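/- Let $r\ge 0$ be an integer and work over the field $\mathbb{C}(q)$. **The shifted quantum affine algebra.** Let $U=U_q^{(-2r-2)}$ be the shifted quantum affine algebra of $\mathfrak{sl}_2$ with shift $\mu=-(2r+2)\omega$ ($\omega$ the fundamental coweight): the associative unital $\mathbb{C}(q)$-algebra generated by $e_p,f_p$ ($p\in\mathbb{Z}$), $\psi^+_s$ ($s\ge 0$), $\psi^-_{-s}$ ($s\ge 2r+2$), $(\psi^+_0)^{-1}$, $(\psi^-_{-2r-2})^{-1}$, with the relations, for $e(z)=\sum_p e_pz^{-p}$, $f(z)=\sum_p f_pz^{-p}$, $\psi^{+}(z)=\sum_{s\ge0}\psi^+_sz^{-s}$, $\psi^-(z)=\sum_{s\ge 2r+2}\psi^-_{-s}z^{s}$, $\delta(z)=\sum_{s\in\mathbb Z}z^s$ and $\epsilon,\epsilon'\in\{\pm\}$: all $\psi^{\epsilon}(z),\psi^{\epsilon'}(w)$ commute, $(\psi^+_0)^{\pm1}(\psi^+_0)^{\mp1}=1=(\psi^-_{-2r-2})^{\pm1}(\psi^-_{-2r-2})^{\mp1}$, $$(z-q^2w)e(z)e(w)=(q^2z-w)e(w)e(z),\qquad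 (q^2z-w)f(z)f(w)=(z-q^2w)f(w)f(z),$$ $$(z-q^2w)\psi^\epsilon(z)e(w)=(q^2z-w)e(w)\psi^\epsilon(z),\qquad (q^2z-w)\psi^\epsilon(z)f(w)=(z-q^2w)f(w)\psi^\epsilon(z),$$ $$[e(z),f(w)]=\frac{1}{q-q^{-1}}\,\delta(z/w)\,\bigl(\psi^+(z)-\psi^-(z)\bigr).$$ Let $U^>$ be the algebra generated by $e_p$ ($p\in\mathbb{Z}$) with the relation $(z-q^2w)e(z)e(w)=(q^2z-w)e(w)e(z)$ only; there is the natural homomorphism $U^>\to U$, $e_p\mapsto e_p$. **Difference operators.** Let $\tilde{\mathcal A}$ be the $\mathbb{C}(q)$-algebra generated by $D_i^{\pm1},\mathsf w_i^{\pm1/2}$ ($1\le i\le r+1$), in which the $D_i$ commute with each other, the $\mathsf w_i^{1/2}$ commute with each other and $D_i\mathsf w_j^{1/2}=q^{\delta_{ij}}\mathsf w_j^{1/2}D_i$, localized at the elements $\mathsf w_i-q^m\mathsf w_j$ ($i\ne j$, $m\in\mathbb{Z}$). Put $W(z)=\prod_t(1-\mathsf w_t/z)$ and $W_i(z)=\prod_{t\ne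 i}(1-\mathsf w_t/z)$. **Shuffle algebra.** Let $\mathbb S=\bigoplus_{k\ge0}\mathbb S_k$, where $\mathbb S_k$ is the space of symmetric Laurent polynomials in $x_1,\dots,x_k$ over $\mathbb{C}(q)$, with the product of $F\in\mathbb S_k$ and $G\in\mathbb S_l$ $$F\star G=\frac1{k!\,l!}\sum_{\sigma\in S_{k+l}}\sigma\Bigl(F(x_1,\dots,x_k)\,G(x_{k+1},\dots,x_{k+l})\prod_{i\le k<j}\frac{x_i-q^{-2}x_j}{x_i-x_j}\Bigr),$$ where $\sigma$ acts by $x_i\mapsto x_{\sigma(i)}$. Set $E_{k,n}=\prod_{1\le i\le k}x_i^n\prod_{1\le i\ne j\le k}(x_i-q^{-2}x_j)\in\mathbb S_k$. **Statement.** There is a unique $\mathbb{C}(q)$-algebra homomorphism $\tilde\Phi\colon U\to\tilde{\mathcal A}$ with $$e_p\mapsto\frac{-q}{1-q^2}\prod_t\mathsf w_t\sum_{i=1}^{r+1}\frac{\mathsf w_i^p}{W_i(\mathsf w_i)}D_i^{-1},\qquad f_p\mapsto\frac1{1-q^2}\sum_{i=1}^{r+1}\frac{(q^2\mathsf w_i)^p}{W_i(\mathsf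 w_i)}D_i,\qquad \psi^\pm(z)\mapsto\prod_t\mathsf w_t\cdot\Bigl(\frac{1}{W(z)W(q^{-2}z)}\Bigr)^{\pm},$$ where $(\cdot)^\pm$ is the expansion in powers of $z^{\mp1}$, and a unique $\mathbb{C}(q)$-algebra homomorphism $\Upsilon\colon U^>\to\mathbb S$ with $e_p\mapsto x_1^p$. Every $E_{r+1,n}$ ($n\in\mathbb Z$) lies in the image of $\Upsilon$. Moreover, for every $n\in\mathbb{Z}$ and all $u_0,u_1\in U^>$ with $\Upsilon(u_0)=E_{r+1,n}$ and $\Upsilon(u_1)=E_{r+1,n+1}$ (that is, $u_0=\Upsilon^{-1}(E_{r+1,n})$ and $u_1=\Upsilon^{-1}(E_{r+1,n+1})$): the elements $\tilde\Phi(u_0),\tilde\Phi(u_1)$ belong to the subalgebra of $\tilde{\mathcal A}$ generated by $\{\tilde\Phi(e_p)\}_{p=n}^{n+2r+1}$, they are invertible in $\tilde{\mathcal A}$, and the localization of this subalgebra at them, i.e. the $\mathbb{C}(q)$-subalgebra of $\tilde{\mathcal A}$ generated by $$\{\tilde\Phi(e_p)\}_{p=n}^{n+2r+1}\cup\{\tilde\Phi(u_0)^{-1},\tilde\Phi(u_1)^{-1}\},$$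 coincides with the whole image $\tilde\Phi(U)$. -/

import Mathlib

open scoped Nat

noncomputable section

namespace ShiftedSl2

/-- The ground field `ℂ(q)`. -/
abbrev Cq : Type := RatFunc ℂ

/-- The quantum parameter `q`. -/
def q : Cq := RatFunc.X

/-! ### The shifted quantum affine algebra of `sl₂` -/

/-- Generators of the shifted quantum affine algebra `U^{(b)} = U^{sc}_{0,b}` of `sl₂`.
`psiP s` stands for `ψ⁺_s`, `psiM s` stands for `ψ⁻_{b-s}` (`s ≥ 0`), and
`psiPInv`, `psiMInv` stand for the inverses of `ψ⁺_0` and `ψ⁻_b`. -/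
inductive UGen : Type
  | e (p : ℤ) : UGen
  | f (p : ℤ) : UGen
  | psiP (s : ℕ) : UGen
  | psiM (s : ℕ) : UGen
  | psiPInv : UGen
  | psiMInv : UGen

namespace UFree

/-- The mode `e_p` in the free algebra. -/
def e (p : ℤ) : FreeAlgebra Cq UGen := FreeAlgebra.ι Cq (UGen.e p)

/-- The mode `f_p` in the free algebra. -/
def f (p : ℤ) : FreeAlgebra Cq UGen := FreeAlgebra.ι Cq (UGen.f p)

/-- The mode `ψ^ε_s`, `s ∈ ℤ`, in the free algebra (`ε = true` for `+`, `ε = false` for `-`):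
`ψ⁺_s` is zero unless `s ≥ 0`, and `ψ⁻_s` is zero unless `s ≤ b`. -/
def psi (b : ℤ) (ε : Bool) (s : ℤ) : FreeAlgebra Cq UGen :=
  match ε with
  | true => if 0 ≤ s then FreeAlgebra.ι Cq (UGen.psiP s.toNat) else 0
  | false => if s ≤ b then FreeAlgebra.ι Cq (UGen.psiM (b - s).toNat) else 0

end UFree

open UFree in
/-- The defining relations of `U^{(b)}`, written for the coefficients of the currents
`e(z) = ∑ e_p z^{-p}`, `f(z) = ∑ f_p z^{-p}`, `ψ⁺(z) = ∑_{s ≥ 0} ψ⁺_s z^{-s}`,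
`ψ⁻(z) = ∑_{s ≤ b} ψ⁻_s z^{-s}`:
* `[ψ^ε(z), ψ^ε'(w)] = 0`, and `ψ⁺_0`, `ψ⁻_b` are invertible;
* `(z - q²w) e(z) e(w) = (q²z - w) e(w) e(z)`;
* `(q²z - w) f(z) f(w) = (z - q²w) f(w) f(z)`;
* `(z - q²w) ψ^ε(z) e(w) = (q²z - w) e(w) ψ^ε(z)`;
* `(q²z - w) ψ^ε(z) f(w) = (z - q²w) f(w) ψ^ε(z)`;
* `[e(z), f(w)] = (q - q⁻¹)⁻¹ δ(z/w) (ψ⁺(z) - ψ⁻(z))`. -/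
inductive URel (b : ℤ) : FreeAlgebra Cq UGen → FreeAlgebra Cq UGen → Prop
  | psi_psi (ε ε' : Bool) (s t : ℤ) :
      URel b (psi b ε s * psi b ε' t) (psi b ε' t * psi b ε s)
  | psiP_mul_inv : URel b (psi b true 0 * FreeAlgebra.ι Cq UGen.psiPInv) 1
  | psiP_inv_mul : URel b (FreeAlgebra.ι Cq UGen.psiPInv * psi b true 0) 1
  | psiM_mul_inv : URel b (psi b false b * FreeAlgebra.ι Cq UGen.psiMInv) 1
  | psiM_inv_mul : URel b (FreeAlgebra.ι Cq UGen.psiMInv * psi b false b) 1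
  | e_e (m n : ℤ) :
      URel b (e (m + 1) * e n - q ^ 2 • (e m * e (n + 1)))
        (q ^ 2 • (e n * e (m + 1)) - e (n + 1) * e m)
  | f_f (m n : ℤ) :
      URel b (q ^ 2 • (f (m + 1) * f n) - f m * f (n + 1))
        (f n * f (m + 1) - q ^ 2 • (f (n + 1) * f m))
  | psi_e (ε : Bool) (m n : ℤ) :
      URel b (psi b ε (m + 1) * e n - q ^ 2 • (psi b ε m * e (n + 1)))
        (q ^ 2 • (e n * psi b ε (m + 1)) - e (n + 1) * psi b ε m)
  | psi_f (ε : Bool) (m n : ℤ) :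
      URel b (q ^ 2 • (psi b ε (m + 1) * f n) - psi b ε m * f (n + 1))
        (f n * psi b ε (m + 1) - q ^ 2 • (f (n + 1) * psi b ε m))
  | e_f (m n : ℤ) :
      URel b (e m * f n - f n * e m)
        ((q - q⁻¹)⁻¹ • (psi b true (m + n) - psi b false (m + n)))

/-- The shifted quantum affine algebra `U^{(b)} = U^{sc}_{0,b}` of `sl₂` over `ℂ(q)`. -/
abbrev U (b : ℤ) : Type := RingQuot (URel b)

/-- The image of a generator in `U^{(b)}`. -/
def U.gen (b : ℤ) (g : UGen) : U b := RingQuot.mkAlgHom Cq (URel b) (FreeAlgebra.ι Cq g)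

/-! ### The positive half -/

/-- The quadratic relations of the positive half. -/
inductive UPosRel : FreeAlgebra Cq ℤ → FreeAlgebra Cq ℤ → Prop
  | e_e (m n : ℤ) :
      UPosRel
        (FreeAlgebra.ι Cq (m + 1) * FreeAlgebra.ι Cq n
          - q ^ 2 • (FreeAlgebra.ι Cq m * FreeAlgebra.ι Cq (n + 1)))
        (q ^ 2 • (FreeAlgebra.ι Cq n * FreeAlgebra.ι Cq (m + 1))
          - FreeAlgebra.ι Cq (n + 1) * FreeAlgebra.ι Cq m)

/-- The positive half `U^>_q(L sl₂)`: generators `e_p` (`p ∈ ℤ`), relations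
`(z - q²w) e(z) e(w) = (q²z - w) e(w) e(z)`. -/
abbrev UPos : Type := RingQuot UPosRel

/-- The generator `e_p` of `U^>_q(L sl₂)`. -/
def UPos.e (p : ℤ) : UPos := RingQuot.mkAlgHom Cq UPosRel (FreeAlgebra.ι Cq p)

/-- The natural homomorphism `U^>_q(L sl₂) → U^{(b)}`, `e_p ↦ e_p`. -/
def UPos.toU (b : ℤ) : UPos →ₐ[Cq] U b :=
  RingQuot.liftAlgHom Cq
    ⟨FreeAlgebra.lift Cq (fun p : ℤ => U.gen b (UGen.e p)), by
      rintro _ _ ⟨m, n⟩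
      have h := RingQuot.mkAlgHom_rel Cq (URel.e_e (b := b) m n)
      simpa [U.gen, UFree.e] using h⟩

/-! ### Localized difference operators -/

/-- Generators of the algebra of localized difference operators in `a` variables:
`D_i`, `D_i⁻¹`, `w_i^{1/2}`, `w_i^{-1/2}` and `(w_i - q^m w_j)⁻¹` for `i ≠ j`, `m ∈ ℤ`. -/
inductive AGen (a : ℕ) : Type
  | D (i : Fin a) : AGen a
  | DInv (i : Fin a) : AGen a
  | v (i : Fin a) : AGen a
  | vInv (i : Fin a) : AGen a
  | dInv (i j : Fin a) (h : i ≠ j) (m : ℤ) : AGen a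

/-- The element `w_i - q^m w_j` in the free algebra, where `w_i = (w_i^{1/2})²`. -/
def AFree.diff {a : ℕ} (i j : Fin a) (m : ℤ) : FreeAlgebra Cq (AGen a) :=
  FreeAlgebra.ι Cq (AGen.v i) ^ 2 - q ^ m • FreeAlgebra.ι Cq (AGen.v j) ^ 2

open FreeAlgebra in
/-- Relations: the `D`'s commute, the `w^{1/2}`'s commute, `D_i w_j^{1/2} = q^{δ_ij} w_j^{1/2} D_i`,
and `D_i`, `w_i^{1/2}`, `w_i - q^m w_j` (`i ≠ j`) are inverted. -/
inductive ARel (a : ℕ) : FreeAlgebra Cq (AGen a) → FreeAlgebra Cq (AGen a) → Prop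
  | D_D (i j : Fin a) : ARel a (ι Cq (.D i) * ι Cq (.D j)) (ι Cq (.D j) * ι Cq (.D i))
  | v_v (i j : Fin a) : ARel a (ι Cq (.v i) * ι Cq (.v j)) (ι Cq (.v j) * ι Cq (.v i))
  | D_mul_inv (i : Fin a) : ARel a (ι Cq (.D i) * ι Cq (.DInv i)) 1
  | D_inv_mul (i : Fin a) : ARel a (ι Cq (.DInv i) * ι Cq (.D i)) 1
  | v_mul_inv (i : Fin a) : ARel a (ι Cq (.v i) * ι Cq (.vInv i)) 1
  | v_inv_mul (i : Fin a) : ARel a (ι Cq (.vInv i) * ι Cq (.v i)) 1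
  | D_v (i j : Fin a) :
      ARel a (ι Cq (.D i) * ι Cq (.v j))
        ((if i = j then q else 1) • (ι Cq (.v j) * ι Cq (.D i)))
  | diff_mul_inv (i j : Fin a) (h : i ≠ j) (m : ℤ) :
      ARel a (AFree.diff i j m * ι Cq (.dInv i j h m)) 1
  | diff_inv_mul (i j : Fin a) (h : i ≠ j) (m : ℤ) :
      ARel a (ι Cq (.dInv i j h m) * AFree.diff i j m) 1

/-- The algebra of difference operators in `a` variables, localized at the elements
`w_i - q^m w_j` (`i ≠ j`, `m ∈ ℤ`). Since these generate an Ore set, adjoining their two-sided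
inverses by generators and relations gives the Ore localization. -/
abbrev A (a : ℕ) : Type := RingQuot (ARel a)

namespace A

variable {a : ℕ}

/-- The image of a generator. -/
def gen (g : AGen a) : A a := RingQuot.mkAlgHom Cq (ARel a) (FreeAlgebra.ι Cq g)

/-- The operator `D_i`. -/
def D (i : Fin a) : A a := gen (.D i)

/-- The operator `D_i⁻¹`. -/
def DInv (i : Fin a) : A a := gen (.DInv i)

theorem v_mul_vInv (i : Fin a) : gen (.v i) * gen (.vInv i) = (1 : A a) := by
  simpa [gen] using RingQuot.mkAlgHom_rel Cq (ARel.v_mul_inv i)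

theorem vInv_mul_v (i : Fin a) : gen (.vInv i) * gen (.v i) = (1 : A a) := by
  simpa [gen] using RingQuot.mkAlgHom_rel Cq (ARel.v_inv_mul i)

/-- The invertible element `w_i = (w_i^{1/2})²`. -/
def w (i : Fin a) : (A a)ˣ := ⟨gen (.v i), gen (.vInv i), v_mul_vInv i, vInv_mul_v i⟩ ^ 2

/-- The product `∏_t w_t`. -/
def wProd (a : ℕ) : A a := (List.ofFn fun t : Fin a => (w t : A a)).prod

/-- The element `1 / W_i(w_i) = ∏_{s ≠ i} (1 - w_s / w_i)⁻¹ = ∏_{s ≠ i} w_i (w_i - w_s)⁻¹`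
(all factors commute, so the order of multiplication is immaterial). -/
def WInv (i : Fin a) : A a :=
  (List.ofFn fun s : Fin a => if h : i ≠ s then (w i : A a) * gen (.dInv i s h 0) else 1).prod

/-- The expansion of `(1 - c/z)⁻¹` in `z⁻¹`, as a power series in the variable `z⁻¹`. -/
def geomInf (c : (A a)ˣ) : PowerSeries (A a) := PowerSeries.mk fun j => ((c ^ j : (A a)ˣ) : A a)

/-- The expansion of `(1 - c/z)⁻¹ = -(z/c) (1 - z/c)⁻¹` in `z`, as a power series in `z`. -/
def geomZero (c : (A a)ˣ) : PowerSeries (A a) :=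
  PowerSeries.mk fun j => if j = 0 then 0 else -((c⁻¹ ^ j : (A a)ˣ) : A a)

theorem q_ne_zero : q ≠ 0 := RatFunc.X_ne_zero

/-- The invertible element `q² w_i`. -/
def qqw (i : Fin a) : (A a)ˣ :=
  Units.map (algebraMap Cq (A a)).toMonoidHom (Units.mk0 q q_ne_zero ^ 2) * w i

/-- The rational function `∏_t w_t / (W(z) W(q⁻²z))` with `W(z) = ∏_t (1 - w_t/z)`,
expanded in powers of `z⁻¹`. -/
def psiInf (a : ℕ) : PowerSeries (A a) :=
  PowerSeries.C (wProd a) * (List.ofFn fun t : Fin a => geomInf (w t) * geomInf (qqw t)).prod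

/-- The rational function `∏_t w_t / (W(z) W(q⁻²z))` with `W(z) = ∏_t (1 - w_t/z)`,
expanded in powers of `z`. -/
def psiZero (a : ℕ) : PowerSeries (A a) :=
  PowerSeries.C (wProd a) * (List.ofFn fun t : Fin a => geomZero (w t) * geomZero (qqw t)).prod

end A

/-! ### The GKLO-type homomorphism -/

/-- `Φ` is the GKLO-type homomorphism for `sl₂`, `λ = 0`, `μ = -(2r+2)ω`, i.e.
* `e(z) ↦ -q/(1-q²) ∏_t w_t ∑_i δ(w_i/z) W_i(w_i)⁻¹ D_i⁻¹`,
* `f(z) ↦ 1/(1-q²) ∑_i δ(q²w_i/z) W_i(w_i)⁻¹ D_i`,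
* `ψ^±(z) ↦ ∏_t w_t · (1/(W(z) W(q⁻²z)))^±`, the expansions in `z^{∓1}`. -/
structure IsGKLO (r : ℕ) (Φ : U (-(2 * r + 2)) →ₐ[Cq] A (r + 1)) : Prop where
  map_e (p : ℤ) : Φ (U.gen _ (.e p)) =
    (-q / (1 - q ^ 2)) • (A.wProd (r + 1) *
      ∑ i : Fin (r + 1), ((A.w i ^ p : (A (r + 1))ˣ) : A (r + 1)) * A.WInv i * A.DInv i)
  map_f (p : ℤ) : Φ (U.gen _ (.f p)) =
    (1 / (1 - q ^ 2)) •
      ∑ i : Fin (r + 1), ((A.qqw i ^ p : (A (r + 1))ˣ) : A (r + 1)) * A.WInv i * A.D i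
  map_psiP (s : ℕ) : Φ (U.gen _ (.psiP s)) = PowerSeries.coeff s (A.psiInf (r + 1))
  map_psiM (s : ℕ) : Φ (U.gen _ (.psiM s)) =
    PowerSeries.coeff (2 * r + 2 + s) (A.psiZero (r + 1))

/-! ### The shuffle algebra of `sl₂` -/

/-- Rational functions in `x_1, …, x_k` over `ℂ(q)`. -/
abbrev RatFun (k : ℕ) : Type := FractionRing (MvPolynomial (Fin k) Cq)

/-- The variable `x_i`. -/
def RatFun.x {k : ℕ} (i : Fin k) : RatFun k := algebraMap (MvPolynomial (Fin k) Cq) _ (MvPolynomial.X i)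

/-- The substitution `x_i ↦ x_{g i}` along an injection `g`. -/
def RatFun.subst {k m : ℕ} (g : Fin k ↪ Fin m) : RatFun k →ₐ[Cq] RatFun m :=
  IsFractionRing.liftAlgHom (A := MvPolynomial (Fin k) Cq)
    (g := (IsScalarTower.toAlgHom Cq (MvPolynomial (Fin m) Cq) (RatFun m)).comp
      (MvPolynomial.rename g))
    ((IsFractionRing.injective (MvPolynomial (Fin m) Cq) (RatFun m)).comp
      (MvPolynomial.rename_injective g g.injective))

/-- Membership in the degree `k` component of the shuffle algebra of `sl₂`:
symmetric Laurent polynomials in `x_1, …, x_k` over `ℂ(q)`. -/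
def RatFun.IsSymmLaurent {k : ℕ} (F : RatFun k) : Prop :=
  (∃ (f : MvPolynomial (Fin k) Cq) (N : ℕ), F = algebraMap _ (RatFun k) f / (∏ i, RatFun.x i) ^ N) ∧
    ∀ σ : Equiv.Perm (Fin k), RatFun.subst σ.toEmbedding F = F

/-- The shuffle product of homogeneous elements,
`(k! l!)⁻¹ Sym (F(x_1,…,x_k) G(x_{k+1},…,x_{k+l}) ∏_{i ≤ k < j} ζ(x_i/x_j))`
with `ζ(z/w) = (z - q⁻²w)/(z - w)`. -/
def RatFun.shuffle {k l : ℕ} (F : RatFun k) (G : RatFun l) : RatFun (k + l) :=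
  ((k ! : RatFun (k + l)) * (l ! : RatFun (k + l)))⁻¹ *
    ∑ σ : Equiv.Perm (Fin (k + l)), RatFun.subst σ.toEmbedding
      (RatFun.subst (Fin.castAddEmb l) F * RatFun.subst (Fin.natAddEmb k) G *
        ∏ i : Fin k, ∏ j : Fin l,
          (RatFun.x (Fin.castAdd l i) - (q ^ 2)⁻¹ • RatFun.x (Fin.natAdd k j)) /
            (RatFun.x (Fin.castAdd l i) - RatFun.x (Fin.natAdd k j)))

/-- The ambient graded space `⨁_k ℂ(q)(x_1,…,x_k)` of the shuffle algebra. -/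
abbrev Graded : Type := Π₀ k : ℕ, RatFun k

open Classical in
/-- The bilinear extension of the shuffle product to graded elements. -/
def Graded.star (F G : Graded) : Graded :=
  F.sum fun k Fk => G.sum fun l Gl => DFinsupp.single (k + l) (RatFun.shuffle Fk Gl)

/-- `Υ` is the homomorphism from `U^>_q(L sl₂)` to the shuffle algebra with `e_p ↦ x_1^p`. -/
structure IsShuffleRealization (Υ : UPos →ₗ[Cq] Graded) : Prop where
  mem (u : UPos) (k : ℕ) : (Υ u k).IsSymmLaurent
  map_one : Υ 1 = DFinsupp.single 0 1
  map_mul (u v : UPos) : Υ (u * v) = (Υ u).star (Υ v)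
  map_e (p : ℤ) : Υ (UPos.e p) = DFinsupp.single 1 (RatFun.x 0 ^ p)

/-- The shuffle element `E_{k,n} = ∏_i x_i^n ∏_{i ≠ j} (x_i - q⁻² x_j)` of degree `k`. -/
def shuffleE (k : ℕ) (n : ℤ) : Graded :=
  DFinsupp.single k
    ((∏ i : Fin k, RatFun.x i ^ n) *
      ∏ i : Fin k, ∏ j ∈ Finset.univ.erase i, (RatFun.x i - (q ^ 2)⁻¹ • RatFun.x j))

end ShiftedSl2

end

open scoped Nat

noncomputable section

namespace ShiftedSl2

/-! ### Labels of coloured words -/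

section Labels

variable {a k : ℕ}

/-! The core is an evaluation formula. Put `t = q^{-2}`, `T_i = D_i^{-1}`, `P = ∏ w_s`. Up to a
scalar, `e_p` acts as `P y_p` with `y_p = ∑_i w_i^p / W_i(w_i) T_i`. A product `y_{p_1} ⋯ y_{p_k}`
expands over colour words `i_1 … i_k`; moving the `T`'s to the right places at position `l` the
point `x_l = t^c w_{i_l}`, where `c` counts the earlier positions of the same colour (`word_prod`).
By telescoping, the coefficient of a word is a symmetric factor times `∏_{m<l} (x_m - t x_l)/(x_m -
x_l)` (`rcoef_mul_vdm`). Words with the same multiplicities are rearrangements of one list of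
points. A rearrangement that does not come from a word has some `t x` in front of `x`, and the
factor `x_m - t x_l` kills it. So the sum over words is a symmetrization over all of `S_k`
(`orbit_sum`): it evaluates the shuffle element at the points. In particular the kernel of `Υ` acts
by zero (`gklo_toU_eq_zero`), so the image of any preimage of `E_{k,n}` is well defined although
injectivity of `Υ` is never proved.

An explicit preimage of `E_{k,n}` uses only the modes `e_n, …, e_{n+2k-2}` (`eLaurent`), and
`E_{k,n}` vanishes at words with a repeated colour. For `k = r+1` this leaves a scalar times
`P^{n+2r+1} ∏ D_i^{-1}`, a unit; two consecutive `n` give `P` and `∏ D_i^{-1}` with their inverses.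
For `k = r` each surviving word omits one colour `j`, and `∏_{i≠j} D_i^{-1} = D_j ∏ D_i^{-1}`, so up
to units one obtains `f_{-(n+2r)}` (`IsInverse.wordSum_eLaurent`). Commuting suitable `e`'s with two
such `f`'s gives `ψ⁺_1` and `ψ⁻_{-2r-3}`; together with `P^{±1}` these shift the modes of `e` and
`f` one step up or down, and the remaining `ψ`'s are commutators (`ops_mem`).

For the existence of `Φ̃`, the quadratic relations are instances of the evaluation formula, the
Cartan relations reduce to identities for each single `i`, and `[e, f]` is a partial fraction
expansion over the poles `w_i, q²w_i`. For `Υ`, words are sent to symmetrized monomials, and the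
kernel of this map is a congruence containing the quadratic relations.

All of this holds over a commutative coefficient ring in which the relevant differences are units,
so no basis of the localized algebra is needed. -/

/-- The number of positions before `u` which have colour `s`. -/
def cnt (i : Fin k → Fin a) (u : ℕ) (s : Fin a) : ℕ :=
  (Finset.univ.filter fun m : Fin k => (m : ℕ) < u ∧ i m = s).card

/-- The label of a position: its colour and its rank among the positions of that colour. -/
def label (i : Fin k → Fin a) (l : Fin k) : Fin a × ℕ := (i l, cnt i l (i l))

/-- The number of positions of each colour. -/
def mult (i : Fin k → Fin a) : Fin a → ℕ := cnt i k

theorem cnt_lt_cnt (i : Fin k → Fin a) {m : Fin k} {u : ℕ} (h : (m : ℕ) < u) :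
    cnt i m (i m) < cnt i u (i m) := by
  refine Finset.card_lt_card (Finset.ssubset_iff_of_subset ?_ |>.2 ⟨m, ?_, ?_⟩)
  · intro x; simp only [Finset.mem_filter, Finset.mem_univ, true_and]; rintro ⟨h1, h2⟩
    exact ⟨h1.trans h, h2⟩
  · simpa using h
  · simp

theorem label_injective (i : Fin k → Fin a) : Function.Injective (label i) := by
  intro l m h
  simp only [label, Prod.mk.injEq] at h
  obtain ⟨h1, h2⟩ := h
  rcases lt_trichotomy l m with hl | hl | hl
  · have := cnt_lt_cnt i (m := l) (u := m) hl
    rw [h2, h1] at this; exact absurd this (lt_irrefl _)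
  · exact hl
  · have := cnt_lt_cnt i (m := m) (u := l) hl
    rw [← h2, h1] at this; exact absurd this (lt_irrefl _)

/-- Ranks within one colour are distinct and bounded by the count, hence fill an initial segment of
`ℕ`. -/
theorem image_cnt (i : Fin k → Fin a) (u : ℕ) (s : Fin a) :
    (Finset.univ.filter fun m : Fin k => (m : ℕ) < u ∧ i m = s).image (fun m : Fin k => cnt i m s) =
      Finset.range (cnt i u s) := by
  refine Finset.eq_of_subset_of_card_le ?_ ?_
  · intro c; simp only [Finset.mem_image, Finset.mem_filter, Finset.mem_univ, true_and,
      Finset.mem_range]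
    rintro ⟨m, ⟨h1, rfl⟩, rfl⟩
    exact cnt_lt_cnt i h1
  · rw [Finset.card_image_of_injOn, Finset.card_range, cnt]
    intro x hx y hy hxy
    simp only [Finset.coe_filter, Finset.mem_univ, true_and, Set.mem_ofPred_eq] at hx hy
    refine label_injective i ?_
    simp only [label, hx.2, hy.2, Prod.mk.injEq, true_and]; exact hxy

theorem exists_label_of_lt (i : Fin k → Fin a) {u : ℕ} {s : Fin a} {c : ℕ} (h : c < cnt i u s) :
    ∃ m : Fin k, (m : ℕ) < u ∧ label i m = (s, c) := by
  have := (image_cnt i u s).symm ▸ Finset.mem_range.2 h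
  simp only [Finset.mem_image, Finset.mem_filter, Finset.mem_univ, true_and] at this
  obtain ⟨m, ⟨h1, rfl⟩, rfl⟩ := this
  exact ⟨m, h1, rfl⟩

theorem mem_range_label (i : Fin k → Fin a) (x : Fin a × ℕ) :
    x ∈ Set.range (label i) ↔ x.2 < mult i x.1 := by
  constructor
  · rintro ⟨l, rfl⟩; exact cnt_lt_cnt i l.2
  · intro h; obtain ⟨m, -, hm⟩ := exists_label_of_lt i h; exact ⟨m, hm⟩

/-- The set of labels is `{(s, c) | c < mult s}`, so it depends only on the multiplicities, and
labels are distinct. -/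
theorem exists_perm_label {i j : Fin k → Fin a} (h : mult i = mult j) :
    ∃ τ : Equiv.Perm (Fin k), label j = label i ∘ τ := by
  have hr : Set.range (label j) = Set.range (label i) := by
    ext x; rw [mem_range_label, mem_range_label, h]
  refine ⟨(Equiv.ofInjective _ (label_injective j)).trans
    ((Equiv.setCongr hr).trans (Equiv.ofInjective _ (label_injective i)).symm), ?_⟩
  funext l
  simp only [Function.comp_apply, Equiv.trans_apply]
  rw [Equiv.apply_ofInjective_symm (label_injective i)]; rfl

theorem mult_comp (i : Fin k → Fin a) (τ : Equiv.Perm (Fin k)) : mult (i ∘ τ) = mult i := by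
  funext s
  unfold mult cnt
  refine Finset.card_bij (fun m _ => τ m) ?_ ?_ ?_
  · intro m; simp
  · intro x _ y _ h; exact τ.injective h
  · intro m hm; refine ⟨τ.symm m, ?_, by simp⟩; simpa using hm

/-- A permutation which does not preserve the order of the positions of the same colour
exchanges two consecutive ones. -/
theorem exists_lt_of_label_comp_ne (i : Fin k → Fin a) (τ : Equiv.Perm (Fin k))
    (h : label (i ∘ τ) ≠ label i ∘ τ) :
    ∃ l m : Fin k, l < m ∧ ∃ x c, label i (τ l) = (x, c + 1) ∧ label i (τ m) = (x, c) := by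
  by_contra! H
  apply h
  funext l
  simp only [label, Function.comp_apply, Prod.mk.injEq, true_and]
  set x := i (τ l) with hx
  -- If no consecutive ranks are exchanged, order is preserved across every rank gap, by induction
  -- on the gap.
  have key : ∀ d (l m : Fin k) c, label i (τ l) = (x, c) → label i (τ m) = (x, c + d + 1) →
      l < m := by
    intro d
    induction d with
    | zero =>
      intro l m c hl hm
      rcases lt_trichotomy l m with h1 | h1 | h1
      · exact h1
      · subst h1; rw [hl] at hm; simp at hm
      · exact absurd hl (H m l h1 x c hm)
    | succ d ih =>
      intro l m c hl hm
      have h1 : c + d + 1 < mult i x := by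
        have : (x, c + (d + 1) + 1) ∈ Set.range (label i) := ⟨_, hm⟩
        rw [mem_range_label] at this; simp only at this ⊢; omega
      obtain ⟨n, hn⟩ := (mem_range_label i (x, c + d + 1)).2 h1
      have h2 := ih l (τ.symm n) c hl (by simpa using hn)
      refine h2.trans ?_
      rcases lt_trichotomy (τ.symm n) m with h3 | h3 | h3
      · exact h3
      · rw [← h3] at hm; simp [hn] at hm
      · exact absurd (by simpa using hn) (H m _ h3 x (c + d + 1) (by rw [hm]; rfl))
  have key' : ∀ m : Fin k, i (τ m) = x → (m < l ↔ cnt i (τ m) x < cnt i (τ l) x) := by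
    intro m hm
    have e1 : label i (τ m) = (x, cnt i (τ m) x) := by simp [label, hm]
    have e2 : label i (τ l) = (x, cnt i (τ l) x) := by simp [label, hx]
    constructor
    · intro hlt
      by_contra! hle
      rcases hle.eq_or_lt with h1 | h1
      · rw [← h1, ← e2] at e1
        exact hlt.ne (τ.injective (label_injective i e1))
      · obtain ⟨d, hd⟩ := Nat.exists_eq_add_of_lt h1
        exact absurd (key d l m _ e2 (by rw [e1, hd])) (lt_asymm hlt)
    · intro h1
      obtain ⟨d, hd⟩ := Nat.exists_eq_add_of_lt h1
      exact key d m l _ e1 (by rw [e2, hd])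
  · unfold cnt
    refine Finset.card_bij (fun m _ => τ m) ?_ ?_ ?_
    · intro m
      simp only [Finset.mem_filter, Finset.mem_univ, true_and, Function.comp_apply]
      rintro ⟨h1, h2⟩
      refine ⟨?_, h2⟩
      by_contra! h3
      have h4 := (key' m h2).1 (by simpa using h1)
      rcases h3.eq_or_lt with h5 | h5
      · rw [h5] at h4; exact lt_irrefl _ h4
      · have := cnt_lt_cnt i (m := τ l) (u := τ m) h5
        rw [← hx] at this; omega
    · intro x _ y _ h; exact τ.injective h
    · intro m
      simp only [Finset.mem_filter, Finset.mem_univ, true_and, Function.comp_apply]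
      rintro ⟨h1, h2⟩
      refine ⟨τ.symm m, ⟨?_, by simpa using h2⟩, by simp⟩
      refine (key' _ (by simpa using h2)).2 ?_
      have := cnt_lt_cnt i (m := m) (u := τ l) h1
      rw [h2] at this; simpa using this

theorem cnt_cons_zero (j : Fin a) (i : Fin k → Fin a) (s : Fin a) :
    cnt (Fin.cons j i : Fin (k + 1) → Fin a) 0 s = 0 := by
  simp [cnt]

theorem cnt_cons_succ (j : Fin a) (i : Fin k → Fin a) (u : ℕ) (s : Fin a) :
    cnt (Fin.cons j i : Fin (k + 1) → Fin a) (u + 1) s = cnt i u s + if j = s then 1 else 0 := by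
  simp only [cnt, Finset.card_filter, Fin.sum_univ_succ, Fin.cons_zero, Fin.cons_succ]
  simp [add_comm]

end Labels

/-! ### Products over pairs and antisymmetrization -/

section Pairs

variable {k : ℕ}

/-- A permutation of the positions permutes the unordered pairs, and a symmetric factor does not see
the order within a pair. -/
theorem prod_Iio_comp_perm {M : Type*} [CommMonoid M] (σ : Equiv.Perm (Fin k))
    {g : Fin k → Fin k → M} (hg : ∀ i j, g i j = g j i) :
    ∏ j, ∏ i ∈ Finset.Iio j, g (σ i) (σ j) = ∏ j, ∏ i ∈ Finset.Iio j, g i j := by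
  simp_rw [Finset.prod_sigma']
  set D := (Finset.univ : Finset (Fin k)).sigma Finset.Iio with hD
  have hφD : D.image (fun x ↦ ⟨σ x.1 ⊔ σ x.2, σ x.1 ⊓ σ x.2⟩) = D := by
    ext ⟨x1, x2⟩
    suffices (∃ a, ∃ b < a, σ a ⊔ σ b = x1 ∧ σ a ⊓ σ b = x2) ↔ x2 < x1 by simpa [hD]
    refine ⟨?_, fun hlt ↦ ?_⟩
    · rintro ⟨i, j, hij, rfl, rfl⟩
      exact inf_le_sup.lt_of_ne <| by simp [hij.ne.symm]
    obtain hlt' | hle := lt_or_ge (σ.symm x1) (σ.symm x2)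
    · exact ⟨_, _, hlt', by simp [hlt.le]⟩
    exact ⟨_, _, hle.lt_of_ne (by simp [hlt.ne]), by simp [hlt.le]⟩
  nth_rw 2 [← hφD]
  rw [Finset.prod_image fun x hx y hy ↦ Finset.injOn_of_card_image_eq (by rw [hφD]) hx hy]
  refine Finset.prod_congr rfl fun ⟨x₁, x₂⟩ hx ↦ ?_
  obtain hlt | hle := lt_or_ge (σ x₁) (σ x₂)
  · simp [inf_eq_left.2 hlt.le, sup_eq_right.2 hlt.le, hg (σ x₂)]
  · simp [inf_eq_right.2 hle, sup_eq_left.2 hle]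

theorem prod_erase_eq_prod_Iio {M : Type*} [CommMonoid M] (g : Fin k → Fin k → M) :
    ∏ i, ∏ j ∈ Finset.univ.erase i, g i j = ∏ j, ∏ i ∈ Finset.Iio j, (g i j * g j i) := by
  have h1 : ∀ i : Fin k, ∏ j ∈ Finset.univ.erase i, g i j =
      (∏ j ∈ Finset.Iio i, g i j) * ∏ j ∈ Finset.Ioi i, g i j := by
    intro i
    rw [← Finset.prod_union]
    · congr 1; ext j; simp [lt_or_lt_iff_ne]
    · rw [Finset.disjoint_left]; intro j; simp only [Finset.mem_Iio, Finset.mem_Ioi]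
      exact fun h => h.not_gt
  simp_rw [h1, Finset.prod_mul_distrib]
  rw [mul_comm]
  congr 1
  exact Finset.prod_comm' (by simp)

variable {K B : Type*} [Field K] [CommRing B] [Algebra K B]

/-- The product `∏_{i<j} (x_i - t x_j)`. -/
def zProd (t : K) (x : Fin k → B) : B := ∏ j, ∏ i ∈ Finset.Iio j, (x i - t • x j)

/-- The product `∏_{i<j} (x_i - x_j)`. -/
def vdm (x : Fin k → B) : B := ∏ j, ∏ i ∈ Finset.Iio j, (x i - x j)

theorem vdm_comp (x : Fin k → B) (σ : Equiv.Perm (Fin k)) :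
    vdm (x ∘ σ) = (Equiv.Perm.sign σ : ℤ) * vdm x :=
  σ.prod_Iio_comp_eq_sign_mul_prod (f := fun i j => x i - x j) (by simp)

theorem map_zProd {B' : Type*} [CommRing B'] [Algebra K B'] (f : B →ₐ[K] B') (t : K)
    (x : Fin k → B) : f (zProd t x) = zProd t (f ∘ x) := by
  simp [zProd, map_prod]

theorem map_vdm {B' : Type*} [CommRing B'] (f : B →+* B')
    (x : Fin k → B) : f (vdm x) = vdm (f ∘ x) := by
  simp [vdm, map_prod]

/-- The polynomial `∏_{i<j} (t x_i - x_j) ∏_i x_i^i`. -/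
def ePoly (t : K) (x : Fin k → B) : B :=
  (∏ j, ∏ i ∈ Finset.Iio j, (t • x i - x j)) * ∏ i, x i ^ (i : ℕ)

theorem map_ePoly {B' : Type*} [CommRing B'] [Algebra K B'] (f : B →ₐ[K] B') (t : K)
    (x : Fin k → B) : f (ePoly t x) = ePoly t (f ∘ x) := by
  simp [ePoly, map_prod]

theorem sum_sign_prod_pow (x : Fin k → B) :
    ∑ σ : Equiv.Perm (Fin k), ((Equiv.Perm.sign σ : ℤ) : B) * ∏ i, x (σ i) ^ (i : ℕ) =
      ∏ j, ∏ i ∈ Finset.Iio j, (x j - x i) := by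
  have h := Matrix.det_vandermonde x
  rw [Matrix.det_apply'] at h
  simp only [Matrix.vandermonde_apply] at h
  rw [h]
  exact Finset.prod_comm' (by simp)

/-- The factor `∏ (t x_i - x_j)` completes `zProd` to a symmetric product, so antisymmetrization
acts only on the staircase monomial `∏ x_i^i` and yields a Vandermonde determinant. This produces
the explicit preimage of `E_{k,n}`. -/
theorem antisymm_ePoly (t : K) (x : Fin k → B) :
    ∑ σ : Equiv.Perm (Fin k), ((Equiv.Perm.sign σ : ℤ) : B) *
        (ePoly t (x ∘ σ) * zProd t (x ∘ σ)) =
      (∏ i, ∏ j ∈ Finset.univ.erase i, (x i - t • x j)) * vdm x := by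
  have h1 : ∀ σ : Equiv.Perm (Fin k), ((Equiv.Perm.sign σ : ℤ) : B) *
        (ePoly t (x ∘ σ) * zProd t (x ∘ σ)) =
      (∏ j, ∏ i ∈ Finset.Iio j, ((t • x i - x j) * (x i - t • x j))) *
        (((Equiv.Perm.sign σ : ℤ) : B) * ∏ i, x (σ i) ^ (i : ℕ)) := by
    intro σ
    rw [← prod_Iio_comp_perm σ (by intro i j; ring)]
    simp only [ePoly, zProd, Finset.prod_mul_distrib, Function.comp_apply]
    ring
  simp_rw [h1, ← Finset.mul_sum, sum_sign_prod_pow, prod_erase_eq_prod_Iio, vdm,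
    ← Finset.prod_mul_distrib]
  refine Finset.prod_congr rfl fun j _ => Finset.prod_congr rfl fun i _ => ?_
  ring

/-- Evaluation of a Laurent polynomial at invertible elements. -/
def ev (x : Fin k → Bˣ) (f : (Fin k → ℤ) →₀ K) : B :=
  f.sum fun p c => c • ∏ l, ((x l ^ p l : Bˣ) : B)

/-- The noncommutative evaluation `x^p ↦ y_{p_1} ⋯ y_{p_k}` of a Laurent polynomial. -/
def wordSum {R : Type*} [Ring R] [Algebra K R] (y : ℤ → R) (f : (Fin k → ℤ) →₀ K) : R :=
  f.sum fun p c => c • (List.ofFn fun l => y (p l)).prod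

end Pairs

/-! ### Difference operators with coefficients in a commutative ring -/

section Inverse

theorem map_inverse {B B' F : Type*} [MonoidWithZero B] [MonoidWithZero B'] [FunLike F B B']
    [MonoidHomClass F B B'] (f : F) {x : B}
    (hx : IsUnit x) : f (Ring.inverse x) = Ring.inverse (f x) := by
  obtain ⟨u, rfl⟩ := hx
  rw [Ring.inverse_unit]
  have : f (u : B) = (Units.map (f : B →* B') u : B'ˣ) := rfl
  rw [this, Ring.inverse_unit, ← map_inv]; rfl

theorem eq_inverse_of_mul_eq_one {B : Type*} [CommMonoidWithZero B] {x y : B} (h : x * y = 1) :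
    y = Ring.inverse x := by
  have hx : IsUnit x := IsUnit.of_mul_eq_one _ h
  calc y = Ring.inverse x * (x * y) := by rw [← mul_assoc, Ring.inverse_mul_cancel _ hx, one_mul]
    _ = _ := by rw [h, mul_one]

end Inverse

/-- Invertible operators `T_i` acting on the commutative ring `C` generated by
invertible elements `w_i` by `T_i w_j = t^{δ_ij} w_j T_i`. -/
structure DiffOps (K : Type*) [Field K] (a : ℕ) (C R : Type*) [CommRing C] [Algebra K C]
    [Ring R] [Algebra K R] where
  ι : C →ₐ[K] R
  w : Fin a → Cˣ
  t : K
  T : Fin a → Rˣ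
  τ : Fin a → C →ₐ[K] C
  t_ne : t ≠ 0
  pow_inj : Function.Injective fun n : ℕ => t ^ n
  T_comm : ∀ i j, Commute (T i : R) (T j)
  T_mul : ∀ i c, (T i : R) * ι c = ι (τ i c) * T i
  τ_w : ∀ i j, τ i (w j) = (if i = j then t else 1) • (w j : C)
  isUnit_sub : ∀ i j, i ≠ j → ∀ m : ℤ, IsUnit ((w i : C) - t ^ m • (w j : C))

namespace DiffOps

variable {K : Type*} [Field K] {a : ℕ} {C R : Type*} [CommRing C] [Algebra K C]
  [Ring R] [Algebra K R] (S : DiffOps K a C R) {k : ℕ}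

/-- The point `t^c w_s`. -/
def pt (x : Fin a × ℕ) : Cˣ :=
  Units.map (algebraMap K C).toMonoidHom (Units.mk0 (S.t ^ x.2) (pow_ne_zero _ S.t_ne)) * S.w x.1

theorem pt_val (x : Fin a × ℕ) : (S.pt x : C) = S.t ^ x.2 • (S.w x.1 : C) := by
  simp [pt, Algebra.smul_def]

theorem smul_pt (x : Fin a × ℕ) : S.t • (S.pt x : C) = S.pt (x.1, x.2 + 1) := by
  rw [pt_val, pt_val, smul_smul, pow_succ']

theorem isUnit_smul_iff {c : K} (hc : c ≠ 0) {x : C} : IsUnit (c • x) ↔ IsUnit x := by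
  rw [Algebra.smul_def, IsUnit.mul_iff]
  exact ⟨fun h => h.2, fun h => ⟨(IsUnit.mk0 c hc).map _, h⟩⟩

/-- For equal colours the difference is a nonzero scalar times `w_s`; for different colours a power
of `t` factors out of some `w_i - t^m w_j`. Every denominator below is therefore a unit, without a
field. -/
theorem isUnit_pt_sub {x y : Fin a × ℕ} (h : x ≠ y) : IsUnit ((S.pt x : C) - S.pt y) := by
  rw [pt_val, pt_val]
  by_cases h1 : x.1 = y.1
  · have h2 : x.2 ≠ y.2 := fun h2 => h (Prod.ext h1 h2)
    rw [h1, ← sub_smul, isUnit_smul_iff]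
    · exact Units.isUnit _
    · exact sub_ne_zero.2 fun h3 => h2 (S.pow_inj h3)
  · have : S.t ^ x.2 • (S.w x.1 : C) - S.t ^ y.2 • (S.w y.1 : C) =
        S.t ^ x.2 • ((S.w x.1 : C) - S.t ^ ((y.2 : ℤ) - x.2) • (S.w y.1 : C)) := by
      rw [smul_sub, smul_smul, ← zpow_natCast, ← zpow_natCast, ← zpow_add₀ S.t_ne]
      congr; ring
    rw [this, isUnit_smul_iff (pow_ne_zero _ S.t_ne)]
    exact S.isUnit_sub _ _ h1 _

theorem isUnit_w_sub {i j : Fin a} (h : i ≠ j) : IsUnit ((S.w i : C) - S.w j) := by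
  simpa using S.isUnit_sub i j h 0

theorem τ_pt (j : Fin a) (x : Fin a × ℕ) :
    S.τ j (S.pt x) = S.pt (x.1, x.2 + if j = x.1 then 1 else 0) := by
  rw [pt_val, pt_val, map_smul, S.τ_w]
  split_ifs with h <;> simp [smul_smul, pow_succ]

/-- The element `1 / W_i(w_i)`. -/
def WI (i : Fin a) : C :=
  ∏ s ∈ Finset.univ.erase i, (S.w i : C) * Ring.inverse ((S.w i : C) - S.w s)

/-- The operators `∑_i w_i^p / W_i(w_i) T_i`. -/
def y (p : ℤ) : R := ∑ i, S.ι (((S.w i ^ p : Cˣ) : C) * S.WI i) * S.T i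

/-- The coefficient of a word in the product of the operators `1 / W_i(w_i) T_i`. -/
def rcoef (i : Fin k → Fin a) : C :=
  ∏ l, ∏ s ∈ Finset.univ.erase (i l),
    (S.pt (label i l) : C) * Ring.inverse ((S.pt (label i l) : C) - S.pt (s, cnt i l s))

/-- The product of the operators `T_{i_l}`. -/
def Tw (i : Fin k → Fin a) : R := (List.ofFn fun l => (S.T (i l) : R)).prod

theorem Tw_comp (i : Fin k → Fin a) (σ : Equiv.Perm (Fin k)) : S.Tw (i ∘ σ) = S.Tw i := by
  refine List.Perm.prod_eq' (σ.ofFn_comp_perm fun l => (S.T (i l) : R)) ?_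
  rw [List.pairwise_ofFn]
  intro l m _
  exact S.T_comm _ _

theorem label_cons_zero (j : Fin a) (i : Fin k → Fin a) :
    label (Fin.cons j i : Fin (k + 1) → Fin a) 0 = (j, 0) := by
  simp [label, cnt_cons_zero]

theorem label_cons_succ (j : Fin a) (i : Fin k → Fin a) (l : Fin k) :
    label (Fin.cons j i : Fin (k + 1) → Fin a) l.succ =
      ((label i l).1, (label i l).2 + if j = (label i l).1 then 1 else 0) := by
  by_cases h : j = i l <;> simp [label, cnt_cons_succ, h]

theorem τ_zpow_pt (j : Fin a) (x : Fin a × ℕ) (p : ℤ) :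
    S.τ j ((S.pt x ^ p : Cˣ) : C) =
      ((S.pt (x.1, x.2 + if j = x.1 then 1 else 0) ^ p : Cˣ) : C) := by
  have h : Units.map (S.τ j : C →* C) (S.pt x) = S.pt (x.1, x.2 + if j = x.1 then 1 else 0) :=
    Units.ext (S.τ_pt j x)
  rw [← h, ← map_zpow]; rfl

/-- Induction on the leftmost letter: moving `T_j` to the right applies `τ_j`, which raises by one
the rank of each position of colour `j`. Prepending `j` to the word changes the labels in the same
way. -/
theorem word_prod (p : Fin k → ℤ) :
    (List.ofFn fun l => S.y (p l)).prod =
      ∑ i : Fin k → Fin a,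
        S.ι ((∏ l, ((S.pt (label i l) ^ p l : Cˣ) : C)) * S.rcoef i) * S.Tw i := by
  induction k with
  | zero => simp [rcoef, Tw]
  | succ k ih =>
    rw [List.ofFn_succ, List.prod_cons, ih, y, Finset.sum_mul_sum,
      ← (Fin.consEquiv fun _ => Fin a).sum_comp, Fintype.sum_prod_type]
    refine Finset.sum_congr rfl fun j _ => Finset.sum_congr rfl fun i _ => ?_
    have hT : S.Tw (Fin.cons j i : Fin (k + 1) → Fin a) = S.T j * S.Tw i := by
      simp [Tw, List.ofFn_succ]
    have hτ : S.τ j (S.rcoef i) = ∏ l : Fin k, ∏ s ∈ Finset.univ.erase (i l),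
        (S.pt (label (Fin.cons j i : Fin (k + 1) → Fin a) l.succ) : C) *
        Ring.inverse ((S.pt (label (Fin.cons j i : Fin (k + 1) → Fin a) l.succ) : C) -
          S.pt (s, cnt (Fin.cons j i : Fin (k + 1) → Fin a) (l.succ : Fin (k + 1)) s)) := by
      rw [rcoef, map_prod]
      refine Finset.prod_congr rfl fun l _ => ?_
      rw [map_prod]
      refine Finset.prod_congr rfl fun s hs => ?_
      rw [map_mul, map_inverse, map_sub, τ_pt, τ_pt, label_cons_succ, Fin.val_succ,
        cnt_cons_succ]
      refine S.isUnit_pt_sub fun h => ?_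
      have := congrArg Prod.fst h
      simp only [label] at this
      rw [← this] at hs; simp at hs
    have hr : S.rcoef (Fin.cons j i : Fin (k + 1) → Fin a) = S.WI j * S.τ j (S.rcoef i) := by
      rw [hτ]
      simp only [rcoef, Fin.prod_univ_succ, Fin.cons_zero, Fin.cons_succ, WI]
      congr 1
      refine Finset.prod_congr rfl fun s _ => ?_
      rw [label_cons_zero, Fin.val_zero, cnt_cons_zero]
      simp [pt_val]
    have hp : S.τ j (∏ l, ((S.pt (label i l) ^ p l.succ : Cˣ) : C)) =
        ∏ l : Fin k, ((S.pt (label (Fin.cons j i : Fin (k + 1) → Fin a) l.succ) ^ p l.succ :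
          Cˣ) : C) := by
      rw [map_prod]
      exact Finset.prod_congr rfl fun l _ => by rw [τ_zpow_pt, label_cons_succ]
    have h0 : S.pt (label (Fin.cons j i : Fin (k + 1) → Fin a) 0) = S.w j := by
      ext; simp [label_cons_zero, pt_val]
    change _ = S.ι ((∏ l, ((S.pt (label (Fin.cons j i : Fin (k + 1) → Fin a) l) ^ p l :
      Cˣ) : C)) * S.rcoef (Fin.cons j i : Fin (k + 1) → Fin a)) *
        S.Tw (Fin.cons j i : Fin (k + 1) → Fin a)
    rw [hT, hr, Fin.prod_univ_succ, h0, ← hp]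
    have e1 : S.ι (((S.w j ^ p 0 : Cˣ) : C) *
        S.τ j (∏ l, ((S.pt (label i l) ^ p l.succ : Cˣ) : C)) *
        (S.WI j * S.τ j (S.rcoef i))) =
        S.ι (((S.w j ^ p 0 : Cˣ) : C) * S.WI j) *
        S.ι (S.τ j ((∏ l, ((S.pt (label i l) ^ p l.succ : Cˣ) : C)) * S.rcoef i)) := by
      rw [← map_mul, map_mul (S.τ j)]; congr 1; ring
    rw [e1, mul_assoc, mul_assoc, ← mul_assoc (S.ι (S.τ j _)), ← S.T_mul, mul_assoc]

theorem wordSum_eq (f : (Fin k → ℤ) →₀ K) :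
    wordSum S.y f = ∑ i : Fin k → Fin a,
      S.ι (ev (fun l => S.pt (label i l)) f * S.rcoef i) * S.Tw i := by
  simp only [wordSum, ev, Finsupp.sum, word_prod, Finset.sum_mul, map_sum, Finset.smul_sum]
  rw [Finset.sum_comm]
  refine Finset.sum_congr rfl fun i _ => Finset.sum_congr rfl fun p _ => ?_
  rw [smul_mul_assoc, map_smul, smul_mul_assoc]

end DiffOps

/-! ### The sum over words as a symmetrization -/

theorem prod_inverse_telescope {B : Type*} [CommMonoidWithZero B] (u : ℕ → B) (n : ℕ)
    (hu : ∀ c, c < n → IsUnit (u c)) :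
    Ring.inverse (u n) =
      Ring.inverse (u 0) * ∏ c ∈ Finset.range n, (u c * Ring.inverse (u (c + 1))) := by
  induction n with
  | zero => simp
  | succ n ih =>
    rw [Finset.prod_range_succ, ← mul_assoc, ← ih fun c hc => hu c (by omega), ← mul_assoc,
      Ring.inverse_mul_cancel _ (hu n (by omega)), one_mul]

theorem prod_filter_cnt {a k : ℕ} {M : Type*} [CommMonoid M] (i : Fin k → Fin a) (u : ℕ)
    (s : Fin a) (F : ℕ → M) :
    ∏ m ∈ (Finset.univ : Finset (Fin k)).filter fun m : Fin k => (m : ℕ) < u ∧ i m = s, F (cnt i m s) = ∏ c ∈ Finset.range (cnt i u s), F c := by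
  rw [← image_cnt, Finset.prod_image]
  intro x hx y hy hxy
  simp only [Finset.coe_filter, Finset.mem_univ, true_and, Set.mem_ofPred_eq] at hx hy
  refine label_injective i ?_
  simp only [label, hx.2, hy.2, Prod.mk.injEq, true_and]; exact hxy

namespace DiffOps

variable {K : Type*} [Field K] {a : ℕ} {C R : Type*} [CommRing C] [Algebra K C]
  [Ring R] [Algebra K R] (S : DiffOps K a C R) {k : ℕ}

/-- The factor of a point in the symmetric part of the coefficient of a word. -/
def bfac (x : Fin a × ℕ) : C :=
  ∏ s ∈ Finset.univ.erase x.1, (S.pt x : C) * Ring.inverse ((S.pt x : C) - S.w s)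

/-- The factor of a pair of points in the symmetric part of the coefficient of a word. -/
def gfac (x y : Fin a × ℕ) : C :=
  if x.1 ≠ y.1 then
    ((S.pt y : C) - S.pt x) * (S.pt x - S.pt y) * Ring.inverse ((S.pt y : C) - S.t • (S.pt x : C)) *
      Ring.inverse ((S.pt x : C) - S.t • (S.pt y : C))
  else if x.2 < y.2 then
    ((S.pt x : C) - S.pt y) * Ring.inverse ((S.pt x : C) - S.t • (S.pt y : C))
  else
    ((S.pt y : C) - S.pt x) * Ring.inverse ((S.pt y : C) - S.t • (S.pt x : C))

theorem gfac_comm (x y : Fin a × ℕ) : S.gfac x y = S.gfac y x := by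
  unfold gfac
  by_cases h : x.1 = y.1
  · rcases lt_trichotomy x.2 y.2 with h2 | h2 | h2
    · simp [h, h2, h2.not_gt]
    · rw [Prod.ext h h2]
    · simp [h, h2, h2.not_gt]
  · have h' : y.1 ≠ x.1 := Ne.symm h
    simp only [ne_eq, h, h', not_false_eq_true, if_true]; ring

/-- The symmetric part of the coefficient of a word. -/
def ccoef (i : Fin k → Fin a) : C :=
  (∏ l, S.bfac (label i l)) * ∏ l, ∏ m ∈ Finset.Iio l, S.gfac (label i m) (label i l)

theorem ccoef_comp (i : Fin k → Fin a) (σ : Equiv.Perm (Fin k))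
    (h : label (i ∘ σ) = label i ∘ σ) : S.ccoef (i ∘ σ) = S.ccoef i := by
  unfold ccoef
  rw [h]
  congr 1
  · exact Equiv.prod_comp σ fun l => S.bfac (label i l)
  · exact prod_Iio_comp_perm σ fun m l => S.gfac_comm (label i m) (label i l)

/-- The points of colour `s` before position `l` are `w_s, t w_s, …`, so `1/(x_l - t^n w_s)`
telescopes into `1/(x_l - w_s)` times the ratios `(x_l - x_m)/(x_l - t x_m)` over those points. The
asymmetry left in the pairs is exactly `zProd / vdm`. -/
theorem rcoef_mul_vdm (i : Fin k → Fin a) :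
    S.rcoef i * vdm (fun l => (S.pt (label i l) : C)) =
      S.ccoef i * zProd S.t (fun l => (S.pt (label i l) : C)) := by
  have h1 : S.rcoef i = (∏ l, S.bfac (label i l)) * ∏ l, ∏ m ∈ Finset.Iio l,
      if i m ≠ i l then ((S.pt (label i l) : C) - S.pt (label i m)) *
        Ring.inverse ((S.pt (label i l) : C) - S.t • (S.pt (label i m) : C)) else 1 := by
    rw [rcoef, ← Finset.prod_mul_distrib]
    refine Finset.prod_congr rfl fun l _ => ?_
    -- Group the earlier positions by colour; multiplying a point by `t` raises its rank by one,
    -- which turns the ratios into a telescoping product.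
    have h2 : (∏ m ∈ Finset.Iio l,
      if i m ≠ i l then ((S.pt (label i l) : C) - S.pt (label i m)) *
        Ring.inverse ((S.pt (label i l) : C) - S.t • (S.pt (label i m) : C)) else 1) =
      ∏ s ∈ Finset.univ.erase (i l), ∏ m ∈ (Finset.univ : Finset (Fin k)).filter fun m : Fin k => (m : ℕ) < l ∧ i m = s,
        (((S.pt (label i l) : C) - S.pt (s, cnt i m s)) *
        Ring.inverse ((S.pt (label i l) : C) - S.pt (s, cnt i m s + 1))) := by
      rw [← Finset.prod_filter,
        ← Finset.prod_fiberwise_of_maps_to (t := Finset.univ.erase (i l)) (g := i)]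
      · refine Finset.prod_congr rfl fun s hs => ?_
        refine Finset.prod_congr ?_ ?_
        · ext m
          simp only [Finset.mem_erase, Finset.mem_univ, and_true] at hs
          simp only [Finset.mem_filter, Finset.mem_Iio, Finset.mem_univ, true_and, Fin.lt_def]
          constructor
          · rintro ⟨⟨h1, -⟩, h2⟩; exact ⟨h1, h2⟩
          · rintro ⟨h1, h2⟩; exact ⟨⟨h1, h2 ▸ hs⟩, h2⟩
        · intro m hm
          simp only [Finset.mem_filter] at hm
          rw [smul_pt]
          simp [label, hm.2.2]
      · intro m; simp
    rw [h2, bfac, show (label i l).1 = i l from rfl, ← Finset.prod_mul_distrib]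
    refine Finset.prod_congr rfl fun s hs => ?_
    simp only [Finset.mem_erase, Finset.mem_univ, and_true] at hs
    rw [prod_filter_cnt i l s fun c => (((S.pt (label i l) : C) - S.pt (s, c)) *
        Ring.inverse ((S.pt (label i l) : C) - S.pt (s, c + 1))),
      prod_inverse_telescope (fun c => ((S.pt (label i l) : C) - S.pt (s, c)))]
    · simp [mul_assoc, pt_val S (s, 0)]
    · intro c _
      refine S.isUnit_pt_sub fun h => hs ?_
      simpa [label] using (congrArg Prod.fst h).symm
  rw [h1, ccoef, mul_assoc, mul_assoc, vdm, zProd]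
  congr 1
  rw [← Finset.prod_mul_distrib, ← Finset.prod_mul_distrib]
  refine Finset.prod_congr rfl fun l _ => ?_
  rw [← Finset.prod_mul_distrib, ← Finset.prod_mul_distrib]
  refine Finset.prod_congr rfl fun m hm => ?_
  rw [Finset.mem_Iio] at hm
  by_cases h : i m = i l
  · have h3 : cnt i m (i m) < cnt i l (i l) := by rw [← h]; exact cnt_lt_cnt i hm
    have h4 : IsUnit ((S.pt (label i m) : C) - S.t • (S.pt (label i l) : C)) := by
      rw [smul_pt]
      refine S.isUnit_pt_sub fun h5 => ?_
      have := congrArg Prod.snd h5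
      simp only [label] at this; omega
    have h5 : S.gfac (label i m) (label i l) = ((S.pt (label i m) : C) - S.pt (label i l)) *
        Ring.inverse ((S.pt (label i m) : C) - S.t • (S.pt (label i l) : C)) := by
      rw [gfac, if_neg (by simpa [label] using h), if_pos (by exact h3)]
    rw [if_neg (by simpa using h), h5, one_mul, mul_assoc, Ring.inverse_mul_cancel _ h4, mul_one]
  · have h4 : IsUnit ((S.pt (label i m) : C) - S.t • (S.pt (label i l) : C)) := by
      rw [smul_pt]
      refine S.isUnit_pt_sub fun h5 => h ?_
      simpa [label] using congrArg Prod.fst h5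
    rw [if_pos h, gfac, if_pos (by simpa [label] using h), mul_assoc (_ * _ * _),
      Ring.inverse_mul_cancel _ h4]
    ring

theorem isUnit_vdm_pt (i : Fin k → Fin a) : IsUnit (vdm fun l => (S.pt (label i l) : C)) := by
  unfold vdm
  simp only [IsUnit.prod_iff, Finset.mem_Iio, Finset.mem_univ, true_implies]
  intro l m hml
  exact S.isUnit_pt_sub fun h => hml.ne (label_injective i h)

/-- Some `t^{c+1} w_x` stands before `t^c w_x`, and the factor of this pair is zero. -/
theorem zProd_eq_zero (i : Fin k → Fin a) (σ : Equiv.Perm (Fin k))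
    (h : label (i ∘ σ) ≠ label i ∘ σ) :
    zProd S.t ((fun l => (S.pt (label i l) : C)) ∘ σ) = 0 := by
  obtain ⟨l, m, hlm, x, c, h1, h2⟩ := exists_lt_of_label_comp_ne i σ h
  unfold zProd
  refine Finset.prod_eq_zero (Finset.mem_univ m) (Finset.prod_eq_zero (Finset.mem_Iio.2 hlm) ?_)
  simp only [Function.comp_apply]
  rw [h1, h2, smul_pt, sub_self]

/-- Permutations that keep the order inside each colour correspond bijectively to the words with the
given multiplicities; all others contribute zero by `zProd_eq_zero`. The sum over words thus extends
to the full symmetric group. -/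
theorem orbit_sum (i : Fin k → Fin a) (f : (Fin k → ℤ) →₀ K) :
    ∑ j : Fin k → Fin a with mult j = mult i,
        S.ι (ev (fun l => S.pt (label j l)) f * S.rcoef j) * S.Tw j =
      S.ι (S.ccoef i * Ring.inverse (vdm fun l => (S.pt (label i l) : C)) *
        ∑ σ : Equiv.Perm (Fin k), ((Equiv.Perm.sign σ : ℤ) : C) *
          (ev ((fun l => S.pt (label i l)) ∘ σ) f *
            zProd S.t ((fun l => (S.pt (label i l) : C)) ∘ σ))) * S.Tw i := by
  classical
  rw [Finset.mul_sum, map_sum, Finset.sum_mul]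
  have h1 : ∑ σ ∈ (Finset.univ : Finset (Equiv.Perm (Fin k))).filter fun σ : Equiv.Perm (Fin k) =>
        label (i ∘ σ) = label i ∘ σ,
      S.ι (ev (fun l => S.pt (label (i ∘ σ) l)) f * S.rcoef (i ∘ σ)) * S.Tw (i ∘ σ) =
      ∑ j : Fin k → Fin a with mult j = mult i,
        S.ι (ev (fun l => S.pt (label j l)) f * S.rcoef j) * S.Tw j := by
    refine Finset.sum_bij (fun σ _ => i ∘ σ) ?_ ?_ ?_ ?_
    · intro σ _; simp [mult_comp]
    · intro σ hσ τ hτ h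
      simp only [Finset.mem_filter, Finset.mem_univ, true_and] at hσ hτ
      ext l : 1
      refine label_injective i ?_
      have := congrFun (hσ.symm.trans ((congrArg label h).trans hτ)) l
      exact this
    · intro j hj
      simp only [Finset.mem_filter, Finset.mem_univ, true_and] at hj
      obtain ⟨τ, hτ⟩ := exists_perm_label hj.symm
      have : j = i ∘ τ := by
        funext l; exact congrArg Prod.fst (congrFun hτ l)
      subst this
      exact ⟨τ, by simpa using hτ, rfl⟩
    · intro σ _; rfl
  rw [← h1, Finset.sum_filter]
  refine Finset.sum_congr rfl fun σ _ => ?_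
  split_ifs with h
  · rw [Tw_comp]
    congr 2
    have h2 := S.rcoef_mul_vdm (i ∘ σ)
    rw [h] at h2 ⊢
    rw [S.ccoef_comp i σ h] at h2
    have h3 := vdm_comp (fun l => (S.pt (label i l) : C)) σ
    have h4 := S.isUnit_vdm_pt i
    simp only [Function.comp_def] at h2 h3 h4 ⊢
    rw [h3] at h2
    have h5 : (((Equiv.Perm.sign σ : ℤ) : C)) * ((Equiv.Perm.sign σ : ℤ) : C) = 1 := by
      rw [← Int.cast_mul, Int.units_coe_mul_self, Int.cast_one]
    have h6 := Ring.inverse_mul_cancel _ h4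
    set V := vdm fun l => (S.pt (label i l) : C)
    set Z := zProd S.t fun l => (S.pt (label i (σ l)) : C)
    set s := ((Equiv.Perm.sign σ : ℤ) : C)
    set r := S.rcoef fun x => i (σ x)
    set e := ev (fun l => S.pt (label i (σ l))) f
    linear_combination (-e * r * s * s) * h6 - e * r * h5 + e * s * Ring.inverse V * h2
  · rw [S.zProd_eq_zero i σ h]; simp

/-- The operator depends only on the antisymmetrization of `f`; this is how relations of the shuffle
algebra pass to difference operators. -/
theorem wordSum_eq_zero (f : (Fin k → ℤ) →₀ K)
    (hf : ∀ x : Fin k → Cˣ, ∑ σ : Equiv.Perm (Fin k), ((Equiv.Perm.sign σ : ℤ) : C) *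
          (ev (x ∘ σ) f * zProd S.t ((fun l => (x l : C)) ∘ σ)) = 0) :
    wordSum S.y f = 0 := by
  classical
  rw [wordSum_eq, ← Finset.sum_fiberwise_of_maps_to (t := Finset.univ.image mult) (g := mult)
    (fun i _ => Finset.mem_image_of_mem _ (Finset.mem_univ i))]
  refine Finset.sum_eq_zero fun n hn => ?_
  obtain ⟨i, -, rfl⟩ := Finset.mem_image.1 hn
  rw [orbit_sum, hf fun l => S.pt (label i l)]
  simp

end DiffOps

theorem label_of_injective {a k : ℕ} {i : Fin k → Fin a} (hi : Function.Injective i) (l : Fin k) :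
    label i l = (i l, 0) := by
  simp only [label, Prod.mk.injEq, true_and, cnt, Finset.card_eq_zero, Finset.filter_eq_empty_iff,
    Finset.mem_univ, true_implies, not_and]
  intro m hm h
  rw [hi h] at hm; exact lt_irrefl _ hm

theorem exists_label_of_not_injective {a k : ℕ} {i : Fin k → Fin a}
    (hi : ¬ Function.Injective i) :
    ∃ l m : Fin k, ∃ x, label i l = (x, 0) ∧ label i m = (x, 1) := by
  simp only [Function.Injective, not_forall] at hi
  obtain ⟨l, m, hlm, hne⟩ := hi
  wlog h : l < m generalizing l m
  · exact this m l hlm.symm (Ne.symm hne) (lt_of_le_of_ne (not_lt.1 h) (Ne.symm hne))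
  have h1 : cnt i l (i l) < cnt i m (i l) := cnt_lt_cnt i h
  have h2 : cnt i m (i m) < cnt i k (i m) := cnt_lt_cnt i m.2
  rw [← hlm] at h2
  obtain ⟨l', -, h3⟩ := exists_label_of_lt i (u := k) (s := i l) (c := 0) (by omega)
  obtain ⟨m', -, h4⟩ := exists_label_of_lt i (u := k) (s := i l) (c := 1) (by omega)
  exact ⟨l', m', _, h3, h4⟩

/-! ### An explicit combination of words representing `E_{k,n}` -/

section LaurentEPoly

variable {K : Type*} [Field K]

/-- The Laurent polynomial `∏ x_i^n f` as a combination of exponents. -/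
def shiftLaurent {k : ℕ} (n : ℤ) (f : MvPolynomial (Fin k) K) : (Fin k → ℤ) →₀ K :=
  ∑ p ∈ f.support, Finsupp.single (fun i => (p i : ℤ) + n) (f.coeff p)

theorem ev_add {B : Type*} [CommRing B] [Algebra K B] {k : ℕ} (x : Fin k → Bˣ)
    (f g : (Fin k → ℤ) →₀ K) : ev x (f + g) = ev x f + ev x g :=
  Finsupp.sum_add_index' (by simp) (by simp [add_smul])

theorem ev_single {B : Type*} [CommRing B] [Algebra K B] {k : ℕ} (x : Fin k → Bˣ)
    (p : Fin k → ℤ) (c : K) :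
    ev x (Finsupp.single p c) = c • ∏ l, ((x l ^ p l : Bˣ) : B) := by
  simp [ev]

/-- Evaluation as a linear map. -/
def evLin {B : Type*} [CommRing B] [Algebra K B] {k : ℕ} (x : Fin k → Bˣ) :
    ((Fin k → ℤ) →₀ K) →ₗ[K] B :=
  Finsupp.linearCombination K fun p => ∏ l, ((x l ^ p l : Bˣ) : B)

theorem evLin_apply {B : Type*} [CommRing B] [Algebra K B] {k : ℕ} (x : Fin k → Bˣ)
    (f : (Fin k → ℤ) →₀ K) : evLin x f = ev x f := rfl

theorem ev_shiftLaurent {B : Type*} [CommRing B] [Algebra K B] {k : ℕ} (x : Fin k → Bˣ) (n : ℤ)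
    (f : MvPolynomial (Fin k) K) :
    ev x (shiftLaurent n f) =
      (∏ l, ((x l ^ n : Bˣ) : B)) * MvPolynomial.aeval (fun l => (x l : B)) f := by
  rw [← evLin_apply, shiftLaurent, map_sum]
  have h : f = ∑ p ∈ f.support, MvPolynomial.monomial p (f.coeff p) :=
    (MvPolynomial.support_sum_monomial_coeff f).symm
  conv_rhs => rw [h, map_sum, Finset.mul_sum]
  refine Finset.sum_congr rfl fun p _ => ?_
  rw [evLin_apply, ev_single, MvPolynomial.aeval_monomial, Finsupp.prod_fintype _ _ (by simp),
    Algebra.smul_def, mul_left_comm, ← Finset.prod_mul_distrib]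
  congr 1
  refine Finset.prod_congr rfl fun l _ => ?_
  rw [zpow_add, Units.val_mul, mul_comm, zpow_natCast, Units.val_pow_eq_pow_val]

variable (t : K) (k : ℕ) (n : ℤ)

/-- The Laurent polynomial `∏ x_i^n ∏_{i<j} (t x_i - x_j) ∏_i x_i^i`. -/
def eLaurent : (Fin k → ℤ) →₀ K :=
  shiftLaurent n (ePoly t (MvPolynomial.X : Fin k → MvPolynomial (Fin k) K))

theorem ev_eLaurent {B : Type*} [CommRing B] [Algebra K B] (x : Fin k → Bˣ) :
    ev x (eLaurent t k n) =
      (∏ l, ((x l ^ n : Bˣ) : B)) * ePoly t (fun l => (x l : B)) := by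
  rw [eLaurent, ev_shiftLaurent, map_ePoly]
  congr 2
  funext l; simp

/-- A variable occurs in `k - 1` of the linear factors, and the staircase monomial adds at most `k -
1`. This bound fixes the window of modes of `e` needed for `E_{k,n}`. -/
theorem degreeOf_ePoly (l : Fin k) :
    MvPolynomial.degreeOf l (ePoly t (MvPolynomial.X : Fin k → MvPolynomial (Fin k) K)) ≤
      2 * (k - 1) := by
  have hX : ∀ i, MvPolynomial.degreeOf l (MvPolynomial.X i : MvPolynomial (Fin k) K) ≤
      if l = i then 1 else 0 := fun i => by
    rw [MvPolynomial.degreeOf_X]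
  have hlin : ∀ i j, MvPolynomial.degreeOf l
      (t • MvPolynomial.X i - MvPolynomial.X j : MvPolynomial (Fin k) K) ≤
        max (if l = i then 1 else 0) (if l = j then 1 else 0) := fun i j => by
    refine (MvPolynomial.degreeOf_sub_le _ _ _).trans (max_le_max ?_ (hX j))
    rw [MvPolynomial.smul_eq_C_mul]
    exact (MvPolynomial.degreeOf_C_mul_le _ _ _).trans (hX i)
  have h1 : MvPolynomial.degreeOf l (∏ j, ∏ i ∈ Finset.Iio j,
      (t • MvPolynomial.X i - MvPolynomial.X j : MvPolynomial (Fin k) K)) ≤ k - 1 := by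
    refine (MvPolynomial.degreeOf_prod_le _ _ _).trans ?_
    have h2 : ∀ j : Fin k, MvPolynomial.degreeOf l (∏ i ∈ Finset.Iio j,
      (t • MvPolynomial.X i - MvPolynomial.X j : MvPolynomial (Fin k) K)) ≤
        if l = j then (l : ℕ) else if l < j then 1 else 0 := by
      intro j
      refine (MvPolynomial.degreeOf_prod_le _ _ _).trans ?_
      refine (Finset.sum_le_sum fun i _ => hlin i j).trans ?_
      split_ifs with h3 h4
      · subst h3
        refine (Finset.sum_le_card_nsmul _ _ 1 ?_).trans (by simp)
        intro i _; split_ifs <;> simp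
      · rw [Finset.sum_eq_single l]
        · simp
        · intro i _ hi; simp [hi.symm]
        · intro h; exact absurd (Finset.mem_Iio.2 h4) h
      · refine le_of_eq (Finset.sum_eq_zero fun i hi => ?_)
        rw [Finset.mem_Iio] at hi
        have : l ≠ i := fun h => h4 (h ▸ hi)
        simp [this]
    refine (Finset.sum_le_sum fun j _ => h2 j).trans ?_
    rw [← Finset.add_sum_erase _ _ (Finset.mem_univ l), if_pos rfl]
    have h5 : ∑ j ∈ Finset.univ.erase l, (if l = j then (l : ℕ) else if l < j then 1 else 0) =
        ∑ j ∈ Finset.univ.erase l, (if l < j then 1 else 0) := by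
      refine Finset.sum_congr rfl fun j hj => ?_
      rw [if_neg (Finset.ne_of_mem_erase hj).symm]
    rw [h5, ← Finset.sum_filter, Finset.sum_const, smul_eq_mul, mul_one]
    have h6 : (Finset.univ.erase l).filter (fun j => l < j) = Finset.Ioi l := by
      ext j; simp; exact fun h => h.ne'
    rw [h6, Fin.card_Ioi]; omega
  have h2 : MvPolynomial.degreeOf l (∏ i : Fin k,
      (MvPolynomial.X i ^ (i : ℕ) : MvPolynomial (Fin k) K)) ≤ k - 1 := by
    refine (MvPolynomial.degreeOf_prod_le _ _ _).trans ?_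
    rw [Finset.sum_eq_single l]
    · refine (MvPolynomial.degreeOf_pow_le _ _ _).trans ?_
      rw [MvPolynomial.degreeOf_X_self]; omega
    · intro i _ hi
      have := (MvPolynomial.degreeOf_pow_le l (MvPolynomial.X i : MvPolynomial (Fin k) K) i)
      rw [MvPolynomial.degreeOf_X, if_neg hi.symm] at this
      omega
    · simp
  refine (MvPolynomial.degreeOf_mul_le _ _ _).trans ?_
  omega

theorem mem_support_eLaurent {p : Fin k → ℤ} (hp : p ∈ (eLaurent t k n).support) (l : Fin k) :
    n ≤ p l ∧ p l ≤ n + 2 * (k - 1 : ℕ) := by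
  classical
  rw [eLaurent, shiftLaurent] at hp
  obtain ⟨m, hm, hmp⟩ := Finset.mem_biUnion.1 (Finsupp.support_finsetSum hp)
  have := Finsupp.support_single_subset hmp
  rw [Finset.mem_singleton] at this
  subst this
  have h := (MvPolynomial.le_degreeOf_of_mem_support l hm).trans (degreeOf_ePoly t k l)
  simp only
  omega

end LaurentEPoly

/-! ### Values of `E_{k,n}` for `k = a` and `k = a - 1` -/

namespace DiffOps

variable {K : Type*} [Field K] {a : ℕ} {C R : Type*} [CommRing C] [Algebra K C]
  [Ring R] [Algebra K R] (S : DiffOps K a C R) {k : ℕ}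

/-- The value of the shuffle element `E_{k,n}` times the symmetric coefficient at a word. -/
def eCoef (n : ℤ) (i : Fin k → Fin a) : C :=
  S.ccoef i * ((∏ l, ((S.pt (label i l) ^ n : Cˣ) : C)) *
    ∏ l, ∏ m ∈ Finset.univ.erase l, ((S.pt (label i l) : C) - S.t • (S.pt (label i m) : C)))

theorem orbit_sum_eLaurent (n : ℤ) (i : Fin k → Fin a) :
    ∑ j : Fin k → Fin a with mult j = mult i,
        S.ι (ev (fun l => S.pt (label j l)) (eLaurent S.t k n) * S.rcoef j) * S.Tw j =
      S.ι (S.eCoef n i) * S.Tw i := by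
  rw [orbit_sum]
  congr 2
  have h : ∀ σ : Equiv.Perm (Fin k), ((Equiv.Perm.sign σ : ℤ) : C) *
          (ev ((fun l => S.pt (label i l)) ∘ σ) (eLaurent S.t k n) *
            zProd S.t ((fun l => (S.pt (label i l) : C)) ∘ σ)) =
      (∏ l, ((S.pt (label i l) ^ n : Cˣ) : C)) * (((Equiv.Perm.sign σ : ℤ) : C) *
        (ePoly S.t ((fun l => (S.pt (label i l) : C)) ∘ σ) *
            zProd S.t ((fun l => (S.pt (label i l) : C)) ∘ σ))) := by
    intro σ
    rw [ev_eLaurent]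
    have := Equiv.prod_comp σ fun l => ((S.pt (label i l) ^ n : Cˣ) : C)
    simp only [Function.comp_def] at this ⊢
    rw [this]; ring
  simp_rw [h]
  rw [← Finset.mul_sum, antisymm_ePoly, eCoef]
  have := Ring.inverse_mul_cancel _ (S.isUnit_vdm_pt i)
  set V := vdm fun l => (S.pt (label i l) : C)
  set N := ∏ l, ((S.pt (label i l) ^ n : Cˣ) : C)
  linear_combination (S.ccoef i * N * ∏ i_1, ∏ j ∈ Finset.univ.erase i_1,
    (((S.pt (label i i_1)) : C) - S.t • (S.pt (label i j) : C))) * this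

/-- A repeated colour `x` contributes both `w_x` and `t w_x`, which annihilate a factor `x_i - t
x_j` of `E_{k,n}`. -/
theorem eCoef_of_not_injective (n : ℤ) {i : Fin k → Fin a} (hi : ¬ Function.Injective i) :
    S.eCoef n i = 0 := by
  obtain ⟨l, m, x, h1, h2⟩ := exists_label_of_not_injective hi
  have h3 : l ≠ m := by rintro rfl; rw [h1] at h2; simp at h2
  have h4 : ∏ l, ∏ m ∈ Finset.univ.erase l,
      ((S.pt (label i l) : C) - S.t • (S.pt (label i m) : C)) = 0 := by
    refine Finset.prod_eq_zero (Finset.mem_univ m) (Finset.prod_eq_zero (i := l) (by simp [h3]) ?_)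
    rw [h1, h2, smul_pt]; simp
  rw [eCoef, h4]; simp

/-- All ranks are zero, so the points are the `w_{i_l}`. The factors of `E_{k,n}` cancel the
denominators of `gfac`, and its numerators cancel the denominators of `bfac` for colours in use;
only unused colours survive below. -/
theorem eCoef_of_injective (n : ℤ) {i : Fin k → Fin a} (hi : Function.Injective i) :
    S.eCoef n i = ∏ l, (((S.w (i l) ^ (n + (a - 1 : ℕ)) : Cˣ) : C) *
      ∏ s ∈ Finset.univ.filter (fun s => s ∉ Set.range i),
        Ring.inverse ((S.w (i l) : C) - S.w s)) := by
  classical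
  have hpt : ∀ l, S.pt (label i l) = S.w (i l) := fun l => by
    ext; rw [label_of_injective hi]; simp [pt_val]
  have hg : ∀ l m, m ≠ l → S.gfac (label i m) (label i l) *
      (((S.w (i m) : C) - S.t • (S.w (i l) : C)) * ((S.w (i l) : C) - S.t • (S.w (i m) : C))) =
      ((S.w (i m) : C) - S.w (i l)) * ((S.w (i l) : C) - S.w (i m)) := by
    intro l m hlm
    have hu : ∀ l m, m ≠ l → IsUnit ((S.w (i l) : C) - S.t • (S.w (i m) : C)) := fun l m h => by
      simpa using S.isUnit_sub (i l) (i m) (fun h' => h (hi h').symm) 1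
    have h1 : (label i m).1 ≠ (label i l).1 := fun h => hlm (hi h)
    rw [gfac, if_pos h1, hpt, hpt]
    have h2 := Ring.inverse_mul_cancel _ (hu l m hlm)
    have h3 := Ring.inverse_mul_cancel _ (hu m l hlm.symm)
    set A := (S.w (i l) : C) - S.t • (S.w (i m) : C)
    set A' := (S.w (i m) : C) - S.t • (S.w (i l) : C)
    linear_combination ((S.w (i l) : C) - S.w (i m)) * ((S.w (i m) : C) - S.w (i l)) *
      (h3 + Ring.inverse A' * A' * h2)
  rw [eCoef, ccoef]
  have h1 : (∏ l, ∏ m ∈ Finset.Iio l, S.gfac (label i m) (label i l)) *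
      ∏ l, ∏ m ∈ Finset.univ.erase l, ((S.pt (label i l) : C) - S.t • (S.pt (label i m) : C)) =
      ∏ l, ∏ m ∈ Finset.univ.erase l, ((S.w (i l) : C) - S.w (i m)) := by
    rw [prod_erase_eq_prod_Iio, prod_erase_eq_prod_Iio, ← Finset.prod_mul_distrib]
    refine Finset.prod_congr rfl fun l _ => ?_
    rw [← Finset.prod_mul_distrib]
    refine Finset.prod_congr rfl fun m hm => ?_
    rw [hpt, hpt]
    exact hg l m (Finset.mem_Iio.1 hm).ne
  rw [mul_mul_mul_comm, h1, ← Finset.prod_mul_distrib, ← Finset.prod_mul_distrib]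
  refine Finset.prod_congr rfl fun l _ => ?_
  rw [bfac, hpt, show (label i l).1 = i l from rfl, Finset.prod_mul_distrib, Finset.prod_const,
    Finset.card_erase_of_mem (Finset.mem_univ _), Finset.card_univ, Fintype.card_fin,
    zpow_add, zpow_natCast, Units.val_mul, Units.val_pow_eq_pow_val]
  have h2 : Finset.univ.erase (i l) =
      (Finset.univ.filter fun s => s ∉ Set.range i) ∪ (Finset.univ.erase l).image i := by
    ext s
    simp only [Finset.mem_erase, Finset.mem_univ, and_true, Set.mem_range, not_exists,
      Finset.mem_union, Finset.mem_filter, true_and, Finset.mem_image]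
    constructor
    · intro h
      by_cases h' : ∃ m, i m = s
      · obtain ⟨m, rfl⟩ := h'; exact Or.inr ⟨m, fun h' => h (h' ▸ rfl), rfl⟩
      · exact Or.inl fun m hm => h' ⟨m, hm⟩
    · rintro (h | ⟨m, h, rfl⟩)
      · exact fun h' => h l h'.symm
      · exact fun h' => h (hi h')
  have h3 : Disjoint (Finset.univ.filter fun s => s ∉ Set.range i)
      ((Finset.univ.erase l).image i) := by
    rw [Finset.disjoint_left]
    simp only [Finset.mem_filter, Finset.mem_univ, true_and, Finset.mem_image, not_exists, not_and]
    rintro s hs m - rfl; exact hs ⟨m, rfl⟩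
  have h4 : (∏ m ∈ Finset.univ.erase l, Ring.inverse ((S.w (i l) : C) - S.w (i m))) *
      ∏ m ∈ Finset.univ.erase l, ((S.w (i l) : C) - S.w (i m)) = 1 := by
    rw [← Finset.prod_mul_distrib]
    refine Finset.prod_eq_one fun m hm => Ring.inverse_mul_cancel _ (S.isUnit_w_sub ?_)
    exact fun h => Finset.ne_of_mem_erase hm (hi h).symm
  rw [h2, Finset.prod_union h3, Finset.prod_image fun _ _ _ _ h => hi h]
  linear_combination (((S.w (i l) ^ n : Cˣ) : C) * (S.w (i l) : C) ^ (a - 1) *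
    ∏ s ∈ Finset.univ.filter (fun s => s ∉ Set.range i),
        Ring.inverse ((S.w (i l) : C) - S.w s)) * h4

/-- Only words using every colour once survive. They form a single orbit, with no unused colour, so
no denominator remains. -/
theorem wordSum_eLaurent_top (n : ℤ) :
    wordSum S.y (eLaurent S.t a n) =
      S.ι (∏ l, ((S.w l ^ (n + (a - 1 : ℕ)) : Cˣ) : C)) * S.Tw id := by
  classical
  rw [wordSum_eq, ← Finset.sum_fiberwise_of_maps_to (t := Finset.univ.image mult) (g := mult)
    (fun i _ => Finset.mem_image_of_mem _ (Finset.mem_univ i)),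
    Finset.sum_eq_single (mult (id : Fin a → Fin a))]
  · rw [orbit_sum_eLaurent, eCoef_of_injective S n Function.injective_id]
    simp
  · intro m hm hne
    obtain ⟨i, -, rfl⟩ := Finset.mem_image.1 hm
    rw [orbit_sum_eLaurent, eCoef_of_not_injective, map_zero, zero_mul]
    intro hi
    refine hne ?_
    exact mult_comp id (Equiv.ofBijective i (Finite.injective_iff_bijective.1 hi))
  · simp

end DiffOps

theorem exists_eq_succAbove_comp {k : ℕ} {i : Fin k → Fin (k + 1)} (hi : Function.Injective i) :
    ∃ (j : Fin (k + 1)) (σ : Equiv.Perm (Fin k)), i = j.succAbove ∘ σ := by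
  have : ¬ Function.Surjective i := fun h => by
    have := Fintype.card_le_of_surjective i h
    simp at this
  simp only [Function.Surjective, not_forall, not_exists] at this
  obtain ⟨j, hj⟩ := this
  choose g hg using fun l => Fin.exists_succAbove_eq (hj l)
  have hgi : Function.Injective g := fun l m h => hi (by rw [← hg, ← hg, h])
  refine ⟨j, Equiv.ofBijective g (Finite.injective_iff_bijective.1 hgi), ?_⟩
  funext l; exact (hg l).symm

theorem mult_succAbove_injective {k : ℕ} :
    Function.Injective fun j : Fin (k + 1) => mult j.succAbove := by
  intro j j' h
  by_contra hne
  obtain ⟨l, hl⟩ := Fin.exists_succAbove_eq hne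
  have h1 : (j, 0) ∈ Set.range (label j'.succAbove) :=
    ⟨l, by rw [label_of_injective Fin.succAbove_right_injective, hl]⟩
  rw [mem_range_label] at h1
  simp only at h h1
  rw [← h, ← mem_range_label j.succAbove (j, 0)] at h1
  obtain ⟨m, hm⟩ := h1
  exact Fin.succAbove_ne j m (congrArg Prod.fst hm)

namespace DiffOps

variable {K : Type*} [Field K] {k : ℕ} {C R : Type*} [CommRing C] [Algebra K C]
  [Ring R] [Algebra K R] (S : DiffOps K (k + 1) C R)

/-- Each surviving orbit is determined by the one colour `j` it omits. -/
theorem wordSum_eLaurent_sub_top (n : ℤ) :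
    wordSum S.y (eLaurent S.t k n) =
      ∑ j : Fin (k + 1), S.ι (∏ l, (((S.w (j.succAbove l) ^ (n + k) : Cˣ) : C) *
        Ring.inverse ((S.w (j.succAbove l) : C) - S.w j))) * S.Tw j.succAbove := by
  classical
  rw [wordSum_eq, ← Finset.sum_fiberwise_of_maps_to (t := Finset.univ.image mult) (g := mult)
    (fun i _ => Finset.mem_image_of_mem _ (Finset.mem_univ i)),
    ← Finset.sum_subset (s₁ := Finset.univ.image fun j : Fin (k + 1) => mult j.succAbove)]
  · rw [Finset.sum_image fun _ _ _ _ h => mult_succAbove_injective h]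
    refine Finset.sum_congr rfl fun j _ => ?_
    rw [orbit_sum_eLaurent, eCoef_of_injective S n Fin.succAbove_right_injective]
    congr 3
    funext l
    have : (Finset.univ.filter fun s => s ∉ Set.range j.succAbove) = {j} := by
      ext s; simp
    rw [this]; simp
  · intro m; simp only [Finset.mem_image, Finset.mem_univ, true_and]
    rintro ⟨j, rfl⟩; exact ⟨_, rfl⟩
  · intro m hm hne
    obtain ⟨i, -, rfl⟩ := Finset.mem_image.1 hm
    rw [orbit_sum_eLaurent, eCoef_of_not_injective, map_zero, zero_mul]
    intro hi
    obtain ⟨j, σ, rfl⟩ := exists_eq_succAbove_comp hi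
    refine hne (Finset.mem_image.2 ⟨j, Finset.mem_univ _, ?_⟩)
    exact (mult_comp _ σ).symm

end DiffOps

/-! ### The difference operators and their coefficient ring inside `A a` -/

theorem q_pow_injective : Function.Injective fun n : ℕ => q ^ n := by
  intro m n h
  simp only [q, ← RatFunc.algebraMap_X, ← map_pow] at h
  have := RatFunc.algebraMap_injective ℂ h
  simpa using congrArg Polynomial.natDegree this

theorem q_sq_pow_injective : Function.Injective fun n : ℕ => (q ^ 2) ^ n := by
  intro m n h
  simp only [← pow_mul] at h
  have := q_pow_injective h
  omega

theorem q_sq_inv_pow_injective : Function.Injective fun n : ℕ => ((q ^ 2)⁻¹) ^ n := by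
  intro m n h
  simp only [inv_pow, inv_inj] at h
  exact q_sq_pow_injective h

theorem q_sq_ne_one : q ^ 2 ≠ 1 := fun h => by
  have := q_pow_injective (a₁ := 2) (a₂ := 0) (by simpa using h); simp at this

theorem q_four_ne_one : q ^ 4 ≠ 1 := fun h => by
  have := q_pow_injective (a₁ := 4) (a₂ := 0) (by simpa using h); simp at this

namespace A

variable {a : ℕ}

theorem rel {x y : FreeAlgebra Cq (AGen a)} (h : ARel a x y) :
    RingQuot.mkAlgHom Cq (ARel a) x = RingQuot.mkAlgHom Cq (ARel a) y :=
  RingQuot.mkAlgHom_rel Cq h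

theorem D_mul_D (i j : Fin a) : D i * D j = D j * D i := by
  simpa [D, gen] using rel (ARel.D_D i j)

theorem v_mul_v (i j : Fin a) : (gen (.v i) * gen (.v j) : A a) = gen (.v j) * gen (.v i) := by
  simpa [gen] using rel (ARel.v_v i j)

theorem D_mul_DInv (i : Fin a) : D i * DInv i = 1 := by
  simpa [D, DInv, gen] using rel (ARel.D_mul_inv i)

theorem DInv_mul_D (i : Fin a) : DInv i * D i = 1 := by
  simpa [D, DInv, gen] using rel (ARel.D_inv_mul i)

theorem D_mul_v (i j : Fin a) :
    D i * gen (.v j) = (if i = j then q else 1) • (gen (.v j) * D i) := by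
  simpa only [D, gen, map_mul, map_smul] using rel (ARel.D_v i j)

/-- The image of `w_i - q^m w_j`. -/
theorem diff_mul_dInv (i j : Fin a) (h : i ≠ j) (m : ℤ) :
    ((gen (.v i)) ^ 2 - q ^ m • gen (.v j) ^ 2) * gen (.dInv i j h m) = (1 : A a) := by
  simpa only [AFree.diff, gen, map_mul, map_smul, map_sub, map_pow, map_one] using
    rel (ARel.diff_mul_inv i j h m)

theorem dInv_mul_diff (i j : Fin a) (h : i ≠ j) (m : ℤ) :
    gen (.dInv i j h m) * ((gen (.v i)) ^ 2 - q ^ m • gen (.v j) ^ 2) = (1 : A a) := by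
  simpa only [AFree.diff, gen, map_mul, map_smul, map_sub, map_pow, map_one] using
    rel (ARel.diff_inv_mul i j h m)

/-- The invertible element `D_i`. -/
def Du (i : Fin a) : (A a)ˣ := ⟨D i, DInv i, D_mul_DInv i, DInv_mul_D i⟩

theorem Du_commute (i j : Fin a) : Commute (Du i) (Du j) := Units.ext (D_mul_D i j)

/-- The commutative subalgebra of functions: the double centralizer of the `w_i^{1/2}`. -/
def fn (a : ℕ) : Subalgebra Cq (A a) :=
  Subalgebra.centralizer Cq (Set.centralizer (Set.range fun i : Fin a => gen (.v i)))

theorem mem_fn {x : A a} :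
    x ∈ fn a ↔ ∀ y : A a, (∀ i, gen (.v i) * y = y * gen (.v i)) → y * x = x * y := by
  simp [fn, Subalgebra.mem_centralizer_iff, Set.mem_centralizer_iff]

theorem v_mem_fn (i : Fin a) : gen (.v i) ∈ fn a := mem_fn.2 fun _ h => (h i).symm

/-- The `w_i^{1/2}` commute, so they lie in their own centralizer; hence `x` commutes with all of
them, and `y`, being in the double centralizer, commutes with `x`. This gives a commutative
coefficient ring with no knowledge of a basis of `A a`. -/
theorem fn_commute {x y : A a} (hx : x ∈ fn a) (hy : y ∈ fn a) : x * y = y * x := by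
  rw [mem_fn] at hx hy
  refine hy x fun i => (hx _ fun j => v_mul_v j i)

instance : CommRing (fn a) :=
  { (inferInstance : Ring (fn a)) with
    mul_comm := fun x y => Subtype.ext (fn_commute x.2 y.2) }

theorem mem_fn_of_inverse {x y : A a} (hx : x ∈ fn a) (h1 : x * y = 1) (h2 : y * x = 1) :
    y ∈ fn a := by
  rw [mem_fn] at hx ⊢
  intro z hz
  calc z * y = y * x * z * y := by rw [h2, one_mul]
    _ = y * (z * x) * y := by rw [hx z hz, mul_assoc y]
    _ = y * z := by rw [mul_assoc, mul_assoc, h1, mul_one]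

/-- Conjugation by `u` only rescales the `w_j^{1/2}`, so it preserves their centralizer and hence
the double centralizer. -/
theorem conj_mem_fn (u : (A a)ˣ) (c : Fin a → Cq)
    (hu : ∀ j, (u : A a) * gen (.v j) = c j • (gen (.v j) * u)) {x : A a} (hx : x ∈ fn a) :
    u * x * (u⁻¹ : (A a)ˣ) ∈ fn a := by
  rw [mem_fn] at hx ⊢
  intro z hz
  have hu' : ∀ j, gen (.v j) * (u⁻¹ : (A a)ˣ) = c j • ((u⁻¹ : (A a)ˣ) * gen (.v j)) := fun j => by
    calc gen (.v j) * ((u⁻¹ : (A a)ˣ) : A a) = (u⁻¹ : (A a)ˣ) * (u * gen (.v j)) * (u⁻¹ : (A a)ˣ) := by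
          rw [Units.inv_mul_cancel_left]
      _ = _ := by
        rw [hu, mul_smul_comm, smul_mul_assoc, mul_assoc, mul_assoc, Units.mul_inv, mul_one]
  have key := hx ((u⁻¹ : (A a)ˣ) * z * u) fun j => by
    calc gen (.v j) * ((u⁻¹ : (A a)ˣ) * z * u) = gen (.v j) * (u⁻¹ : (A a)ˣ) * z * u := by
          simp only [mul_assoc]
      _ = c j • ((u⁻¹ : (A a)ˣ) * (gen (.v j) * z) * u) := by
          rw [hu', smul_mul_assoc, smul_mul_assoc]; simp only [mul_assoc]
      _ = (u⁻¹ : (A a)ˣ) * z * (c j • (gen (.v j) * u)) := by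
          rw [hz, mul_smul_comm]; simp only [mul_assoc]
      _ = _ := by rw [← hu]; simp only [mul_assoc]
  calc z * (u * x * (u⁻¹ : (A a)ˣ)) =
      u * (((u⁻¹ : (A a)ˣ) * z * u) * x) * (u⁻¹ : (A a)ˣ) := by
        simp only [mul_assoc, Units.mul_inv_cancel_left]
    _ = _ := by rw [key]; simp only [mul_assoc, Units.mul_inv, mul_one]

/-- Conjugation by `u` on the subalgebra of functions. -/
def conjFn (u : (A a)ˣ) (c : Fin a → Cq)
    (hu : ∀ j, (u : A a) * gen (.v j) = c j • (gen (.v j) * u)) : fn a →ₐ[Cq] fn a where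
  toFun x := ⟨u * x * (u⁻¹ : (A a)ˣ), conj_mem_fn u c hu x.2⟩
  map_one' := by ext; simp
  map_mul' x y := by ext; simp [mul_assoc]
  map_zero' := by ext; simp
  map_add' x y := by ext; simp [mul_add, add_mul]
  commutes' r := by
    ext
    change (u : A a) * algebraMap Cq (A a) r * (u⁻¹ : (A a)ˣ) = algebraMap Cq (A a) r
    rw [← Algebra.commutes, mul_assoc, Units.mul_inv, mul_one]

/-- The invertible function `w_i^{1/2}`. -/
def vFn (i : Fin a) : (fn a)ˣ where
  val := ⟨gen (.v i), v_mem_fn i⟩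
  inv := ⟨gen (.vInv i), mem_fn_of_inverse (v_mem_fn i) (v_mul_vInv i) (vInv_mul_v i)⟩
  val_inv := Subtype.ext (v_mul_vInv i)
  inv_val := Subtype.ext (vInv_mul_v i)

/-- The invertible function `w_i`. -/
def wFn (i : Fin a) : (fn a)ˣ := vFn i ^ 2

theorem map_wFn (i : Fin a) : Units.map (fn a).val.toMonoidHom (wFn i) = w i := by
  ext; rfl

theorem conjFn_wFn (u : (A a)ˣ) (c : Fin a → Cq)
    (hu : ∀ j, (u : A a) * gen (.v j) = c j • (gen (.v j) * u)) (j : Fin a) :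
    conjFn u c hu (wFn j) = c j ^ 2 • (wFn j : fn a) := by
  rw [wFn, Units.val_pow_eq_pow_val, map_pow, ← smul_pow]
  congr 1
  ext
  change (u : A a) * gen (.v j) * (u⁻¹ : (A a)ˣ) = c j • gen (.v j)
  rw [hu, smul_mul_assoc, mul_assoc, Units.mul_inv, mul_one]

theorem isUnit_diffFn (i j : Fin a) (h : i ≠ j) (m : ℤ) :
    IsUnit ((wFn i : fn a) - q ^ m • (wFn j : fn a)) := by
  have hm : (gen (.v i) ^ 2 - q ^ m • gen (.v j) ^ 2 : A a) ∈ fn a :=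
    ((wFn i : fn a) - q ^ m • (wFn j : fn a)).2
  exact IsUnit.of_mul_eq_one ⟨gen (.dInv i j h m), mem_fn_of_inverse hm
    (diff_mul_dInv i j h m) (dInv_mul_diff i j h m)⟩ (Subtype.ext (diff_mul_dInv i j h m))

theorem Du_mul_v (i j : Fin a) :
    (Du i : A a) * gen (.v j) = (if i = j then q else 1) • (gen (.v j) * (Du i : A a)) :=
  D_mul_v i j

theorem Du_inv_mul_v (i j : Fin a) :
    ((Du i)⁻¹ : (A a)ˣ) * gen (.v j) =
      (if i = j then q⁻¹ else 1) • (gen (.v j) * (((Du i)⁻¹ : (A a)ˣ) : A a)) := by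
  rw [Units.inv_mul_eq_iff_eq_mul, mul_smul_comm, ← mul_assoc, Du_mul_v, smul_mul_assoc,
    mul_assoc, Units.mul_inv, mul_one, smul_smul]
  split_ifs <;> simp [q_ne_zero]

/-- The difference operators `D_i`, with `t = q²`. -/
def opD (a : ℕ) : DiffOps Cq a (fn a) (A a) where
  ι := (fn a).val
  w := wFn
  t := q ^ 2
  T := Du
  τ i := conjFn (Du i) _ (Du_mul_v i)
  t_ne := pow_ne_zero _ q_ne_zero
  pow_inj := q_sq_pow_injective
  T_comm i j := (Du_commute i j).units_val
  T_mul i c := by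
    change (Du i : A a) * (c : A a) = (Du i * c * ((Du i)⁻¹ : (A a)ˣ)) * Du i
    rw [mul_assoc _ _ (Du i : A a), Units.inv_mul, mul_one]
  τ_w i j := by rw [conjFn_wFn]; split_ifs <;> simp
  isUnit_sub i j h m := by
    have := isUnit_diffFn i j h (2 * m)
    rwa [zpow_mul] at this

/-- The difference operators `D_i⁻¹`, with `t = q⁻²`. -/
def opDInv (a : ℕ) : DiffOps Cq a (fn a) (A a) where
  ι := (fn a).val
  w := wFn
  t := (q ^ 2)⁻¹
  T i := (Du i)⁻¹
  τ i := conjFn (Du i)⁻¹ _ (Du_inv_mul_v i)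
  t_ne := inv_ne_zero (pow_ne_zero _ q_ne_zero)
  pow_inj := q_sq_inv_pow_injective
  T_comm i j := ((Du_commute i j).inv_inv).units_val
  T_mul i c := by
    change (((Du i)⁻¹ : (A a)ˣ) : A a) * (c : A a) =
      (((Du i)⁻¹ : (A a)ˣ) * c * (((Du i)⁻¹)⁻¹ : (A a)ˣ)) * ((Du i)⁻¹ : (A a)ˣ)
    rw [mul_assoc _ _ (((Du i)⁻¹ : (A a)ˣ) : A a), Units.inv_mul, mul_one]
  τ_w i j := by rw [conjFn_wFn]; split_ifs <;> simp
  isUnit_sub i j h m := by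
    have := isUnit_diffFn i j h (-(2 * m))
    rwa [zpow_neg, zpow_mul, ← inv_zpow] at this

end A

/-! ### Partial fractions over a commutative ring -/

section PartialFractions

variable {B : Type*} [CommRing B] {κ : Type*} [Fintype κ]

/-- Unit differences make the `X - c_i` pairwise coprime, so their monic product divides `p` even
over a ring with zero divisors; the degree then forces `p = 0`. -/
theorem polynomial_eq_zero_of_eval (p : Polynomial B) (c : κ → B)
    (hc : ∀ i j, i ≠ j → IsUnit (c i - c j)) (hdeg : p.degree < Fintype.card κ)
    (hp : ∀ i, p.eval (c i) = 0) : p = 0 := by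
  nontriviality B
  by_contra hne
  have hdvd : ∏ i, (Polynomial.X - Polynomial.C (c i)) ∣ p := by
    refine Finset.prod_dvd_of_coprime ?_ fun i _ => Polynomial.dvd_iff_isRoot.2 (hp i)
    intro i _ j _ hij
    exact Polynomial.isCoprime_X_sub_C_of_isUnit_sub (hc i j hij)
  refine (Polynomial.monic_prod_of_monic _ _ fun i _ =>
    Polynomial.monic_X_sub_C (c i)).not_dvd_of_degree_lt hne ?_ hdvd
  rw [Polynomial.degree_prod_of_monic _ _ fun i _ => Polynomial.monic_X_sub_C (c i)]
  simpa using hdeg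

variable [DecidableEq κ]

/-- The coefficient of `(1 - c_i X)⁻¹` in the partial fraction expansion. -/
def pfCoef (c : κ → Bˣ) (i : κ) : B :=
  ∏ j ∈ Finset.univ.erase i, (c i : B) * Ring.inverse ((c i : B) - c j)

variable (c : κ → Bˣ)

theorem pfCoef_mul (hc : ∀ i j, i ≠ j → IsUnit ((c i : B) - c j)) (i : κ) :
    pfCoef c i * ∏ j ∈ Finset.univ.erase i, ((c i : B) - c j) =
      ∏ _j ∈ Finset.univ.erase i, (c i : B) := by
  rw [pfCoef, ← Finset.prod_mul_distrib]
  refine Finset.prod_congr rfl fun j hj => ?_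
  rw [mul_assoc, Ring.inverse_mul_cancel _ (hc i j (Finset.ne_of_mem_erase hj).symm), mul_one]

theorem degree_sum_prod_lt [Nonempty κ] (L : κ → B) (f : κ → Polynomial B)
    (hf : ∀ i, (f i).degree ≤ 1) :
    (∑ i, Polynomial.C (L i) * ∏ j ∈ Finset.univ.erase i, f j).degree < Fintype.card κ := by
  have hpos : 0 < Fintype.card κ := Fintype.card_pos
  refine (Polynomial.degree_sum_le _ _).trans_lt ((Finset.sup_lt_iff ?_).2 fun i _ => ?_)
  · exact bot_lt_iff_ne_bot.2 (by simp)
  · refine ((Polynomial.degree_mul_le _ _).trans (add_le_add Polynomial.degree_C_le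
      (Polynomial.degree_prod_le _ _))).trans_lt ?_
    rw [zero_add]
    refine (Finset.sum_le_sum fun _ _ => hf _).trans_lt ?_
    rw [Finset.sum_const, Finset.card_erase_of_mem (Finset.mem_univ _), Finset.card_univ]
    simp only [nsmul_eq_mul, mul_one]
    exact_mod_cast Nat.sub_lt hpos one_pos

/-- Lagrange interpolation: both sides have degree below the number of poles and agree at the points
`c_i⁻¹`. -/
theorem sum_pfCoef_one_sub [Nonempty κ] (hc : ∀ i j, i ≠ j → IsUnit ((c i : B) - c j)) :
    ∑ i, Polynomial.C (pfCoef c i) *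
      ∏ j ∈ Finset.univ.erase i, (1 - Polynomial.C (c j : B) * Polynomial.X) = 1 := by
  rw [← sub_eq_zero]
  refine polynomial_eq_zero_of_eval _ (fun i => ((c i)⁻¹ : Bˣ)) ?_ ?_ ?_
  · intro i j hij
    have : (((c i)⁻¹ : Bˣ) : B) - ((c j)⁻¹ : Bˣ) =
        ((c i)⁻¹ * (c j)⁻¹ : Bˣ) * ((c j : B) - c i) := by
      rw [mul_sub, Units.val_mul, mul_assoc, Units.inv_mul, mul_right_comm, Units.inv_mul]; ring
    rw [this]
    exact (Units.isUnit _).mul (hc j i hij.symm)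
  · refine (Polynomial.degree_sub_le _ _).trans_lt (max_lt ?_ ?_)
    · refine degree_sum_prod_lt _ _ fun i => ?_
      refine (Polynomial.degree_sub_le _ _).trans (max_le ?_ (Polynomial.degree_C_mul_X_le _))
      exact Polynomial.degree_one_le.trans (by norm_num)
    · refine Polynomial.degree_one_le.trans_lt ?_
      exact_mod_cast Fintype.card_pos
  · intro i
    rw [Polynomial.eval_sub, Polynomial.eval_finsetSum, Finset.sum_eq_single i]
    · simp only [Polynomial.eval_mul, Polynomial.eval_C, Polynomial.eval_prod, Polynomial.eval_sub,
        Polynomial.eval_one, Polynomial.eval_X]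
      rw [sub_eq_zero, pfCoef, ← Finset.prod_mul_distrib]
      refine Finset.prod_eq_one fun j hj => ?_
      have h := Ring.inverse_mul_cancel _ (hc i j (Finset.ne_of_mem_erase hj).symm)
      have h' := Units.mul_inv (c i)
      linear_combination h + Ring.inverse ((c i : B) - c j) * (-(c j : B)) * h'
    · intro j _ hj
      rw [Polynomial.eval_mul, Polynomial.eval_prod,
        Finset.prod_eq_zero (Finset.mem_erase.2 ⟨hj.symm, Finset.mem_univ i⟩), mul_zero]
      simp
    · simp

/-- Interpolation at the `c_i` with the same coefficients, as needed for the expansion at `z = 0`.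
-/
theorem sum_pfCoef_sub [Nonempty κ] (hc : ∀ i j, i ≠ j → IsUnit ((c i : B) - c j)) :
    ∑ i, Polynomial.C (pfCoef c i) *
      ∏ j ∈ Finset.univ.erase i, (Polynomial.X - Polynomial.C (c j : B)) =
      Polynomial.X ^ (Fintype.card κ - 1) := by
  rw [← sub_eq_zero]
  refine polynomial_eq_zero_of_eval _ (fun i => (c i : B)) hc ?_ ?_
  · refine (Polynomial.degree_sub_le _ _).trans_lt (max_lt ?_ ?_)
    · exact degree_sum_prod_lt _ _ fun i => Polynomial.degree_X_sub_C_le _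
    · refine (Polynomial.degree_X_pow_le _).trans_lt ?_
      exact_mod_cast Nat.sub_lt Fintype.card_pos one_pos
  · intro i
    rw [Polynomial.eval_sub, Polynomial.eval_finsetSum, Finset.sum_eq_single i]
    · simp only [Polynomial.eval_mul, Polynomial.eval_C, Polynomial.eval_prod, Polynomial.eval_sub,
        Polynomial.eval_pow, Polynomial.eval_X]
      rw [pfCoef_mul c hc, Finset.prod_const, Finset.card_erase_of_mem (Finset.mem_univ _),
        Finset.card_univ, sub_self]
    · intro j _ hj
      rw [Polynomial.eval_mul, Polynomial.eval_prod,
        Finset.prod_eq_zero (Finset.mem_erase.2 ⟨hj.symm, Finset.mem_univ i⟩), mul_zero]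
      simp
    · simp

/-- The expansion of `(1 - c/z)⁻¹` in `z⁻¹`. -/
def gInf {B : Type*} [Ring B] (c : Bˣ) : PowerSeries B :=
  PowerSeries.mk fun j => ((c ^ j : Bˣ) : B)

/-- The expansion of `(1 - c/z)⁻¹` in `z`. -/
def gZero {B : Type*} [Ring B] (c : Bˣ) : PowerSeries B :=
  PowerSeries.mk fun j => if j = 0 then 0 else -((c⁻¹ ^ j : Bˣ) : B)

theorem one_sub_mul_gInf (c : Bˣ) : (1 - PowerSeries.C (c : B) * PowerSeries.X) * gInf c = 1 := by
  ext n
  rw [sub_mul, one_mul, mul_assoc, map_sub, PowerSeries.coeff_C_mul]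
  cases n with
  | zero => simp [gInf]
  | succ n =>
    rw [PowerSeries.coeff_succ_X_mul]
    simp [gInf, PowerSeries.coeff_one, pow_succ']

theorem X_sub_mul_gZero (c : Bˣ) :
    (PowerSeries.X - PowerSeries.C (c : B)) * gZero c = PowerSeries.X := by
  ext n
  rw [sub_mul, map_sub, PowerSeries.coeff_C_mul]
  cases n with
  | zero => simp [gZero]
  | succ n =>
    rw [PowerSeries.coeff_succ_X_mul]
    cases n with
    | zero => simp [gZero]
    | succ n => simp [gZero, PowerSeries.coeff_X, pow_succ']

theorem prod_gInf [Nonempty κ] (hc : ∀ i j, i ≠ j → IsUnit ((c i : B) - c j)) :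
    ∏ i, gInf (c i) = ∑ i, PowerSeries.C (pfCoef c i) * gInf (c i) := by
  have h := congrArg (Polynomial.coeToPowerSeries.ringHom (R := B)) (sum_pfCoef_one_sub c hc)
  simp only [map_sum, map_mul, map_prod, map_sub, map_one,
    Polynomial.coeToPowerSeries.ringHom_apply, Polynomial.coe_C, Polynomial.coe_X] at h
  rw [← mul_one (∏ i, gInf (c i)), ← h, Finset.mul_sum]
  refine Finset.sum_congr rfl fun i _ => ?_
  rw [← Finset.mul_prod_erase _ _ (Finset.mem_univ i)]
  have h2 : (∏ j ∈ Finset.univ.erase i, (1 - PowerSeries.C (c j : B) * PowerSeries.X)) *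
      ∏ j ∈ Finset.univ.erase i, gInf (c j) = 1 := by
    rw [← Finset.prod_mul_distrib]
    exact Finset.prod_eq_one fun j _ => one_sub_mul_gInf (c j)
  linear_combination (gInf (c i) * PowerSeries.C (pfCoef c i)) * h2

theorem powerSeries_mul_X_pow_cancel {f g : PowerSeries B} {n : ℕ}
    (h : f * PowerSeries.X ^ n = g * PowerSeries.X ^ n) : f = g := by
  ext m
  have := congrArg (PowerSeries.coeff (m + n)) h
  simpa [PowerSeries.coeff_mul_X_pow] using this

theorem prod_gZero [Nonempty κ] (hc : ∀ i j, i ≠ j → IsUnit ((c i : B) - c j)) :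
    ∏ i, gZero (c i) = ∑ i, PowerSeries.C (pfCoef c i) * gZero (c i) := by
  -- The power `X ^ (card - 1)` is introduced so that it can be replaced by the interpolation
  -- identity.
  refine powerSeries_mul_X_pow_cancel (n := Fintype.card κ - 1) ?_
  have h := congrArg (Polynomial.coeToPowerSeries.ringHom (R := B)) (sum_pfCoef_sub c hc)
  simp only [map_sum, map_mul, map_prod, map_sub, map_pow,
    Polynomial.coeToPowerSeries.ringHom_apply, Polynomial.coe_C, Polynomial.coe_X] at h
  conv_lhs => rw [← h]
  rw [Finset.mul_sum, Finset.sum_mul]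
  refine Finset.sum_congr rfl fun i _ => ?_
  rw [← Finset.mul_prod_erase _ _ (Finset.mem_univ i)]
  have h2 : (∏ j ∈ Finset.univ.erase i, (PowerSeries.X - PowerSeries.C (c j : B))) *
      ∏ j ∈ Finset.univ.erase i, gZero (c j) = PowerSeries.X ^ (Fintype.card κ - 1) := by
    rw [← Finset.prod_mul_distrib]
    simp_rw [X_sub_mul_gZero]
    rw [Finset.prod_const, Finset.card_erase_of_mem (Finset.mem_univ _), Finset.card_univ]
  linear_combination (gZero (c i) * PowerSeries.C (pfCoef c i)) * h2

/-- The two-sided sequence of coefficients of a power series in `z⁻¹`. -/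
def coeffInf (f : PowerSeries B) (s : ℤ) : B :=
  if 0 ≤ s then PowerSeries.coeff s.toNat f else 0

/-- The two-sided sequence of coefficients of a power series in `z`. -/
def coeffZero (f : PowerSeries B) (s : ℤ) : B :=
  if s ≤ 0 then PowerSeries.coeff (-s).toNat f else 0

/-- The two expansions of a single `(1 - c/z)⁻¹` differ by `∑_s c^s z^{-s}`. Partial fractions with
common coefficients at both ends reduce the product to this case. -/
theorem coeffInf_sub_coeffZero [Nonempty κ] (hc : ∀ i j, i ≠ j → IsUnit ((c i : B) - c j))
    (s : ℤ) :
    coeffInf (∏ i, gInf (c i)) s - coeffZero (∏ i, gZero (c i)) s =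
      ∑ i, pfCoef c i * ((c i ^ s : Bˣ) : B) := by
  rw [prod_gInf c hc, prod_gZero c hc]
  rcases lt_trichotomy s 0 with h | h | h
  · obtain ⟨n, rfl⟩ : ∃ n : ℕ, s = -(n + 1 : ℕ) := ⟨(-s - 1).toNat, by omega⟩
    rw [coeffInf, coeffZero, if_neg (by omega), if_pos (by omega)]
    simp only [neg_neg, Int.toNat_natCast, map_sum, PowerSeries.coeff_C_mul, zero_sub,
      ← Finset.sum_neg_distrib]
    refine Finset.sum_congr rfl fun i _ => ?_
    simp only [gZero, PowerSeries.coeff_mk, if_neg (Nat.succ_ne_zero n), mul_neg, neg_neg, zpow_neg,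
      zpow_natCast, inv_pow]
  · subst h
    simp [coeffInf, coeffZero, gInf, gZero]
  · obtain ⟨n, rfl⟩ : ∃ n : ℕ, s = (n + 1 : ℕ) := ⟨(s - 1).toNat, by omega⟩
    rw [coeffInf, coeffZero, if_pos (by omega), if_neg (by omega)]
    simp only [Int.toNat_natCast, map_sum, PowerSeries.coeff_C_mul, sub_zero]
    refine Finset.sum_congr rfl fun i _ => ?_
    simp only [gInf, PowerSeries.coeff_mk, zpow_natCast]

/-- Extending coefficients by zero turns a power series identity into one valid for every `m ∈ ℤ`;
the boundary case `m = -1` is the constant term. -/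
theorem coeffInf_step {f g : PowerSeries B} {u v e : B}
    (h : (1 - PowerSeries.C u * PowerSeries.X) * f =
      PowerSeries.C e * ((1 - PowerSeries.C v * PowerSeries.X) * g)) (m : ℤ) :
    coeffInf f (m + 1) - u * coeffInf f m = e * (coeffInf g (m + 1) - v * coeffInf g m) := by
  rcases lt_trichotomy m (-1) with hm | hm | hm
  · simp [coeffInf, show ¬ 0 ≤ m + 1 by omega, show ¬ 0 ≤ m by omega]
  · subst hm
    have := congrArg (PowerSeries.coeff 0) h
    rw [PowerSeries.coeff_C_mul] at this
    simp only [sub_mul, one_mul, mul_assoc, map_sub, PowerSeries.coeff_C_mul,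
      PowerSeries.coeff_zero_X_mul, mul_zero, sub_zero] at this
    simpa [coeffInf] using this
  · obtain ⟨n, rfl⟩ := Int.eq_ofNat_of_zero_le (show 0 ≤ m by omega)
    have := congrArg (PowerSeries.coeff (n + 1)) h
    rw [PowerSeries.coeff_C_mul] at this
    simp only [sub_mul, one_mul, mul_assoc, map_sub, PowerSeries.coeff_C_mul,
      PowerSeries.coeff_succ_X_mul] at this
    have e1 : ((n : ℤ) + 1).toNat = n + 1 := by omega
    simp only [coeffInf, show (0 : ℤ) ≤ n by omega, show (0 : ℤ) ≤ n + 1 by omega, if_true, e1,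
      Int.toNat_natCast]
    exact this

theorem coeffZero_step {f g : PowerSeries B} {u v e : B}
    (h : (PowerSeries.X - PowerSeries.C u) * f =
      PowerSeries.C e * ((PowerSeries.X - PowerSeries.C v) * g)) (m : ℤ) :
    coeffZero f (m + 1) - u * coeffZero f m = e * (coeffZero g (m + 1) - v * coeffZero g m) := by
  rcases lt_trichotomy m 0 with hm | hm | hm
  · obtain ⟨n, rfl⟩ : ∃ n : ℕ, m = -(n + 1 : ℕ) := ⟨(-m - 1).toNat, by omega⟩
    have := congrArg (PowerSeries.coeff (n + 1)) h
    rw [PowerSeries.coeff_C_mul] at this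
    simp only [sub_mul, map_sub, PowerSeries.coeff_C_mul, PowerSeries.coeff_succ_X_mul] at this
    have e1 : (-(-((n + 1 : ℕ) : ℤ) + 1)).toNat = n := by omega
    have e2 : (-(-((n + 1 : ℕ) : ℤ))).toNat = n + 1 := by omega
    simp only [coeffZero, show (-((n + 1 : ℕ) : ℤ) + 1) ≤ 0 by omega,
      show (-((n + 1 : ℕ) : ℤ)) ≤ 0 by omega, if_true, e1, e2]
    exact this
  · subst hm
    have := congrArg (PowerSeries.coeff 0) h
    rw [PowerSeries.coeff_C_mul] at this
    simp only [sub_mul, map_sub, PowerSeries.coeff_C_mul,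
      PowerSeries.coeff_zero_X_mul] at this
    simpa [coeffZero] using this
  · simp [coeffZero, show ¬ m + 1 ≤ 0 by omega, show ¬ m ≤ 0 by omega]

end PartialFractions

/-! ### Quadratic and Cartan relations of the operator currents -/

/-- The Laurent polynomial expressing the quadratic relation of the currents `e(z)`. -/
def relLaurent {K : Type*} [Field K] (t : K) (m n : ℤ) : (Fin 2 → ℤ) →₀ K :=
  Finsupp.single ![m + 1, n] 1 - Finsupp.single ![m, n + 1] t⁻¹ -
    Finsupp.single ![n, m + 1] t⁻¹ + Finsupp.single ![n + 1, m] 1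

/-- The polynomial is `x_0 - t⁻¹ x_1` times a symmetric one, and `(x_0 - t⁻¹ x_1)(x_0 - t x_1)` is
symmetric, so antisymmetrization gives zero. -/
theorem antisymm_relLaurent {K B : Type*} [Field K] [CommRing B] [Algebra K B] {t : K} (ht : t ≠ 0)
    (m n : ℤ) (x : Fin 2 → Bˣ) :
    ∑ σ : Equiv.Perm (Fin 2), ((Equiv.Perm.sign σ : ℤ) : B) *
      (ev (x ∘ σ) (relLaurent t m n) * zProd t ((fun l => (x l : B)) ∘ σ)) = 0 := by
  have hz : ∀ y : Fin 2 → B, zProd t y = y 0 - t • y 1 := by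
    intro y
    have h0 : Finset.Iio (0 : Fin 2) = ∅ := rfl
    have h1 : Finset.Iio (1 : Fin 2) = {0} := rfl
    simp [zProd, Fin.prod_univ_two, h0, h1]
  have he : ∀ x : Fin 2 → Bˣ, ev x (relLaurent t m n) = ((x 0 : B) - t⁻¹ • (x 1 : B)) *
      (((x 0 ^ m * x 1 ^ n : Bˣ) : B) + ((x 0 ^ n * x 1 ^ m : Bˣ) : B)) := by
    intro x
    rw [← evLin_apply, relLaurent, map_add, map_sub, map_sub]
    simp only [evLin_apply, ev_single, Fin.prod_univ_two, Matrix.cons_val_zero,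
      Matrix.cons_val_one, zpow_add_one, Units.val_mul, map_one, Algebra.smul_def]
    ring
  rw [Fintype.sum_equiv (Equiv.Perm.decomposeFin (n := 1)) _
    (fun σ => ((Equiv.Perm.sign (Equiv.Perm.decomposeFin.symm σ) : ℤ) : B) *
      (ev (x ∘ (Equiv.Perm.decomposeFin.symm σ)) (relLaurent t m n) *
        zProd t ((fun l => (x l : B)) ∘ (Equiv.Perm.decomposeFin.symm σ)))) (by simp)]
  rw [Fintype.sum_prod_type, Fin.sum_univ_two, Fintype.sum_unique, Fintype.sum_unique]
  have e1 : (Equiv.Perm.decomposeFin.symm ((0 : Fin 2), (default : Equiv.Perm (Fin 1)))) = 1 := by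
    decide
  have e2 : (Equiv.Perm.decomposeFin.symm ((1 : Fin 2), (default : Equiv.Perm (Fin 1)))) =
      Equiv.swap 0 1 := by decide
  rw [e1, e2, hz, hz, he, he, Equiv.Perm.sign_swap (by decide)]
  have ht' : algebraMap K B t⁻¹ * algebraMap K B t = 1 := by
    rw [← map_mul, inv_mul_cancel₀ ht, map_one]
  simp only [Function.comp_apply, Equiv.Perm.coe_one, id_eq, Equiv.swap_apply_left,
    Equiv.swap_apply_right, Algebra.smul_def, Units.val_mul, Equiv.Perm.sign_one, Units.val_one,
    Int.cast_one, Units.val_neg, Int.cast_neg]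
  linear_combination ((x 0 : B) ^ 2 * (-1) + (x 1 : B) ^ 2) *
    (((x 0 ^ m : Bˣ) : B) * ((x 1 ^ n : Bˣ) : B) + ((x 0 ^ n : Bˣ) : B) * ((x 1 ^ m : Bˣ) : B)) *
      ht'

theorem wordSum_single {K R : Type*} [Field K] [Ring R] [Algebra K R] {k : ℕ} (y : ℤ → R)
    (p : Fin k → ℤ) (c : K) :
    wordSum y (Finsupp.single p c) = c • (List.ofFn fun l => y (p l)).prod := by
  simp [wordSum]

/-- The noncommutative evaluation as a linear map. -/
def wordLin {K R : Type*} [Field K] [Ring R] [Algebra K R] {k : ℕ} (y : ℤ → R) :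
    ((Fin k → ℤ) →₀ K) →ₗ[K] R :=
  Finsupp.linearCombination K fun p => (List.ofFn fun l => y (p l)).prod

theorem wordLin_apply {K R : Type*} [Field K] [Ring R] [Algebra K R] {k : ℕ} (y : ℤ → R)
    (f : (Fin k → ℤ) →₀ K) : wordLin y f = wordSum y f := rfl

theorem wordSum_relLaurent {K R : Type*} [Field K] [Ring R] [Algebra K R] (y : ℤ → R) (t : K)
    (m n : ℤ) :
    wordSum y (relLaurent t m n) = y (m + 1) * y n - t⁻¹ • (y m * y (n + 1)) -
      t⁻¹ • (y n * y (m + 1)) + y (n + 1) * y m := by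
  rw [← wordLin_apply, relLaurent, map_add, map_sub, map_sub]
  simp [wordLin_apply, wordSum_single]

theorem inverse_smul {K B : Type*} [Field K] [CommRing B] [Algebra K B] {c : K} (hc : c ≠ 0)
    (x : B) : Ring.inverse (c • x) = c⁻¹ • Ring.inverse x := by
  by_cases hx : IsUnit x
  · symm
    refine eq_inverse_of_mul_eq_one ?_
    rw [smul_mul_smul_comm, mul_inv_cancel₀ hc, Ring.mul_inverse_cancel _ hx, one_smul]
  · rw [Ring.inverse_non_unit _ hx, smul_zero, Ring.inverse_non_unit]
    rwa [DiffOps.isUnit_smul_iff hc]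

namespace DiffOps

variable {K : Type*} [Field K] {a : ℕ} {C R : Type*} [CommRing C] [Algebra K C]
  [Ring R] [Algebra K R] (S : DiffOps K a C R)

theorem y_rel (m n : ℤ) :
    S.y (m + 1) * S.y n - S.t⁻¹ • (S.y m * S.y (n + 1)) =
      S.t⁻¹ • (S.y n * S.y (m + 1)) - S.y (n + 1) * S.y m := by
  have := S.wordSum_eq_zero (relLaurent S.t m n) (antisymm_relLaurent S.t_ne m n)
  rw [wordSum_relLaurent] at this
  rw [← sub_eq_zero, ← this]; abel

/-- The product of all `w_i`. -/
def P : Cˣ := ∏ i, S.w i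

theorem τ_P (i : Fin a) : S.τ i S.P = S.t • (S.P : C) := by
  rw [P, Units.coe_prod, map_prod]
  simp_rw [S.τ_w]
  rw [← Finset.mul_prod_erase _ _ (Finset.mem_univ i), ← Finset.mul_prod_erase (a := i) _
    (fun j => (S.w j : C)) (Finset.mem_univ i), if_pos rfl, smul_mul_assoc]
  congr 2
  exact Finset.prod_congr rfl fun j hj => by rw [if_neg (Finset.ne_of_mem_erase hj).symm, one_smul]

/-- Every `T_i` rescales the full product `P` by the same `t`. The factor `P` in the image of `e_p`
therefore does not affect homogeneous relations. -/
theorem y_mul_P (p : ℤ) : S.y p * S.ι S.P = S.t • (S.ι S.P * S.y p) := by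
  rw [y, Finset.sum_mul, Finset.mul_sum, Finset.smul_sum]
  refine Finset.sum_congr rfl fun i _ => ?_
  rw [mul_assoc, S.T_mul, τ_P, map_smul, smul_mul_assoc, mul_smul_comm, ← mul_assoc, ← mul_assoc,
    ← map_mul, ← map_mul, mul_comm (S.P : C)]

theorem Py_mul_Py (m n : ℤ) :
    S.ι S.P * S.y m * (S.ι S.P * S.y n) = S.t • (S.ι S.P * S.ι S.P * (S.y m * S.y n)) := by
  rw [mul_assoc, ← mul_assoc (S.y m), y_mul_P, smul_mul_assoc, mul_smul_comm]
  simp only [mul_assoc]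

theorem Py_rel (m n : ℤ) :
    S.ι S.P * S.y (m + 1) * (S.ι S.P * S.y n) -
        S.t⁻¹ • (S.ι S.P * S.y m * (S.ι S.P * S.y (n + 1))) =
      S.t⁻¹ • (S.ι S.P * S.y n * (S.ι S.P * S.y (m + 1))) -
        S.ι S.P * S.y (n + 1) * (S.ι S.P * S.y m) := by
  have := congrArg (fun z => S.t • (S.ι S.P * S.ι S.P * z)) (S.y_rel m n)
  simp only [Py_mul_Py]
  simp only [mul_sub, smul_sub, mul_smul_comm] at this
  rw [smul_comm, this, smul_comm S.t⁻¹]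

/-- In the `i`-th summand, raising the mode by one multiplies by `w_i`, so the relation splits into
one identity of functions for each `i`. -/
theorem func_mul_y {α β γ δ : K} {ψ ψ' : C}
    (h : ∀ i, α • ψ' - β • ((S.w i : C) * ψ) = γ • S.τ i ψ' - δ • ((S.w i : C) * S.τ i ψ)) (n : ℤ) :
    α • (S.ι ψ' * S.y n) - β • (S.ι ψ * S.y (n + 1)) =
      γ • (S.y n * S.ι ψ') - δ • (S.y (n + 1) * S.ι ψ) := by
  simp only [y, Finset.mul_sum, Finset.sum_mul, Finset.smul_sum, ← Finset.sum_sub_distrib]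
  refine Finset.sum_congr rfl fun i _ => ?_
  rw [mul_assoc (S.ι _) (S.T i : R), mul_assoc (S.ι _) (S.T i : R), S.T_mul, S.T_mul]
  simp only [← mul_assoc, ← map_mul]
  rw [← smul_mul_assoc, ← smul_mul_assoc, ← smul_mul_assoc, ← smul_mul_assoc, ← sub_mul, ← sub_mul,
    ← map_smul, ← map_smul, ← map_smul, ← map_smul, ← map_sub, ← map_sub]
  congr 2
  have hi := h i
  simp only [zpow_add_one, Units.val_mul, Algebra.smul_def] at hi ⊢
  linear_combination (((S.w i ^ n : Cˣ) : C) * S.WI i) * hi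

theorem map_gInf {B B' : Type*} [Ring B] [Ring B'] (f : B →+* B') (c : Bˣ) :
    PowerSeries.map f (gInf c) = gInf (Units.map f.toMonoidHom c) := by
  ext n; simp [gInf, ← map_pow]

theorem map_gZero {B B' : Type*} [Ring B] [Ring B'] (f : B →+* B') (c : Bˣ) :
    PowerSeries.map f (gZero c) = gZero (Units.map f.toMonoidHom c) := by
  ext n
  simp only [gZero, PowerSeries.coeff_map, PowerSeries.coeff_mk]
  split_ifs
  · simp
  · rw [map_neg, ← map_inv, ← map_pow]; rfl

/-- The Cartan current of a family of poles `u_i`, `v_i`, expanded at infinity. -/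
def cartanInf (u v : Fin a → Cˣ) : PowerSeries C :=
  PowerSeries.C (S.P : C) * ∏ j, (gInf (u j) * gInf (v j))

/-- The Cartan current of a family of poles `u_i`, `v_i`, expanded at zero. -/
def cartanZero (u v : Fin a → Cˣ) : PowerSeries C :=
  PowerSeries.C (S.P : C) * ∏ j, (gZero (u j) * gZero (v j))

variable {u v : Fin a → Cˣ}

/-- Only the `i`-th pair of poles moves, from `u_i, t u_i` to `t u_i, t² u_i`; the two pairs share
the pole `v_i = t u_i`. -/
theorem map_τ_prod (g : Cˣ → PowerSeries C)
    (hg : ∀ (f : C →+* C) (c : Cˣ), PowerSeries.map f (g c) = g (Units.map f.toMonoidHom c))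
    (hu : ∀ i j, S.τ i (u j) = (if i = j then S.t else 1) • (u j : C))
    (hv : ∀ j, (v j : C) = S.t • (u j : C)) (i : Fin a) :
    ∃ v' : Cˣ, (v' : C) = S.t ^ 2 • (u i : C) ∧
    PowerSeries.map (S.τ i : C →+* C) (∏ j, (g (u j) * g (v j))) =
      g (v i) * g v' * ∏ j ∈ Finset.univ.erase i, (g (u j) * g (v j)) := by
  refine ⟨Units.map (S.τ i : C →+* C).toMonoidHom (v i), ?_, ?_⟩
  · change S.τ i (v i) = _
    rw [hv, map_smul, hu, if_pos rfl, smul_smul, pow_two]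
  · rw [← Finset.mul_prod_erase _ _ (Finset.mem_univ i), map_mul, map_mul, map_prod, hg, hg]
    congr 1
    · congr 2
      ext
      change S.τ i (u i) = _
      rw [hu, if_pos rfl, hv]
    · refine Finset.prod_congr rfl fun j hj => ?_
      have hne := (Finset.ne_of_mem_erase hj).symm
      rw [map_mul, hg, hg]
      congr 2
      · ext
        change S.τ i (u j) = _
        rw [hu, if_neg hne, one_smul]
      · ext
        change S.τ i (v j) = _
        rw [hv, map_smul, hu, if_neg hne, one_smul]

/-- Clearing the non-shared poles `u_i` and `t² u_i` leaves the same series on both sides; `t⁻¹`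
compensates the rescaling of `P`. -/
theorem cartanInf_step
    (hu : ∀ i j, S.τ i (u j) = (if i = j then S.t else 1) • (u j : C))
    (hv : ∀ j, (v j : C) = S.t • (u j : C)) (i : Fin a) (m : ℤ) :
    coeffInf (S.cartanInf u v) (m + 1) - (u i : C) * coeffInf (S.cartanInf u v) m =
      S.t⁻¹ • (coeffInf (PowerSeries.map (S.τ i : C →+* C) (S.cartanInf u v)) (m + 1) -
        (S.t ^ 2 • (u i : C)) *
          coeffInf (PowerSeries.map (S.τ i : C →+* C) (S.cartanInf u v)) m) := by
  obtain ⟨v', hv', h⟩ := S.map_τ_prod gInf map_gInf hu hv i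
  rw [Algebra.smul_def]
  refine coeffInf_step ?_ m
  rw [cartanInf, map_mul, h, PowerSeries.map_C, ← hv']
  have hP : ((S.τ i : C →+* C) (S.P : C)) = S.t • (S.P : C) := S.τ_P i
  rw [hP, ← Finset.mul_prod_erase _ _ (Finset.mem_univ i), Algebra.smul_def, map_mul]
  have h1 := one_sub_mul_gInf (u i)
  have h2 := one_sub_mul_gInf v'
  have h3 : PowerSeries.C (algebraMap K C S.t⁻¹) * PowerSeries.C (algebraMap K C S.t) = 1 := by
    rw [← map_mul, ← map_mul, inv_mul_cancel₀ S.t_ne, map_one, map_one]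
  set E := ∏ j ∈ Finset.univ.erase i, (gInf (u j) * gInf (v j))
  linear_combination (PowerSeries.C (S.P : C) * gInf (v i) * E) * (h1 - h2) -
    (PowerSeries.C (S.P : C) * gInf (v i) * E) *
      ((1 - PowerSeries.C (v' : C) * PowerSeries.X) * gInf v') * h3

theorem cartanZero_step
    (hu : ∀ i j, S.τ i (u j) = (if i = j then S.t else 1) • (u j : C))
    (hv : ∀ j, (v j : C) = S.t • (u j : C)) (i : Fin a) (m : ℤ) :
    coeffZero (S.cartanZero u v) (m + 1) - (u i : C) * coeffZero (S.cartanZero u v) m =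
      S.t⁻¹ • (coeffZero (PowerSeries.map (S.τ i : C →+* C) (S.cartanZero u v)) (m + 1) -
        (S.t ^ 2 • (u i : C)) *
          coeffZero (PowerSeries.map (S.τ i : C →+* C) (S.cartanZero u v)) m) := by
  obtain ⟨v', hv', h⟩ := S.map_τ_prod gZero map_gZero hu hv i
  rw [Algebra.smul_def]
  refine coeffZero_step ?_ m
  rw [cartanZero, map_mul, h, PowerSeries.map_C, ← hv']
  have hP : ((S.τ i : C →+* C) (S.P : C)) = S.t • (S.P : C) := S.τ_P i
  rw [hP, ← Finset.mul_prod_erase _ _ (Finset.mem_univ i), Algebra.smul_def, map_mul]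
  have h1 := X_sub_mul_gZero (u i)
  have h2 := X_sub_mul_gZero v'
  have h3 : PowerSeries.C (algebraMap K C S.t⁻¹) * PowerSeries.C (algebraMap K C S.t) = 1 := by
    rw [← map_mul, ← map_mul, inv_mul_cancel₀ S.t_ne, map_one, map_one]
  set E := ∏ j ∈ Finset.univ.erase i, (gZero (u j) * gZero (v j))
  linear_combination (PowerSeries.C (S.P : C) * gZero (v i) * E) * (h1 - h2) -
    (PowerSeries.C (S.P : C) * gZero (v i) * E) *
      ((PowerSeries.X - PowerSeries.C (v' : C)) * gZero v') * h3

theorem coeffInf_map {B B' : Type*} [CommRing B] [CommRing B'] (f : B →+* B') (g : PowerSeries B)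
    (s : ℤ) : coeffInf (PowerSeries.map f g) s = f (coeffInf g s) := by
  unfold coeffInf; split_ifs <;> simp

theorem coeffZero_map {B B' : Type*} [CommRing B] [CommRing B'] (f : B →+* B') (g : PowerSeries B)
    (s : ℤ) : coeffZero (PowerSeries.map f g) s = f (coeffZero g s) := by
  unfold coeffZero; split_ifs <;> simp

/-- The scaled operators `c P y_p`. -/
def opE (c : K) (p : ℤ) : R := c • (S.ι S.P * S.y p)

/-- The scaled operators `c t^p y_p`. -/
def opF (c : K) (p : ℤ) : R := (c * S.t ^ p) • S.y p

theorem opE_rel (c : K) (m n : ℤ) :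
    S.opE c (m + 1) * S.opE c n - S.t⁻¹ • (S.opE c m * S.opE c (n + 1)) =
      S.t⁻¹ • (S.opE c n * S.opE c (m + 1)) - S.opE c (n + 1) * S.opE c m := by
  simp only [opE, smul_mul_smul_comm, smul_comm S.t⁻¹, ← smul_sub]
  rw [S.Py_rel]

theorem opF_rel (c : K) (m n : ℤ) :
    S.t • (S.opF c (m + 1) * S.opF c n) - S.opF c m * S.opF c (n + 1) =
      S.opF c n * S.opF c (m + 1) - S.t • (S.opF c (n + 1) * S.opF c m) := by
  have := congrArg (fun z => S.t • z) (S.y_rel m n)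
  simp only [smul_sub, smul_smul, mul_inv_cancel₀ S.t_ne, one_smul] at this
  have e : ∀ m n : ℤ, (c * S.t ^ m) * (c * S.t ^ n) = c * c * S.t ^ (m + n) := fun m n => by
    rw [zpow_add₀ S.t_ne]; ring
  simp only [opF, smul_mul_smul_comm, smul_comm S.t, e]
  rw [show m + 1 + n = m + n + 1 by ring, show m + (n + 1) = m + n + 1 by ring,
    show n + (m + 1) = m + n + 1 by ring, show n + 1 + m = m + n + 1 by ring, ← smul_sub,
    ← smul_sub, this]

theorem func_mul_opE {ψ ψ' : C}
    (h : ∀ i, ψ' - S.t⁻¹ • ((S.w i : C) * ψ) = S.t⁻¹ • S.τ i ψ' - (S.w i : C) * S.τ i ψ)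
    (c : K) (n : ℤ) :
    S.ι ψ' * S.opE c n - S.t⁻¹ • (S.ι ψ * S.opE c (n + 1)) =
      S.t⁻¹ • (S.opE c n * S.ι ψ') - S.opE c (n + 1) * S.ι ψ := by
  have := S.func_mul_y (α := 1) (δ := 1) (by simpa using h) n
  simp only [one_smul] at this
  have hP : ∀ ψ : C, S.ι ψ * S.ι S.P = S.ι S.P * S.ι ψ := fun ψ => by
    rw [← map_mul, ← map_mul, mul_comm]
  have := congrArg (fun z => c • (S.ι S.P * z)) this
  simp only [mul_sub, smul_sub, mul_smul_comm, ← mul_assoc, ← hP] at this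
  simp only [opE, mul_smul_comm, smul_mul_assoc, smul_comm S.t⁻¹ c, ← mul_assoc]
  exact this

theorem func_mul_opF {ψ ψ' : C}
    (h : ∀ i, ψ' - (S.w i : C) * ψ = S.t⁻¹ • (S.τ i ψ' - (S.t ^ 2 • (S.w i : C)) * S.τ i ψ))
    (c : K) (n : ℤ) :
    S.t • (S.ι ψ' * S.opF c n) - S.ι ψ * S.opF c (n + 1) =
      S.opF c n * S.ι ψ' - S.t • (S.opF c (n + 1) * S.ι ψ) := by
  have := S.func_mul_y (α := S.t) (β := S.t) (γ := 1) (δ := S.t * S.t) (ψ := ψ) (ψ' := ψ')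
    (fun i => by
      have h' := congrArg (fun z => S.t • z) (h i)
      simp only [smul_sub, smul_smul, smul_mul_assoc, mul_inv_cancel₀ S.t_ne, one_smul] at h'
      rw [← mul_assoc, mul_inv_cancel₀ S.t_ne, one_mul, pow_two] at h'
      simpa only [one_smul] using h') n
  have := congrArg (fun z => (c * S.t ^ n) • z) this
  simp only [smul_sub, smul_smul, one_smul] at this
  simp only [opF, zpow_add_one₀ S.t_ne, mul_smul_comm, smul_mul_assoc, smul_smul]
  convert this using 3 <;> ring

end DiffOps

/-! ### Operators assigned to the generators -/

namespace A

variable {a : ℕ}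

/-- The invertible function `q² w_i`. -/
def qqwFn (i : Fin a) : (fn a)ˣ :=
  Units.map (algebraMap Cq (fn a)).toMonoidHom (Units.mk0 q q_ne_zero ^ 2) * wFn i

theorem coe_qqwFn (i : Fin a) : (qqwFn i : fn a) = q ^ 2 • (wFn i : fn a) := by
  simp [qqwFn, Algebra.smul_def]

theorem map_qqwFn (i : Fin a) : Units.map (fn a).val.toMonoidHom (qqwFn i) = qqw i := by
  rw [qqwFn, map_mul, map_wFn, qqw]
  congr 1

theorem qqwFn_zpow (i : Fin a) (p : ℤ) :
    ((qqwFn i ^ p : (fn a)ˣ) : fn a) = (q ^ 2) ^ p • ((wFn i ^ p : (fn a)ˣ) : fn a) := by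
  rw [qqwFn, mul_zpow, Units.val_mul, ← map_zpow, Algebra.smul_def]
  congr 1
  change algebraMap Cq (fn a) (((Units.mk0 q q_ne_zero ^ 2) ^ p : Cqˣ) : Cq) = _
  rw [Units.val_zpow_eq_zpow_val, Units.val_pow_eq_pow_val, Units.val_mk0]

theorem val_wFn_zpow (i : Fin a) (p : ℤ) :
    (fn a).val ((wFn i ^ p : (fn a)ˣ) : fn a) = ((w i ^ p : (A a)ˣ) : A a) := by
  rw [← map_wFn, ← map_zpow]; rfl

theorem val_qqwFn_zpow (i : Fin a) (p : ℤ) :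
    (fn a).val ((qqwFn i ^ p : (fn a)ˣ) : fn a) = ((qqw i ^ p : (A a)ˣ) : A a) := by
  rw [← map_qqwFn, ← map_zpow]; rfl

/-- The product of the `w_i` as a function. -/
def PFn (a : ℕ) : (fn a)ˣ := ∏ i, wFn i

theorem val_PFn : (fn a).val (PFn a : fn a) = wProd a := by
  rw [PFn, Units.coe_prod, ← List.prod_ofFn, map_list_prod, List.map_ofFn]; rfl

theorem P_opD : (opD a).P = PFn a := rfl

theorem P_opDInv : (opDInv a).P = PFn a := rfl

theorem val_WI (i : Fin a) : (fn a).val ((opD a).WI i) = WInv i := by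
  have h : (opD a).WI i = ∏ s, if h : i ≠ s then (wFn i : fn a) *
      Ring.inverse ((wFn i : fn a) - wFn s) else 1 := by
    rw [← Finset.mul_prod_erase _ _ (Finset.mem_univ i), dif_neg (by simp), one_mul]
    refine Finset.prod_congr rfl fun s hs => ?_
    rw [dif_pos (Finset.ne_of_mem_erase hs).symm]; rfl
  rw [h, ← List.prod_ofFn, map_list_prod, List.map_ofFn, WInv]
  congr 2
  funext s
  simp only [Function.comp_apply]
  split_ifs with hs
  swap
  · rw [map_one]
  · rw [map_mul]
    congr 1
    have hm : gen (.dInv i s hs 0) ∈ fn a := by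
      refine mem_fn_of_inverse (x := gen (.v i) ^ 2 - q ^ (0 : ℤ) • gen (.v s) ^ 2) ?_
        (diff_mul_dInv i s hs 0) (dInv_mul_diff i s hs 0)
      exact ((wFn i : fn a) - q ^ (0 : ℤ) • (wFn s : fn a)).2
    have : (⟨_, hm⟩ : fn a) = Ring.inverse ((wFn i : fn a) - wFn s) := by
      refine eq_inverse_of_mul_eq_one (Subtype.ext ?_)
      have := diff_mul_dInv i s hs 0
      rw [zpow_zero, one_smul] at this
      exact this
    rw [← this]; rfl

theorem WI_opDInv (i : Fin a) : (opDInv a).WI i = (opD a).WI i := rfl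

/-- The operator assigned to `e_p`. -/
def eOp (a : ℕ) (p : ℤ) : A a :=
  (-q / (1 - q ^ 2)) • (wProd a * ∑ i : Fin a, ((w i ^ p : (A a)ˣ) : A a) * WInv i * DInv i)

/-- The operator assigned to `f_p`. -/
def fOp (a : ℕ) (p : ℤ) : A a :=
  (1 / (1 - q ^ 2)) • ∑ i : Fin a, ((qqw i ^ p : (A a)ˣ) : A a) * WInv i * D i

theorem eOp_eq (p : ℤ) :
    eOp a p = (-q / (1 - q ^ 2)) • ((opDInv a).ι (opDInv a).P * (opDInv a).y p) := by
  rw [eOp, DiffOps.y, P_opDInv]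
  congr 2
  · exact val_PFn.symm
  · refine Finset.sum_congr rfl fun i _ => ?_
    rw [map_mul, WI_opDInv, ← val_wFn_zpow, ← val_WI]
    rfl

theorem fOp_eq (p : ℤ) :
    fOp a p = ((1 / (1 - q ^ 2)) * (q ^ 2) ^ p) • (opD a).y p := by
  rw [fOp, DiffOps.y, mul_smul, Finset.smul_sum (r := (q ^ 2) ^ p)]
  congr 1
  refine Finset.sum_congr rfl fun i _ => ?_
  rw [map_mul, ← val_qqwFn_zpow, ← val_WI, qqwFn_zpow, map_smul, smul_mul_assoc, smul_mul_assoc]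
  rfl

/-- The Cartan current in functions, expanded at infinity. -/
def psiInfFn (a : ℕ) : PowerSeries (fn a) := (opD a).cartanInf wFn qqwFn

/-- The Cartan current in functions, expanded at zero. -/
def psiZeroFn (a : ℕ) : PowerSeries (fn a) := (opD a).cartanZero wFn qqwFn

theorem psiInf_eq : psiInf a = PowerSeries.map ((fn a).val : fn a →+* A a) (psiInfFn a) := by
  rw [psiInfFn, DiffOps.cartanInf, map_mul, PowerSeries.map_C, psiInf, ← List.prod_ofFn,
    map_list_prod, List.map_ofFn]
  congr 2
  · exact val_PFn.symm
  · congr 1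
    funext i
    simp only [Function.comp_apply, map_mul, DiffOps.map_gInf]
    rw [show geomInf (w i) = gInf (w i) from rfl, show geomInf (qqw i) = gInf (qqw i) from rfl,
      ← map_wFn, ← map_qqwFn]
    rfl

theorem psiZero_eq : psiZero a = PowerSeries.map ((fn a).val : fn a →+* A a) (psiZeroFn a) := by
  rw [psiZeroFn, DiffOps.cartanZero, map_mul, PowerSeries.map_C, psiZero, ← List.prod_ofFn,
    map_list_prod, List.map_ofFn]
  congr 2
  · exact val_PFn.symm
  · congr 1
    funext i
    simp only [Function.comp_apply, map_mul, DiffOps.map_gZero]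
    rw [show geomZero (w i) = gZero (w i) from rfl, show geomZero (qqw i) = gZero (qqw i) from rfl,
      ← map_wFn, ← map_qqwFn]
    rfl

/-- The function assigned to `ψ^ε_s`. -/
def psiFn (a : ℕ) (ε : Bool) (s : ℤ) : fn a :=
  match ε with
  | true => coeffInf (psiInfFn a) s
  | false => coeffZero (psiZeroFn a) s

theorem psiFn_step_D (ε : Bool) (i : Fin a) (m : ℤ) :
    psiFn a ε (m + 1) - (wFn i : fn a) * psiFn a ε m =
      (q ^ 2)⁻¹ • ((opD a).τ i (psiFn a ε (m + 1)) -
        ((q ^ 2) ^ 2 • (wFn i : fn a)) * (opD a).τ i (psiFn a ε m)) := by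
  cases ε
  · have := (opD a).cartanZero_step (u := wFn) (v := qqwFn) (opD a).τ_w coe_qqwFn i m
    rw [DiffOps.coeffZero_map, DiffOps.coeffZero_map] at this
    exact this
  · have := (opD a).cartanInf_step (u := wFn) (v := qqwFn) (opD a).τ_w coe_qqwFn i m
    rw [DiffOps.coeffInf_map, DiffOps.coeffInf_map] at this
    exact this

/-- For `D_i⁻¹` the poles exchange roles: with `t = q⁻²`, the pole `q² w_i` is moved onto `w_i`, so
the general step applies with `u = q² w` and `v = w`. -/
theorem psiFn_step_DInv (ε : Bool) (i : Fin a) (m : ℤ) :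
    psiFn a ε (m + 1) - (qqwFn i : fn a) * psiFn a ε m =
      ((q ^ 2)⁻¹)⁻¹ • ((opDInv a).τ i (psiFn a ε (m + 1)) -
        (((q ^ 2)⁻¹) ^ 2 • (qqwFn i : fn a)) * (opDInv a).τ i (psiFn a ε m)) := by
  have hu : ∀ i j : Fin a, (opDInv a).τ i (qqwFn j) =
      (if i = j then (opDInv a).t else 1) • (qqwFn j : fn a) := fun i j => by
    rw [coe_qqwFn, map_smul, smul_comm]
    congr 1
    exact (opDInv a).τ_w i j
  have hv : ∀ j : Fin a, (wFn j : fn a) = (opDInv a).t • (qqwFn j : fn a) := fun j => by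
    rw [coe_qqwFn, smul_smul]
    change _ = ((q ^ 2)⁻¹ * q ^ 2) • _
    rw [inv_mul_cancel₀ (pow_ne_zero _ q_ne_zero), one_smul]
  cases ε
  · have := (opDInv a).cartanZero_step (u := qqwFn) (v := wFn) hu hv i m
    rw [DiffOps.coeffZero_map, DiffOps.coeffZero_map] at this
    have h : (opDInv a).cartanZero qqwFn wFn = psiZeroFn a := by
      unfold psiZeroFn DiffOps.cartanZero
      simp only [mul_comm (gZero (qqwFn (a := a) _))]; rfl
    rw [h] at this
    exact this
  · have := (opDInv a).cartanInf_step (u := qqwFn) (v := wFn) hu hv i m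
    rw [DiffOps.coeffInf_map, DiffOps.coeffInf_map] at this
    have h : (opDInv a).cartanInf qqwFn wFn = psiInfFn a := by
      unfold psiInfFn DiffOps.cartanInf
      simp only [mul_comm (gInf (qqwFn (a := a) _))]; rfl
    rw [h] at this
    exact this

/-- The operator assigned to `ψ^ε_s`. -/
def psiOp (a : ℕ) (ε : Bool) (s : ℤ) : A a := (psiFn a ε s : A a)

theorem psiOp_comm (ε ε' : Bool) (s t : ℤ) :
    psiOp a ε s * psiOp a ε' t = psiOp a ε' t * psiOp a ε s :=
  fn_commute (Subtype.property _) (Subtype.property _)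

theorem eOp_eq_opE (p : ℤ) : eOp a p = (opDInv a).opE (-q / (1 - q ^ 2)) p := eOp_eq p

theorem fOp_eq_opF (p : ℤ) : fOp a p = (opD a).opF (1 / (1 - q ^ 2)) p := fOp_eq p

theorem t_opDInv : (opDInv a).t⁻¹ = q ^ 2 := inv_inv _

theorem eOp_rel (m n : ℤ) :
    eOp a (m + 1) * eOp a n - q ^ 2 • (eOp a m * eOp a (n + 1)) =
      q ^ 2 • (eOp a n * eOp a (m + 1)) - eOp a (n + 1) * eOp a m := by
  simp only [eOp_eq_opE, ← t_opDInv (a := a)]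
  exact (opDInv a).opE_rel _ m n

theorem fOp_rel (m n : ℤ) :
    q ^ 2 • (fOp a (m + 1) * fOp a n) - fOp a m * fOp a (n + 1) =
      fOp a n * fOp a (m + 1) - q ^ 2 • (fOp a (n + 1) * fOp a m) := by
  simp only [fOp_eq_opF]
  exact (opD a).opF_rel _ m n

theorem psiOp_eOp (ε : Bool) (m n : ℤ) :
    psiOp a ε (m + 1) * eOp a n - q ^ 2 • (psiOp a ε m * eOp a (n + 1)) =
      q ^ 2 • (eOp a n * psiOp a ε (m + 1)) - eOp a (n + 1) * psiOp a ε m := by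
  simp only [eOp_eq_opE, ← t_opDInv (a := a)]
  refine (opDInv a).func_mul_opE (fun i => ?_) _ n
  have h := psiFn_step_DInv ε i m
  have hq : q ^ 2 ≠ 0 := pow_ne_zero _ q_ne_zero
  have hq' : (q ^ 2)⁻¹⁻¹ * (q ^ 2)⁻¹ ^ 2 * q ^ 2 = 1 := by
    rw [inv_inv, pow_two (q ^ 2)⁻¹, ← mul_assoc, mul_inv_cancel₀ hq, one_mul, inv_mul_cancel₀ hq]
  rw [coe_qqwFn, smul_sub, ← smul_mul_assoc, smul_smul, smul_smul, hq', one_smul,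
    smul_mul_assoc, inv_inv] at h
  rw [t_opDInv]
  exact h

theorem psiOp_fOp (ε : Bool) (m n : ℤ) :
    q ^ 2 • (psiOp a ε (m + 1) * fOp a n) - psiOp a ε m * fOp a (n + 1) =
      fOp a n * psiOp a ε (m + 1) - q ^ 2 • (fOp a (n + 1) * psiOp a ε m) := by
  simp only [fOp_eq_opF]
  exact (opD a).func_mul_opF (psiFn_step_D ε · m) _ n

end A

/-! ### The commutator of `e` and `f` -/

theorem coeffInf_C_mul {B : Type*} [CommRing B] (c : B) (f : PowerSeries B) (s : ℤ) :
    coeffInf (PowerSeries.C c * f) s = c * coeffInf f s := by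
  unfold coeffInf; split_ifs <;> simp

theorem coeffZero_C_mul {B : Type*} [CommRing B] (c : B) (f : PowerSeries B) (s : ℤ) :
    coeffZero (PowerSeries.C c * f) s = c * coeffZero f s := by
  unfold coeffZero; split_ifs <;> simp

namespace DiffOps

variable {K : Type*} [Field K] {a : ℕ} {C R : Type*} [CommRing C] [Algebra K C]
  [Ring R] [Algebra K R]

/-- The operators of `S'` are the inverses of the operators of `S`. -/
structure IsInverse (S S' : DiffOps K a C R) : Prop where
  ι_eq : S'.ι = S.ι
  w_eq : S'.w = S.w
  t_eq : S'.t = S.t⁻¹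
  T_eq : ∀ i, S'.T i = (S.T i)⁻¹

variable (S : DiffOps K a C R)

theorem τ_w_zpow (i j : Fin a) (n : ℤ) :
    S.τ i ((S.w j ^ n : Cˣ) : C) = (if i = j then S.t ^ n else 1) • ((S.w j ^ n : Cˣ) : C) := by
  have := S.τ_zpow_pt i (j, 0) n
  have h0 : S.pt (j, 0) = S.w j := by ext; simp [pt_val]
  rw [h0] at this
  rw [this]
  split_ifs with h
  · have h1 : S.pt (j, 0 + 1) =
        Units.map (algebraMap K C).toMonoidHom (Units.mk0 S.t S.t_ne) * S.w j := by
      ext; simp [pt_val, Algebra.smul_def]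
    rw [h1, mul_zpow, ← map_zpow, Units.val_mul, Algebra.smul_def]
    congr 1
    change algebraMap K C ((Units.mk0 S.t S.t_ne ^ n : Kˣ) : K) = _
    rw [Units.val_zpow_eq_zpow_val, Units.val_mk0]
  · simp [h0]

theorem one_ne_t : (1 : K) - S.t ≠ 0 := fun h => by
  have := S.pow_inj (a₁ := 0) (a₂ := 1) (by simpa [sub_eq_zero] using h)
  exact absurd this (by norm_num)

theorem τ_WI_of_ne {i j : Fin a} (h : i ≠ j) :
    S.τ i (S.WI j) = (S.w j : C) * Ring.inverse ((S.w j : C) - S.t • (S.w i : C)) *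
      ∏ s ∈ (Finset.univ.erase j).erase i, (S.w j : C) * Ring.inverse ((S.w j : C) - S.w s) := by
  rw [WI, map_prod, ← Finset.mul_prod_erase _ _ (Finset.mem_erase.2 ⟨h, Finset.mem_univ i⟩)]
  have h1 : ∀ s, s ≠ j → S.τ i ((S.w j : C) * Ring.inverse ((S.w j : C) - S.w s)) =
      (S.w j : C) * Ring.inverse ((S.w j : C) - (if i = s then S.t else 1) • (S.w s : C)) := by
    intro s hs
    rw [map_mul, map_inverse _ (S.isUnit_w_sub hs.symm), map_sub, S.τ_w, S.τ_w, if_neg h, one_smul]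
  rw [h1 i h, if_pos rfl]
  congr 1
  refine Finset.prod_congr rfl fun s hs => ?_
  rw [Finset.mem_erase, Finset.mem_erase] at hs
  rw [h1 s hs.2.1, if_neg hs.1.symm, one_smul]

theorem τ_WI_self (i : Fin a) :
    S.τ i (S.WI i) = ∏ s ∈ Finset.univ.erase i,
      S.t • (S.w i : C) * Ring.inverse (S.t • (S.w i : C) - S.w s) := by
  rw [WI, map_prod]
  refine Finset.prod_congr rfl fun s hs => ?_
  have h := (Finset.ne_of_mem_erase hs).symm
  rw [map_mul, map_inverse _ (S.isUnit_w_sub h), map_sub, S.τ_w, S.τ_w, if_pos rfl, if_neg h,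
    one_smul]

theorem WI_erase {i j : Fin a} (h : i ≠ j) :
    S.WI i = (S.w i : C) * Ring.inverse ((S.w i : C) - S.w j) *
      ∏ s ∈ (Finset.univ.erase i).erase j, (S.w i : C) * Ring.inverse ((S.w i : C) - S.w s) := by
  rw [WI, ← Finset.mul_prod_erase _ _ (Finset.mem_erase.2 ⟨h.symm, Finset.mem_univ j⟩)]

theorem inverse_neg_comm (i j : Fin a) (t : K) :
    Ring.inverse (t • (S.w i : C) - S.w j) = - Ring.inverse ((S.w j : C) - t • (S.w i : C)) := by
  have := inverse_smul (K := K) (c := -1) (by simp) ((S.w j : C) - t • (S.w i : C))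
  rw [neg_smul, one_smul, neg_sub] at this
  rw [this]; simp

variable {S} {S' : DiffOps K a C R}

theorem IsInverse.WI_eq (h : IsInverse S S') (i : Fin a) : S'.WI i = S.WI i := by
  simp only [WI, h.w_eq]

/-- Only the pair `{i, j}` feels the shifts, and its two denominators are proportional up to sign:
`w_j - t⁻¹ w_i = -t⁻¹ (w_i - t w_j)`. The resulting `t` matches the one from moving `P` past `y_n`,
so mixed terms leave `[e, f]`. -/
theorem IsInverse.off_diag (h : IsInverse S S') {i j : Fin a} (hij : i ≠ j) (m n : ℤ) :
    ((S.w i ^ m : Cˣ) : C) * S.WI i * S'.τ i (((S.w j ^ n : Cˣ) : C) * S.WI j) =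
      S.t • (((S.w j ^ n : Cˣ) : C) * S.WI j * S.τ j (((S.w i ^ m : Cˣ) : C) * S.WI i)) := by
  rw [map_mul, map_mul, S.τ_w_zpow, if_neg hij.symm, one_smul, S.τ_WI_of_ne hij.symm, ← h.w_eq,
    S'.τ_w_zpow, if_neg hij, one_smul, ← h.WI_eq j, S'.τ_WI_of_ne hij, h.w_eq, h.t_eq, h.WI_eq,
    S.WI_erase hij, S.WI_erase hij.symm]
  have e1 : Ring.inverse ((S.w j : C) - S.t⁻¹ • (S.w i : C)) =
      -(S.t • Ring.inverse ((S.w i : C) - S.t • (S.w j : C))) := by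
    have : (S.w j : C) - S.t⁻¹ • (S.w i : C) = S.t⁻¹ • (S.t • (S.w j : C) - S.w i) := by
      rw [smul_sub, smul_smul, inv_mul_cancel₀ S.t_ne, one_smul]
    rw [this, inverse_smul (inv_ne_zero S.t_ne), inv_inv, inverse_neg_comm, smul_neg]
  have e2 : Ring.inverse ((S.w j : C) - S.w i) = - Ring.inverse ((S.w i : C) - S.w j) := by
    have := S.inverse_neg_comm j i 1
    simpa using this
  rw [e1, e2]
  simp only [Algebra.smul_def]
  ring

/-- Terms with `i ≠ j` cancel by `off_diag`; for `i = j` the operators `T_i⁻¹ T_i` disappear and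
only a function remains. -/
theorem IsInverse.comm_y (h : IsInverse S S') (m n : ℤ) :
    S'.y m * S.y n - S.t • (S.y n * S'.y m) =
      S.ι (∑ i, (S.t⁻¹ ^ n • (((S.w i ^ (m + n) : Cˣ) : C) * (S.WI i * S'.τ i (S.WI i))) -
        (S.t * S.t ^ m) • (((S.w i ^ (m + n) : Cˣ) : C) * (S.WI i * S.τ i (S.WI i))))) := by
  have e1 : S'.y m * S.y n = ∑ i, ∑ j, S.ι (((S.w i ^ m : Cˣ) : C) * S.WI i *
      S'.τ i (((S.w j ^ n : Cˣ) : C) * S.WI j)) * (((S.T i)⁻¹ : Rˣ) * S.T j) := by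
    rw [y, y, Finset.sum_mul_sum]
    refine Finset.sum_congr rfl fun i _ => Finset.sum_congr rfl fun j _ => ?_
    rw [mul_assoc, ← mul_assoc (S'.T i : R), ← h.ι_eq, S'.T_mul, map_mul S'.ι (_ * _) (S'.τ i _),
      h.w_eq, h.WI_eq, h.T_eq]
    simp only [mul_assoc]
  have e2 : S.y n * S'.y m = ∑ i, ∑ j, S.ι (((S.w j ^ n : Cˣ) : C) * S.WI j *
      S.τ j (((S.w i ^ m : Cˣ) : C) * S.WI i)) * (((S.T i)⁻¹ : Rˣ) * S.T j) := by
    rw [y, y, Finset.sum_mul_sum, Finset.sum_comm]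
    refine Finset.sum_congr rfl fun i _ => Finset.sum_congr rfl fun j _ => ?_
    have hc : (((S.T i)⁻¹ : Rˣ) : R) * S.T j = S.T j * ((S.T i)⁻¹ : Rˣ) :=
      ((S.T_comm i j).units_inv_left).eq
    rw [mul_assoc, ← mul_assoc (S.T j : R), h.ι_eq, S.T_mul, map_mul S.ι (_ * _) (S.τ j _),
      h.w_eq, h.WI_eq, h.T_eq, hc]
    simp only [mul_assoc]
  rw [e1, e2, Finset.smul_sum, ← Finset.sum_sub_distrib, map_sum]
  refine Finset.sum_congr rfl fun i _ => ?_
  rw [Finset.smul_sum, ← Finset.sum_sub_distrib, Finset.sum_eq_single i]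
  · rw [Units.inv_mul, mul_one, mul_one, ← map_smul, ← map_sub]
    congr 1
    rw [map_mul, map_mul, S.τ_w_zpow, if_pos rfl]
    conv_lhs => rw [← h.w_eq]
    rw [S'.τ_w_zpow, if_pos rfl, h.t_eq, h.w_eq]
    simp only [zpow_add, Units.val_mul, Algebra.smul_def, map_mul]
    ring
  · intro j _ hj
    rw [h.off_diag hj.symm, map_smul, smul_mul_assoc, sub_self]
  · simp

theorem prod_erase_inl {M : Type*} [CommMonoid M] {n : ℕ} (i : Fin n) (F : Fin n ⊕ Fin n → M) :
    ∏ x ∈ Finset.univ.erase (Sum.inl i), F x =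
      (∏ s ∈ Finset.univ.erase i, F (Sum.inl s)) * ∏ s, F (Sum.inr s) := by
  have : (Finset.univ.erase (Sum.inl i) : Finset (Fin n ⊕ Fin n)) =
      (Finset.univ.erase i).disjSum Finset.univ := by
    ext x; cases x <;> simp
  rw [this, Finset.prod_disjSum]

theorem prod_erase_inr {M : Type*} [CommMonoid M] {n : ℕ} (i : Fin n) (F : Fin n ⊕ Fin n → M) :
    ∏ x ∈ Finset.univ.erase (Sum.inr i), F x =
      (∏ s, F (Sum.inl s)) * ∏ s ∈ Finset.univ.erase i, F (Sum.inr s) := by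
  have : (Finset.univ.erase (Sum.inr i) : Finset (Fin n ⊕ Fin n)) =
      Finset.univ.disjSum (Finset.univ.erase i) := by
    ext x; cases x <;> simp
  rw [this, Finset.prod_disjSum]

variable (S) in
/-- The poles `w_i`, `t w_i` of the Cartan current. -/
def pole (x : Fin a ⊕ Fin a) : Cˣ := S.pt (x.elim (fun i => (i, 0)) (fun i => (i, 1)))

variable (S) in
theorem isUnit_pole_sub (x y : Fin a ⊕ Fin a) (hxy : x ≠ y) :
    IsUnit ((S.pole x : C) - S.pole y) := by
  refine S.isUnit_pt_sub fun h => hxy ?_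
  rcases x with i | i <;> rcases y with j | j <;> simp_all

theorem pole_inl (i : Fin a) : (S.pole (Sum.inl i) : C) = S.w i := by simp [pole, pt_val]

theorem pole_inr (i : Fin a) : (S.pole (Sum.inr i) : C) = S.t • (S.w i : C) := by
  simp [pole, pt_val]

/-- The partner pole `t w_i` contributes the scalar `(1 - t)⁻¹`; the other poles `w_s` and `t w_s`
assemble into `1/W_i(w_i)` and its image under the inverse shift. -/
theorem IsInverse.pfCoef_inl (h : IsInverse S S') (i : Fin a) :
    pfCoef S.pole (Sum.inl i) = (1 - S.t)⁻¹ • (S.WI i * S'.τ i (S.WI i)) := by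
  rw [pfCoef, prod_erase_inl]
  simp only [pole_inl, pole_inr]
  rw [← Finset.mul_prod_erase (a := i) Finset.univ _ (Finset.mem_univ i), mul_left_comm]
  have e1 : (S.w i : C) * Ring.inverse ((S.w i : C) - S.t • (S.w i : C)) =
      (1 - S.t)⁻¹ • (1 : C) := by
    have : (S.w i : C) - S.t • (S.w i : C) = (1 - S.t) • (S.w i : C) := by rw [sub_smul, one_smul]
    rw [this, inverse_smul S.one_ne_t, mul_smul_comm, Ring.mul_inverse_cancel _ (Units.isUnit _)]
  rw [e1, smul_mul_assoc, one_mul, ← h.WI_eq, S'.τ_WI_self, h.w_eq, h.WI_eq]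
  congr 2
  refine Finset.prod_congr rfl fun s hs => ?_
  rw [h.t_eq]
  have : S.t⁻¹ • (S.w i : C) - S.w s = S.t⁻¹ • ((S.w i : C) - S.t • (S.w s : C)) := by
    rw [smul_sub, smul_smul, inv_mul_cancel₀ S.t_ne, one_smul]
  rw [this, inverse_smul (inv_ne_zero S.t_ne), smul_mul_smul_comm, inv_inv,
    inv_mul_cancel₀ S.t_ne, one_smul]

variable (S) in
theorem pfCoef_inr (i : Fin a) :
    pfCoef S.pole (Sum.inr i) = (-(S.t * (1 - S.t)⁻¹)) • (S.WI i * S.τ i (S.WI i)) := by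
  rw [pfCoef, prod_erase_inr]
  simp only [pole_inl, pole_inr]
  rw [← Finset.mul_prod_erase (a := i) Finset.univ _ (Finset.mem_univ i)]
  have e1 : S.t • (S.w i : C) * Ring.inverse (S.t • (S.w i : C) - (S.w i : C)) =
      (-(S.t * (1 - S.t)⁻¹)) • (1 : C) := by
    have : S.t • (S.w i : C) - S.w i = (-(1 - S.t)) • (S.w i : C) := by
      rw [neg_sub, sub_smul, one_smul]
    rw [this, inverse_smul (neg_ne_zero.2 S.one_ne_t), smul_mul_smul_comm,
      Ring.mul_inverse_cancel _ (Units.isUnit _), inv_neg, mul_neg]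
  rw [e1, smul_mul_assoc, smul_mul_assoc, one_mul, S.τ_WI_self, mul_comm (S.WI i)]
  congr 2
  refine Finset.prod_congr rfl fun s hs => ?_
  rw [← smul_sub, inverse_smul S.t_ne, smul_mul_smul_comm, mul_inv_cancel₀ S.t_ne, one_smul]

/-- The diagonal terms of `comm_y` are the residues of the Cartan current at `w_i` and `t w_i`, and
the difference of the two expansions is the sum of residues times powers of the poles. -/
theorem IsInverse.comm_opE_opF (h : IsInverse S S') [Nonempty (Fin a)] (c c' : K)
    {v : Fin a → Cˣ} (hv : ∀ j, (v j : C) = S.t • (S.w j : C)) (m n : ℤ) :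
    S'.opE c m * S.opF c' n - S.opF c' n * S'.opE c m =
      (c * c' * (1 - S.t)) • (S.ι (coeffInf (S.cartanInf S.w v) (m + n)) -
        S.ι (coeffZero (S.cartanZero S.w v) (m + n))) := by
  have hP : S'.P = S.P := by rw [P, P, h.w_eq]
  have hw : ∀ j, S.w j = S.pole (Sum.inl j) := fun j => Units.ext (pole_inl j).symm
  have hv' : ∀ j, v j = S.pole (Sum.inr j) := fun j => Units.ext (by rw [hv, pole_inr])
  have hinf : S.cartanInf S.w v = PowerSeries.C (S.P : C) * ∏ x, gInf (S.pole x) := by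
    rw [cartanInf, Finset.prod_mul_distrib, Fintype.prod_sum_type]
    simp only [hv', ← hw]
  have hzero : S.cartanZero S.w v = PowerSeries.C (S.P : C) * ∏ x, gZero (S.pole x) := by
    rw [cartanZero, Finset.prod_mul_distrib, Fintype.prod_sum_type]
    simp only [hv', ← hw]
  rw [← map_sub, hinf, hzero, coeffInf_C_mul, coeffZero_C_mul, ← mul_sub,
    coeffInf_sub_coeffZero S.pole S.isUnit_pole_sub, Fintype.sum_sum_type,
    ← Finset.sum_add_distrib, ← map_smul]
  have e1 : S'.opE c m * S.opF c' n - S.opF c' n * S'.opE c m =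
      (c * c' * S.t ^ n) • (S.ι S.P * (S'.y m * S.y n - S.t • (S.y n * S'.y m))) := by
    rw [opE, opF, smul_mul_smul_comm, smul_mul_smul_comm, h.ι_eq, hP, ← mul_assoc (S.y n),
      S.y_mul_P, mul_sub, smul_mul_assoc, mul_smul_comm, mul_assoc (S.ι _), mul_assoc (S.ι _),
      smul_sub, mul_comm (c' * S.t ^ n) c, mul_assoc c]
  rw [e1, h.comm_y, ← map_mul, ← map_smul]
  congr 1
  rw [Finset.mul_sum, Finset.mul_sum, Finset.smul_sum, Finset.smul_sum]
  refine Finset.sum_congr rfl fun i _ => ?_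
  rw [h.pfCoef_inl, S.pfCoef_inr, ← hw]
  have e2 : ((S.pole (Sum.inr i) ^ (m + n) : Cˣ) : C) =
      S.t ^ (m + n) • ((S.w i ^ (m + n) : Cˣ) : C) := by
    have := S.τ_w_zpow i i (m + n)
    rw [if_pos rfl] at this
    rw [← this]
    have h3 : S.pole (Sum.inr i) = Units.map (S.τ i : C →* C) (S.w i) := by
      ext
      rw [pole_inr]
      change _ = S.τ i (S.w i)
      rw [S.τ_w, if_pos rfl]
    rw [h3, ← map_zpow]; rfl
  rw [e2]
  have k1 : (S.t ^ n : K) * S.t⁻¹ ^ n = 1 := by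
    rw [← mul_zpow, mul_inv_cancel₀ S.t_ne, one_zpow]
  have k2 : (1 - S.t) * (1 - S.t)⁻¹ = 1 := mul_inv_cancel₀ S.one_ne_t
  have k1' := congrArg (algebraMap K C) k1
  have k2' := congrArg (algebraMap K C) k2
  simp only [zpow_add₀ S.t_ne, Algebra.smul_def, map_mul, map_neg, map_one] at k1' k2' ⊢
  set W := ((S.w i ^ (m + n) : Cˣ) : C)
  set A1 := S.WI i * (S'.τ i) (S.WI i)
  set A2 := S.WI i * (S.τ i) (S.WI i)
  set P := (S.P : C)
  set γ := algebraMap K C c * algebraMap K C c'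
  linear_combination (γ * P * W * A1) * k1' - (γ * P * W * A1) * k2' +
    (γ * P * W * A2 * algebraMap K C S.t * algebraMap K C (S.t ^ m) * algebraMap K C (S.t ^ n)) * k2'

end DiffOps

/-! ### Range of the Cartan modes and verification of the defining relations -/

namespace A

variable {a : ℕ}

theorem isInverse_opD : (opD a).IsInverse (opDInv a) where
  ι_eq := rfl
  w_eq := rfl
  t_eq := rfl
  T_eq _ := rfl

theorem one_sub_q_sq_ne : 1 - q ^ 2 ≠ 0 := sub_ne_zero.2 q_sq_ne_one.symm

theorem eOp_fOp [Nonempty (Fin a)] (m n : ℤ) :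
    eOp a m * fOp a n - fOp a n * eOp a m =
      (q - q⁻¹)⁻¹ • (psiOp a true (m + n) - psiOp a false (m + n)) := by
  rw [eOp_eq_opE, fOp_eq_opF, (isInverse_opD (a := a)).comm_opE_opF _ _ coe_qqwFn]
  have : -q / (1 - q ^ 2) * (1 / (1 - q ^ 2)) * (1 - (opD a).t) = (q - q⁻¹)⁻¹ := by
    have h1 := one_sub_q_sq_ne
    have h2 := q_ne_zero
    have h3 : q - q⁻¹ ≠ 0 := fun h => h1 (by
      have := congrArg (fun z => z * (-q)) h
      rw [sub_mul, mul_neg, mul_neg, inv_mul_cancel₀ h2, zero_mul] at this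
      rw [← this]; ring)
    change -q / (1 - q ^ 2) * (1 / (1 - q ^ 2)) * (1 - q ^ 2) = _
    rw [mul_assoc, one_div_mul_cancel h1, mul_one, div_eq_iff h1, eq_comm, inv_mul_eq_iff_eq_mul₀ h3,
      sub_mul, mul_neg, mul_neg, inv_mul_cancel₀ h2]
    ring
  rw [this]; rfl

/-- The power series `z⁻¹ (1 - c/z)⁻¹` in `z`. -/
def hZero {B : Type*} [Ring B] (c : Bˣ) : PowerSeries B :=
  PowerSeries.mk fun j => -((c⁻¹ ^ (j + 1) : Bˣ) : B)

theorem gZero_eq {B : Type*} [CommRing B] (c : Bˣ) : gZero c = PowerSeries.X * hZero c := by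
  ext n
  cases n with
  | zero => simp [gZero]
  | succ n => rw [PowerSeries.coeff_succ_X_mul]; simp [gZero, hZero]

/-- Each of the `2a` factors vanishes to first order at `z = 0`, which accounts for the shift; the
remaining factor has invertible constant term. -/
theorem psiZeroFn_eq : psiZeroFn a = PowerSeries.X ^ (2 * a) *
    (PowerSeries.C (PFn a : fn a) * ∏ i : Fin a, (hZero (wFn i) * hZero (qqwFn i))) := by
  have : ∀ i : Fin a, gZero (wFn i) * gZero (qqwFn i) =
      PowerSeries.X ^ 2 * (hZero (wFn i) * hZero (qqwFn i)) := fun i => by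
    rw [gZero_eq, gZero_eq]; ring
  rw [psiZeroFn, DiffOps.cartanZero, Finset.prod_congr rfl fun i _ => this i,
    Finset.prod_mul_distrib, Finset.prod_const, Finset.card_univ, Fintype.card_fin, ← pow_mul,
    P_opD]
  ring

theorem psiFn_false_eq_zero {s : ℤ} (hs : -(2 * a : ℤ) < s) : psiFn a false s = 0 := by
  unfold psiFn coeffZero
  simp only
  split_ifs with h
  · rw [psiZeroFn_eq, PowerSeries.coeff_X_pow_mul', if_neg (by omega)]
  · rfl

theorem psiFn_true_eq_zero {s : ℤ} (hs : s < 0) : psiFn a true s = 0 := by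
  simp [psiFn, coeffInf, hs]

theorem psiFn_true_zero : psiFn a true 0 = PFn a := by
  simp [psiFn, coeffInf, psiInfFn, DiffOps.cartanInf, gInf, P_opD, map_prod]

/-- The leading coefficient is `P ∏ (w_i · q² w_i)⁻¹`; the signs cancel in pairs. Thus both extreme
Cartan modes are powers of `P` up to scalars. -/
theorem psiFn_false_bot : psiFn a false (-(2 * a)) = (q ^ 2)⁻¹ ^ a • ((PFn a)⁻¹ : (fn a)ˣ) := by
  have h1 : (-(-(2 * a : ℤ))).toNat = 2 * a := by omega
  simp only [psiFn, coeffZero]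
  rw [if_pos (by omega), h1, psiZeroFn_eq, PowerSeries.coeff_X_pow_mul', if_pos le_rfl, Nat.sub_self,
    PowerSeries.coeff_zero_eq_constantCoeff_apply, map_mul, map_prod, PowerSeries.constantCoeff_C]
  have h2 : ∀ i : Fin a, (PowerSeries.constantCoeff (hZero (wFn i) * hZero (qqwFn i)) : fn a) =
      (q ^ 2)⁻¹ • (((wFn i)⁻¹ * (wFn i)⁻¹ : (fn a)ˣ) : fn a) := fun i => by
    have h3 : (((qqwFn i)⁻¹ : (fn a)ˣ) : fn a) = (q ^ 2)⁻¹ • (((wFn i)⁻¹ : (fn a)ˣ) : fn a) := by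
      have := qqwFn_zpow i (-1)
      simpa only [zpow_neg, zpow_one] using this
    rw [map_mul, hZero, hZero, ← PowerSeries.coeff_zero_eq_constantCoeff_apply,
      ← PowerSeries.coeff_zero_eq_constantCoeff_apply, PowerSeries.coeff_mk, PowerSeries.coeff_mk,
      zero_add, pow_one, pow_one, h3, neg_mul_neg, mul_smul_comm, Units.val_mul]
  simp_rw [h2]
  rw [Finset.prod_smul, Finset.prod_const, Finset.card_univ, Fintype.card_fin, mul_smul_comm,
    ← Units.coe_prod, ← Units.val_mul, Finset.prod_mul_distrib, Finset.prod_inv_distrib]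
  change _ • ((PFn a * ((PFn a)⁻¹ * (PFn a)⁻¹) : (fn a)ˣ) : fn a) = _
  rw [mul_inv_cancel_left]

theorem psiOp_true_natCast (s : ℕ) : psiOp a true s = PowerSeries.coeff s (psiInf a) := by
  rw [psiInf_eq]
  simp [psiOp, psiFn, coeffInf]

theorem psiOp_false_natCast (s : ℕ) :
    psiOp a false (-(s : ℤ)) = PowerSeries.coeff s (psiZero a) := by
  rw [psiZero_eq]
  simp [psiOp, psiFn, coeffZero]

/-- The invertible element `∏_t w_t`. -/
def PA (a : ℕ) : (A a)ˣ := Units.map ((fn a).val : fn a →* A a) (PFn a)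

theorem psiOp_true_zero : psiOp a true 0 = PA a := by
  rw [psiOp, psiFn_true_zero]; rfl

theorem psiOp_false_bot : psiOp a false (-(2 * a)) = (q ^ 2)⁻¹ ^ a • (((PA a)⁻¹ : (A a)ˣ) : A a) := by
  rw [psiOp, psiFn_false_bot]; rfl

/-- The images of the generators of the shifted quantum affine algebra. -/
def genOp (a : ℕ) : UGen → A a
  | .e p => eOp a p
  | .f p => fOp a p
  | .psiP s => psiOp a true s
  | .psiM s => psiOp a false (-(2 * a) - s)
  | .psiPInv => ((PA a)⁻¹ : (A a)ˣ)
  | .psiMInv => (q ^ 2) ^ a • (PA a : A a)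

theorem lift_psi {b : ℤ} (hb : b = -(2 * a)) (ε : Bool) (s : ℤ) :
    FreeAlgebra.lift Cq (genOp a) (UFree.psi b ε s) = psiOp a ε s := by
  subst hb
  cases ε
  · simp only [UFree.psi]
    split_ifs with h
    · rw [FreeAlgebra.lift_ι_apply, genOp]
      congr 1; omega
    · rw [map_zero, psiOp, psiFn_false_eq_zero (by omega)]; rfl
  · simp only [UFree.psi]
    split_ifs with h
    · rw [FreeAlgebra.lift_ι_apply, genOp]
      congr 1; omega
    · rw [map_zero, psiOp, psiFn_true_eq_zero (by omega)]; rfl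

theorem lift_rel [Nonempty (Fin a)] {b : ℤ} (hb : b = -(2 * a)) {x y : FreeAlgebra Cq UGen}
    (h : URel b x y) : FreeAlgebra.lift Cq (genOp a) x = FreeAlgebra.lift Cq (genOp a) y := by
  have he : ∀ p, FreeAlgebra.lift Cq (genOp a) (UFree.e p) = eOp a p :=
    fun p => FreeAlgebra.lift_ι_apply _ _
  have hf : ∀ p, FreeAlgebra.lift Cq (genOp a) (UFree.f p) = fOp a p :=
    fun p => FreeAlgebra.lift_ι_apply _ _
  have hq : (q ^ 2) ^ a ≠ 0 := pow_ne_zero _ (pow_ne_zero _ q_ne_zero)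
  cases h with
  | psi_psi ε ε' s t => rw [map_mul, map_mul, lift_psi hb, lift_psi hb, psiOp_comm]
  | psiP_mul_inv =>
    rw [map_mul, lift_psi hb, FreeAlgebra.lift_ι_apply, map_one, psiOp_true_zero]
    exact Units.mul_inv _
  | psiP_inv_mul =>
    rw [map_mul, lift_psi hb, FreeAlgebra.lift_ι_apply, map_one, psiOp_true_zero]
    exact Units.inv_mul _
  | psiM_mul_inv =>
    rw [map_mul, lift_psi hb, FreeAlgebra.lift_ι_apply, map_one, hb, psiOp_false_bot, genOp,
      smul_mul_smul_comm, Units.inv_mul, inv_pow, inv_mul_cancel₀ hq, one_smul]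
  | psiM_inv_mul =>
    rw [map_mul, lift_psi hb, FreeAlgebra.lift_ι_apply, map_one, hb, psiOp_false_bot, genOp,
      smul_mul_smul_comm, Units.mul_inv, inv_pow, mul_inv_cancel₀ hq, one_smul]
  | e_e m n => simpa only [map_mul, map_sub, map_smul, he] using eOp_rel m n
  | f_f m n => simpa only [map_mul, map_sub, map_smul, hf] using fOp_rel m n
  | psi_e ε m n => simpa only [map_mul, map_sub, map_smul, he, lift_psi hb] using psiOp_eOp ε m n
  | psi_f ε m n => simpa only [map_mul, map_sub, map_smul, hf, lift_psi hb] using psiOp_fOp ε m n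
  | e_f m n => simpa only [map_mul, map_sub, map_smul, he, hf, lift_psi hb] using eOp_fOp m n

end A

/-! ### Existence and uniqueness of the homomorphism to difference operators -/

/-- The homomorphism from the shifted quantum affine algebra to difference operators. -/
def gklo (r : ℕ) : U (-(2 * r + 2)) →ₐ[Cq] A (r + 1) :=
  RingQuot.liftAlgHom Cq ⟨FreeAlgebra.lift Cq (A.genOp (r + 1)), fun _ _ h =>
    A.lift_rel (by push_cast; ring) h⟩

theorem gklo_gen (r : ℕ) (g : UGen) : gklo r (U.gen _ g) = A.genOp (r + 1) g := by
  rw [gklo, U.gen, RingQuot.liftAlgHom_mkAlgHom_apply, FreeAlgebra.lift_ι_apply]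

theorem isGKLO_gklo (r : ℕ) : IsGKLO r (gklo r) where
  map_e p := by rw [gklo_gen]; rfl
  map_f p := by rw [gklo_gen]; rfl
  map_psiP s := by rw [gklo_gen, A.genOp, A.psiOp_true_natCast]
  map_psiM s := by
    rw [gklo_gen, A.genOp, ← A.psiOp_false_natCast]
    congr 1; push_cast; ring

theorem U.hom_ext {b : ℤ} {B : Type*} [Ring B] [Algebra Cq B] {Φ Ψ : U b →ₐ[Cq] B}
    (h : ∀ g, Φ (U.gen b g) = Ψ (U.gen b g)) : Φ = Ψ := by
  refine RingQuot.ringQuot_ext' Cq _ _ (FreeAlgebra.hom_ext ?_)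
  funext g; exact h g

theorem U.psiP_zero_mul_inv (b : ℤ) : U.gen b (.psiP 0) * U.gen b .psiPInv = 1 := by
  have := RingQuot.mkAlgHom_rel Cq (URel.psiP_mul_inv (b := b))
  simpa [UFree.psi, U.gen] using this

theorem U.psiPInv_mul (b : ℤ) : U.gen b .psiPInv * U.gen b (.psiP 0) = 1 := by
  have := RingQuot.mkAlgHom_rel Cq (URel.psiP_inv_mul (b := b))
  simpa [UFree.psi, U.gen] using this

theorem U.psiM_zero_mul_inv (b : ℤ) : U.gen b (.psiM 0) * U.gen b .psiMInv = 1 := by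
  have := RingQuot.mkAlgHom_rel Cq (URel.psiM_mul_inv (b := b))
  simpa [UFree.psi, U.gen] using this

theorem U.psiMInv_mul (b : ℤ) : U.gen b .psiMInv * U.gen b (.psiM 0) = 1 := by
  have := RingQuot.mkAlgHom_rel Cq (URel.psiM_inv_mul (b := b))
  simpa [UFree.psi, U.gen] using this

/-- The images of the two inverse generators are not prescribed, but inverses are unique. -/
theorem IsGKLO.unique {r : ℕ} {Φ Ψ : U (-(2 * r + 2)) →ₐ[Cq] A (r + 1)} (hΦ : IsGKLO r Φ)
    (hΨ : IsGKLO r Ψ) : Φ = Ψ := by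
  have hP : ∀ s, Φ (U.gen _ (.psiP s)) = Ψ (U.gen _ (.psiP s)) := fun s => by
    rw [hΦ.map_psiP, hΨ.map_psiP]
  have hM : ∀ s, Φ (U.gen _ (.psiM s)) = Ψ (U.gen _ (.psiM s)) := fun s => by
    rw [hΦ.map_psiM, hΨ.map_psiM]
  refine U.hom_ext fun g => ?_
  cases g with
  | e p => rw [hΦ.map_e, hΨ.map_e]
  | f p => rw [hΦ.map_f, hΨ.map_f]
  | psiP s => exact hP s
  | psiM s => exact hM s
  | psiPInv =>
    refine left_inv_eq_right_inv (a := Φ (U.gen _ (.psiP 0))) ?_ ?_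
    · rw [← map_mul, U.psiPInv_mul, map_one]
    · rw [hP, ← map_mul, U.psiP_zero_mul_inv, map_one]
  | psiMInv =>
    refine left_inv_eq_right_inv (a := Φ (U.gen _ (.psiM 0))) ?_ ?_
    · rw [← map_mul, U.psiMInv_mul, map_one]
    · rw [hM, ← map_mul, U.psiM_zero_mul_inv, map_one]

/-! ### Polynomial antisymmetrization -/

section Antisymm

variable {K : Type*} [Field K] {k : ℕ}

/-- The antisymmetrization of `f ∏_{i<j} (x_i - t x_j)`. -/
def anti {B : Type*} [CommRing B] [Algebra K B] (t : K) (x : Fin k → Bˣ)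
    (f : (Fin k → ℤ) →₀ K) : B :=
  ∑ σ : Equiv.Perm (Fin k), ((Equiv.Perm.sign σ : ℤ) : B) *
    (ev (x ∘ σ) f * zProd t ((fun l => (x l : B)) ∘ σ))

/-- Clearing denominators of a Laurent polynomial. -/
theorem exists_polynomial (f : (Fin k → ℤ) →₀ K) :
    ∃ N₀ : ℕ, ∀ N ≥ N₀, ∃ f₀ : MvPolynomial (Fin k) K,
      ∀ (B : Type) [CommRing B] [Algebra K B] (x : Fin k → Bˣ),
        ev x f = (∏ l, ((x l ^ (-(N : ℤ)) : Bˣ) : B)) *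
          MvPolynomial.aeval (fun l => (x l : B)) f₀ := by
  induction f using Finsupp.induction_linear with
  | zero => exact ⟨0, fun N _ => ⟨0, fun B _ _ x => by simp [ev]⟩⟩
  | add f g hf hg =>
    obtain ⟨N₁, h₁⟩ := hf
    obtain ⟨N₂, h₂⟩ := hg
    refine ⟨max N₁ N₂, fun N hN => ?_⟩
    obtain ⟨f₁, h₁⟩ := h₁ N (le_trans (le_max_left _ _) hN)
    obtain ⟨f₂, h₂⟩ := h₂ N (le_trans (le_max_right _ _) hN)
    exact ⟨f₁ + f₂, fun B _ _ x => by rw [ev_add, h₁, h₂, map_add, mul_add]⟩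
  | single p c =>
    refine ⟨∑ l, (p l).natAbs, fun N hN => ?_⟩
    refine ⟨MvPolynomial.monomial (Finsupp.equivFunOnFinite.symm fun l => (p l + N).toNat) c,
      fun B _ _ x => ?_⟩
    rw [ev_single, MvPolynomial.aeval_monomial, Finsupp.prod_fintype _ _ (by simp),
      Algebra.smul_def, mul_left_comm, ← Finset.prod_mul_distrib]
    congr 1
    refine Finset.prod_congr rfl fun l _ => ?_
    have h1 : (p l).natAbs ≤ N :=
      (Finset.single_le_sum (f := fun l => (p l).natAbs) (fun _ _ => Nat.zero_le _)
        (Finset.mem_univ l)).trans hN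
    rw [← Units.val_pow_eq_pow_val, ← Units.val_mul, ← zpow_natCast, ← zpow_add]
    congr 2
    simp only [Finsupp.coe_equivFunOnFinite_symm]
    omega

/-- The antisymmetrization of `f₀ ∏_{i<j} (X_i - t X_j)` for a polynomial `f₀`. -/
def antiPoly (t : K) (f₀ : MvPolynomial (Fin k) K) : MvPolynomial (Fin k) K :=
  ∑ σ : Equiv.Perm (Fin k), ((Equiv.Perm.sign σ : ℤ) : MvPolynomial (Fin k) K) *
    (MvPolynomial.rename σ f₀ * zProd t (MvPolynomial.X ∘ σ))

theorem aeval_antiPoly {B : Type*} [CommRing B] [Algebra K B] (t : K) (x : Fin k → B)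
    (f₀ : MvPolynomial (Fin k) K) :
    MvPolynomial.aeval x (antiPoly t f₀) =
      ∑ σ : Equiv.Perm (Fin k), ((Equiv.Perm.sign σ : ℤ) : B) *
        (MvPolynomial.aeval (x ∘ σ) f₀ * zProd t (x ∘ σ)) := by
  rw [antiPoly, map_sum]
  refine Finset.sum_congr rfl fun σ _ => ?_
  rw [map_mul, map_mul, map_intCast, MvPolynomial.aeval_rename, map_zProd]
  congr 3
  funext l; simp

theorem anti_eq_aeval {B : Type*} [CommRing B] [Algebra K B] (t : K) (x : Fin k → Bˣ)
    (f : (Fin k → ℤ) →₀ K) (N : ℕ) (f₀ : MvPolynomial (Fin k) K)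
    (h : ∀ x : Fin k → Bˣ, ev x f = (∏ l, ((x l ^ (-(N : ℤ)) : Bˣ) : B)) *
          MvPolynomial.aeval (fun l => (x l : B)) f₀) :
    anti t x f = (∏ l, ((x l ^ (-(N : ℤ)) : Bˣ) : B)) *
      MvPolynomial.aeval (fun l => (x l : B)) (antiPoly t f₀) := by
  rw [aeval_antiPoly, anti, Finset.mul_sum]
  refine Finset.sum_congr rfl fun σ _ => ?_
  rw [h]
  have := Equiv.prod_comp σ fun l => ((x l ^ (-(N : ℤ)) : Bˣ) : B)
  simp only [Function.comp_def] at this ⊢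
  rw [this]
  ring

theorem rename_antiPoly (t : K) (f₀ : MvPolynomial (Fin k) K) (τ : Equiv.Perm (Fin k)) :
    MvPolynomial.rename τ (antiPoly t f₀) =
      ((Equiv.Perm.sign τ : ℤ) : MvPolynomial (Fin k) K) * antiPoly t f₀ := by
  rw [antiPoly, map_sum, Finset.mul_sum, ← Equiv.sum_comp (Equiv.mulLeft τ)
    (fun σ => ((Equiv.Perm.sign τ : ℤ) : MvPolynomial (Fin k) K) * _)]
  refine Finset.sum_congr rfl fun σ _ => ?_
  rw [map_mul, map_mul, map_intCast, MvPolynomial.rename_rename, map_zProd]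
  have h1 : MvPolynomial.rename τ ∘ (MvPolynomial.X : Fin k → MvPolynomial (Fin k) K) ∘ σ =
      MvPolynomial.X ∘ (τ * σ) := by
    funext l; simp
  have h2 : (τ : Fin k → Fin k) ∘ σ = (τ * σ : Equiv.Perm (Fin k)) := rfl
  have h3 : ((Equiv.Perm.sign τ : ℤ) : MvPolynomial (Fin k) K) *
      ((Equiv.Perm.sign τ : ℤ) : MvPolynomial (Fin k) K) = 1 := by
    rw [← Int.cast_mul, Int.units_coe_mul_self, Int.cast_one]
  rw [h1, h2, Equiv.coe_mulLeft, Equiv.Perm.sign_mul, Units.val_mul, Int.cast_mul]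
  calc _ = (1 : MvPolynomial (Fin k) K) * _ := (one_mul _).symm
    _ = _ := by rw [← h3]; ring

/-- The substitution `X_i ↦ X_j`. -/
def merge (i j : Fin k) : MvPolynomial (Fin k) K →ₐ[K] MvPolynomial (Fin k) K :=
  MvPolynomial.rename (Function.update id i j)

/-- Modulo `X_i - X_j` the substitution `X_i ↦ X_j` is the identity. -/
theorem dvd_of_merge_eq_zero {i j : Fin k} {p : MvPolynomial (Fin k) K} (hp : merge i j p = 0) :
    MvPolynomial.X i - MvPolynomial.X j ∣ p := by
  rw [← Ideal.mem_span_singleton, ← Ideal.Quotient.eq_zero_iff_mem]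
  set I : Ideal (MvPolynomial (Fin k) K) := Ideal.span {MvPolynomial.X i - MvPolynomial.X j}
  have h : (Ideal.Quotient.mkₐ K I).comp (merge i j) = Ideal.Quotient.mkₐ K I := by
    refine MvPolynomial.algHom_ext fun l => ?_
    simp only [AlgHom.comp_apply, merge, MvPolynomial.rename_X, Function.update_apply, id]
    split_ifs with hl
    · subst hl
      simp only [Ideal.Quotient.mkₐ_eq_mk]
      rw [eq_comm, Ideal.Quotient.eq]
      exact Ideal.mem_span_singleton_self _
    · rfl
  have := DFunLike.congr_fun h p
  rw [AlgHom.comp_apply, hp, map_zero] at this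
  exact this.symm

/-- Divide out one factor at a time: merging a new pair does not kill the factors of the other
pairs, and the polynomial ring is a domain. Ordering each pair excludes its reversal. -/
theorem prod_dvd_of_merge (s : Finset (Fin k × Fin k)) (hs : ∀ x ∈ s, x.1 < x.2)
    (p : MvPolynomial (Fin k) K) (hp : ∀ x ∈ s, merge x.1 x.2 p = 0) :
    ∏ x ∈ s, (MvPolynomial.X x.1 - MvPolynomial.X x.2) ∣ p := by
  classical
  induction s using Finset.induction_on with
  | empty => simp
  | insert y s hy ih =>
    obtain ⟨g, hg⟩ := ih (fun x hx => hs x (Finset.mem_insert_of_mem hx))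
      fun x hx => hp x (Finset.mem_insert_of_mem hx)
    have h1 := hp y (Finset.mem_insert_self _ _)
    have h2 := hs y (Finset.mem_insert_self _ _)
    rw [hg, map_mul, mul_eq_zero, map_prod, Finset.prod_eq_zero_iff] at h1
    rw [Finset.prod_insert hy, hg, mul_comm]
    refine mul_dvd_mul_left _ (dvd_of_merge_eq_zero (h1.resolve_left ?_))
    rintro ⟨x, hx, hx0⟩
    have h3 := hs x (Finset.mem_insert_of_mem hx)
    simp only [merge, map_sub, MvPolynomial.rename_X, sub_eq_zero, MvPolynomial.X_inj,
      Function.update_apply, id] at hx0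
    have hne : x ≠ y := fun h => hy (h ▸ hx)
    split_ifs at hx0 with e1 e2 e2
    · exact absurd (e1.trans e2.symm) h3.ne
    · exact hne (Prod.ext e1 hx0.symm)
    · rw [hx0, e2] at h3; exact absurd h3 h2.not_gt
    · exact absurd hx0 h3.ne

/-- Merging two variables absorbs their transposition, so the merged antisymmetric polynomial equals
its own negative and vanishes in characteristic zero. -/
theorem vdm_dvd_antiPoly [CharZero K] (t : K) (f₀ : MvPolynomial (Fin k) K) :
    vdm (MvPolynomial.X : Fin k → MvPolynomial (Fin k) K) ∣ antiPoly t f₀ := by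
  have h := prod_dvd_of_merge (K := K) ((Finset.univ : Finset (Fin k × Fin k)).filter
    fun x => x.1 < x.2) (by simp) (antiPoly t f₀) ?_
  · convert h using 1
    rw [vdm, Finset.prod_filter, Fintype.prod_prod_type, Finset.prod_comm]
    refine Finset.prod_congr rfl fun j _ => ?_
    rw [← Finset.prod_filter]
    refine Finset.prod_congr ?_ fun _ _ => rfl
    ext i; simp
  · intro x hx
    have hne : x.1 ≠ x.2 := (Finset.mem_filter.1 hx).2.ne
    have h1 := congrArg (merge x.1 x.2) (rename_antiPoly t f₀ (Equiv.swap x.1 x.2))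
    rw [merge, MvPolynomial.rename_rename, Equiv.Perm.sign_swap hne] at h1
    have h2 : Function.update id x.1 x.2 ∘ Equiv.swap x.1 x.2 = Function.update id x.1 x.2 := by
      funext l
      simp only [Function.comp_apply, Function.update_apply, id]
      rcases eq_or_ne l x.1 with rfl | h3
      · simp
      · rcases eq_or_ne l x.2 with rfl | h4
        · simp
        · rw [Equiv.swap_apply_of_ne_of_ne h3 h4]
    rw [h2] at h1
    simp only [Units.val_neg, Units.val_one, Int.cast_neg, Int.cast_one, neg_mul, one_mul,
      map_neg] at h1
    exact self_eq_neg.1 h1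

end Antisymm

/-! ### Symmetrization in the field of rational functions -/

section Fields

variable {K B : Type*} [Field K] [Field B] [Algebra K B] {k l : ℕ}

/-- The function `f ∏_{i<j} (x_i - t x_j) / (x_i - x_j)`. -/
def zetaTerm (t : K) (f : (Fin k → ℤ) →₀ K) (x : Fin k → Bˣ) : B :=
  ev x f * zProd t (fun l => (x l : B)) / vdm fun l => (x l : B)

/-- The sign picked up by the Vandermonde denominator turns symmetrization into antisymmetrization.
-/
theorem sum_zetaTerm (t : K) (f : (Fin k → ℤ) →₀ K) (x : Fin k → Bˣ) :
    ∑ σ : Equiv.Perm (Fin k), zetaTerm t f (x ∘ σ) = anti t x f / vdm fun l => (x l : B) := by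
  rw [anti, Finset.sum_div]
  refine Finset.sum_congr rfl fun σ _ => ?_
  have h1 := vdm_comp (fun l => (x l : B)) σ
  have h2 : (((Equiv.Perm.sign σ : ℤ) : B)) * ((Equiv.Perm.sign σ : ℤ) : B) = 1 := by
    rw [← Int.cast_mul, Int.units_coe_mul_self, Int.cast_one]
  have h3 : ((Equiv.Perm.sign σ : ℤ) : B) ≠ 0 := left_ne_zero_of_mul_eq_one h2
  simp only [zetaTerm, Function.comp_def] at h1 ⊢
  rw [h1, div_mul_eq_div_div, div_eq_iff h3 |>.2]
  ring_nf
  ring_nf at h2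
  rw [h2, mul_one]

theorem map_ev {K B B' : Type*} [Field K] [CommRing B] [CommRing B'] [Algebra K B] [Algebra K B']
    (h : B →ₐ[K] B') (x : Fin k → Bˣ) (f : (Fin k → ℤ) →₀ K) :
    h (ev x f) = ev (fun l => Units.map (h : B →* B') (x l)) f := by
  rw [ev, Finsupp.sum, map_sum]
  refine Finset.sum_congr rfl fun p _ => ?_
  simp only [map_smul, map_prod, ← map_zpow]
  rfl

theorem map_zetaTerm {B' : Type*} [Field B'] [Algebra K B'] (h : B →ₐ[K] B') (t : K)
    (f : (Fin k → ℤ) →₀ K) (x : Fin k → Bˣ) :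
    h (zetaTerm t f x) = zetaTerm t f fun l => Units.map (h : B →* B') (x l) := by
  have h1 := map_vdm (h : B →+* B') fun l => (x l : B)
  rw [zetaTerm, map_div₀, map_mul, map_ev, map_zProd]
  erw [h1]
  rfl

theorem prod_Iio_add {M : Type*} [CommMonoid M] (g : Fin (k + l) → Fin (k + l) → M) :
    ∏ j, ∏ i ∈ Finset.Iio j, g i j =
      (∏ j : Fin k, ∏ i ∈ Finset.Iio j, g (Fin.castAdd l i) (Fin.castAdd l j)) *
      (∏ j : Fin l, ∏ i ∈ Finset.Iio j, g (Fin.natAdd k i) (Fin.natAdd k j)) *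
      ∏ i : Fin k, ∏ j : Fin l, g (Fin.castAdd l i) (Fin.natAdd k j) := by
  have h : ∀ {n : ℕ} (j : Fin n) (F : Fin n → M), ∏ i ∈ Finset.Iio j, F i =
      ∏ i, if i < j then F i else 1 := fun j F => by
    rw [← Finset.prod_filter]; refine Finset.prod_congr ?_ fun _ _ => rfl; ext; simp
  simp only [h]
  have h1 : ∀ (i : Fin l) (j : Fin k), ¬ Fin.natAdd k i < Fin.castAdd l j := fun i j => by
    simp only [Fin.lt_def, Fin.val_natAdd, Fin.val_castAdd]; omega
  have h2 : ∀ (i : Fin k) (j : Fin l), Fin.castAdd l i < Fin.natAdd k j := fun i j => by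
    simp only [Fin.lt_def, Fin.val_natAdd, Fin.val_castAdd]; omega
  have h3 : ∀ (i j : Fin k), Fin.castAdd l i < Fin.castAdd l j ↔ i < j := fun i j => Iff.rfl
  have h4 : ∀ (i j : Fin l), Fin.natAdd k i < Fin.natAdd k j ↔ i < j := fun i j => by
    simp only [Fin.lt_def, Fin.val_natAdd]; omega
  rw [Fin.prod_univ_add]
  simp only [Fin.prod_univ_add, Finset.prod_mul_distrib, h1, h2, h3, h4, if_true, if_false,
    Finset.prod_const_one, mul_one]
  rw [Finset.prod_comm (s := (Finset.univ : Finset (Fin k))) (t := (Finset.univ : Finset (Fin l)))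
    (f := fun i j => g (Fin.castAdd l i) (Fin.natAdd k j)), mul_assoc]
  congr 1
  exact mul_comm _ _

/-- Pairs `i < j` lie in the first block, in the second, or across; the pairs across give exactly
the kernel of the shuffle product. -/
theorem zetaTerm_append (t : K) (p : Fin k → ℤ) (p' : Fin l → ℤ) (x : Fin (k + l) → Bˣ) :
    zetaTerm t (Finsupp.single (Fin.append p p') 1) x =
      zetaTerm t (Finsupp.single p 1) (x ∘ Fin.castAdd l) *
      zetaTerm t (Finsupp.single p' 1) (x ∘ Fin.natAdd k) *
      ∏ i : Fin k, ∏ j : Fin l, ((x (Fin.castAdd l i) : B) - t • (x (Fin.natAdd k j) : B)) /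
        ((x (Fin.castAdd l i) : B) - (x (Fin.natAdd k j) : B)) := by
  rw [zetaTerm, zetaTerm, zetaTerm, zProd, vdm, zProd, vdm, zProd, vdm, prod_Iio_add, prod_Iio_add]
  simp only [ev_single, Fin.prod_univ_add, Fin.append_left,
    Fin.append_right, one_smul, Function.comp_apply, Finset.prod_div_distrib]
  simp only [div_eq_mul_inv, mul_inv]
  ring

end Fields

/-! ### Symmetrized monomials in the shuffle algebra -/

namespace RatFun

variable {k l m : ℕ}

theorem subst_algebraMap (g : Fin k ↪ Fin m) (p : MvPolynomial (Fin k) Cq) :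
    subst g (algebraMap _ (RatFun k) p) = algebraMap _ (RatFun m) (MvPolynomial.rename g p) := by
  exact IsFractionRing.lift_algebraMap (g := ((IsScalarTower.toAlgHom Cq
    (MvPolynomial (Fin m) Cq) (RatFun m)).comp (MvPolynomial.rename g)).toRingHom)
    ((IsFractionRing.injective (MvPolynomial (Fin m) Cq) (RatFun m)).comp
      (MvPolynomial.rename_injective g g.injective)) p

@[simp]
theorem subst_x (g : Fin k ↪ Fin m) (i : Fin k) : subst g (x i) = x (g i) := by
  rw [x, subst_algebraMap, MvPolynomial.rename_X, x]

theorem x_injective : Function.Injective (x : Fin k → RatFun k) :=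
  (IsFractionRing.injective (MvPolynomial (Fin k) Cq) (RatFun k)).comp MvPolynomial.X_injective

theorem x_ne_zero (i : Fin k) : (x i : RatFun k) ≠ 0 :=
  (map_ne_zero_iff _ (IsFractionRing.injective (MvPolynomial (Fin k) Cq) (RatFun k))).2
    (MvPolynomial.X_ne_zero i)

/-- The variables as units. -/
def ux (i : Fin k) : (RatFun k)ˣ := Units.mk0 (x i) (x_ne_zero i)

@[simp]
theorem val_ux (i : Fin k) : (ux i : RatFun k) = x i := rfl

theorem map_ux (g : Fin k ↪ Fin m) (i : Fin k) :
    Units.map (subst g : RatFun k →* RatFun m) (ux i) = ux (g i) :=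
  Units.ext (subst_x g i)

theorem vdm_x_ne_zero : vdm (fun i => (x i : RatFun k)) ≠ 0 := by
  rw [vdm]
  refine Finset.prod_ne_zero_iff.2 fun j _ => Finset.prod_ne_zero_iff.2 fun i hi => ?_
  exact sub_ne_zero.2 fun h => (Finset.mem_Iio.1 hi).ne (x_injective h)

/-- The symmetrization of `f ∏_{i<j} (x_i - q⁻² x_j) / (x_i - x_j)`. -/
def sym (k : ℕ) : ((Fin k → ℤ) →₀ Cq) →ₗ[Cq] RatFun k :=
  ∑ σ : Equiv.Perm (Fin k),
    LinearMap.mulRight Cq (zProd (q ^ 2)⁻¹ (fun i => x (σ i)) / vdm (fun i => (x (σ i) : RatFun k)))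
      ∘ₗ evLin (ux ∘ σ)

theorem sym_apply (f : (Fin k → ℤ) →₀ Cq) :
    sym k f = ∑ σ : Equiv.Perm (Fin k), zetaTerm (q ^ 2)⁻¹ f (ux ∘ σ) := by
  rw [sym, LinearMap.sum_apply]
  refine Finset.sum_congr rfl fun σ _ => ?_
  rw [zetaTerm, mul_div_assoc, LinearMap.comp_apply, LinearMap.mulRight_apply, evLin_apply]
  rfl

theorem sym_eq_anti_div (f : (Fin k → ℤ) →₀ Cq) :
    sym k f = anti (q ^ 2)⁻¹ ux f / vdm fun i => (x i : RatFun k) := by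
  rw [sym_apply, sum_zetaTerm]
  rfl

theorem subst_zetaTerm (g : Fin k ↪ Fin m) (t : Cq) (f : (Fin l → ℤ) →₀ Cq) (h : Fin l → Fin k) :
    subst g (zetaTerm t f (ux ∘ h)) = zetaTerm t f (ux ∘ g ∘ h) := by
  rw [map_zetaTerm]
  congr 1
  funext i
  exact map_ux g (h i)

theorem subst_sym (g : Fin k ↪ Fin m) (f : (Fin k → ℤ) →₀ Cq) :
    subst g (sym k f) =
      ∑ σ : Equiv.Perm (Fin k), zetaTerm (q ^ 2)⁻¹ f (ux ∘ g ∘ σ) := by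
  rw [sym_apply, map_sum]
  exact Finset.sum_congr rfl fun σ _ => subst_zetaTerm g _ f σ

theorem isSymmLaurent_sym (f : (Fin k → ℤ) →₀ Cq) : (sym k f).IsSymmLaurent := by
  constructor
  · obtain ⟨N, hN⟩ := exists_polynomial f
    obtain ⟨f₀, hf₀⟩ := hN N le_rfl
    obtain ⟨g, hg⟩ := vdm_dvd_antiPoly (q ^ 2)⁻¹ f₀
    refine ⟨g, N, ?_⟩
    have h1 : MvPolynomial.aeval (fun l => ((ux l : (RatFun k)ˣ) : RatFun k)) =
        IsScalarTower.toAlgHom Cq (MvPolynomial (Fin k) Cq) (RatFun k) := by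
      refine MvPolynomial.algHom_ext fun i => ?_
      simp [x]
    have h2 := map_vdm (algebraMap (MvPolynomial (Fin k) Cq) (RatFun k)) MvPolynomial.X
    rw [sym_eq_anti_div, anti_eq_aeval _ _ _ N f₀ fun x => hf₀ _ x, h1,
      IsScalarTower.coe_toAlgHom', hg, map_mul, h2, div_eq_iff vdm_x_ne_zero]
    have h3 : ∏ l : Fin k, ((ux l ^ (-(N : ℤ)) : (RatFun k)ˣ) : RatFun k) =
        ((∏ i : Fin k, x i) ^ N)⁻¹ := by
      rw [← Finset.prod_pow, ← Finset.prod_inv_distrib]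
      refine Finset.prod_congr rfl fun i _ => ?_
      rw [Units.val_zpow_eq_zpow_val, zpow_neg, zpow_natCast, val_ux]
    rw [h3, div_eq_mul_inv]
    change _ * (vdm (fun i => (x i : RatFun k)) * _) = _
    ring
  · intro σ
    rw [subst_sym, sym_apply, ← Equiv.sum_comp (Equiv.mulLeft σ)
      fun τ => zetaTerm (q ^ 2)⁻¹ f (ux ∘ (τ : Equiv.Perm (Fin k)))]
    rfl

/-- The permutation of `k + l` letters acting separately on the first `k` and the last `l`. -/
def blockPerm (σ : Equiv.Perm (Fin k)) (τ : Equiv.Perm (Fin l)) : Equiv.Perm (Fin (k + l)) :=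
  finSumFinEquiv.permCongr (Equiv.Perm.sumCongr σ τ)

theorem blockPerm_castAdd (σ : Equiv.Perm (Fin k)) (τ : Equiv.Perm (Fin l)) (i : Fin k) :
    blockPerm σ τ (Fin.castAdd l i) = Fin.castAdd l (σ i) := by
  simp [blockPerm]

theorem blockPerm_natAdd (σ : Equiv.Perm (Fin k)) (τ : Equiv.Perm (Fin l)) (i : Fin l) :
    blockPerm σ τ (Fin.natAdd k i) = Fin.natAdd k (τ i) := by
  simp [blockPerm]

/-- The inner symmetrizations run over block permutations. Each is absorbed by the outer sum over
`S_{k+l}`, so every term is counted `k! l!` times, which the normalization removes. -/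
theorem shuffle_sym (p : Fin k → ℤ) (p' : Fin l → ℤ) :
    shuffle (sym k (Finsupp.single p 1)) (sym l (Finsupp.single p' 1)) =
      sym (k + l) (Finsupp.single (Fin.append p p') 1) := by
  have h1 : subst (Fin.castAddEmb l) (sym k (Finsupp.single p 1)) *
      subst (Fin.natAddEmb k) (sym l (Finsupp.single p' 1)) *
        ∏ i : Fin k, ∏ j : Fin l,
          (x (Fin.castAdd l i) - (q ^ 2)⁻¹ • x (Fin.natAdd k j)) /
            (x (Fin.castAdd l i) - x (Fin.natAdd k j)) =
      ∑ σ : Equiv.Perm (Fin k), ∑ τ : Equiv.Perm (Fin l),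
        zetaTerm (q ^ 2)⁻¹ (Finsupp.single (Fin.append p p') 1) (ux ∘ blockPerm σ τ) := by
    rw [subst_sym, subst_sym, Finset.sum_mul_sum, Finset.sum_mul]
    refine Finset.sum_congr rfl fun σ _ => ?_
    rw [Finset.sum_mul]
    refine Finset.sum_congr rfl fun τ _ => ?_
    rw [zetaTerm_append]
    congr 1
    · congr 2
      · funext i
        simp only [Function.comp_apply, blockPerm_castAdd, Fin.castAddEmb_apply]
      · funext i
        simp only [Function.comp_apply, blockPerm_natAdd, Fin.natAddEmb_apply]
    · simp only [Function.comp_apply, blockPerm_castAdd, blockPerm_natAdd, val_ux]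
      rw [← Equiv.prod_comp σ]
      refine Finset.prod_congr rfl fun i _ => ?_
      rw [← Equiv.prod_comp τ]
  have h2 : ∀ ρ : Equiv.Perm (Fin (k + l)),
      ∑ π : Equiv.Perm (Fin (k + l)), zetaTerm (q ^ 2)⁻¹
        (Finsupp.single (Fin.append p p') 1) (ux ∘ π ∘ ρ) =
      sym (k + l) (Finsupp.single (Fin.append p p') 1) := fun ρ => by
    rw [sym_apply, ← Equiv.sum_comp (Equiv.mulRight ρ)
      fun π => zetaTerm (q ^ 2)⁻¹ (Finsupp.single (Fin.append p p') 1)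
        (ux ∘ (π : Equiv.Perm (Fin (k + l))))]
    rfl
  rw [shuffle, h1]
  simp only [map_sum, subst_zetaTerm]
  rw [Finset.sum_comm]
  have h3 : ∀ σ : Equiv.Perm (Fin k), ∑ π : Equiv.Perm (Fin (k + l)),
      ∑ τ : Equiv.Perm (Fin l), zetaTerm (q ^ 2)⁻¹
        (Finsupp.single (Fin.append p p') 1) (ux ∘ π.toEmbedding ∘ blockPerm σ τ) =
      (l ! : RatFun (k + l)) * sym (k + l) (Finsupp.single (Fin.append p p') 1) := fun σ => by
    rw [Finset.sum_comm]
    refine (Finset.sum_congr rfl fun τ _ => h2 (blockPerm σ τ)).trans ?_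
    rw [Finset.sum_const, Finset.card_univ, Fintype.card_perm, Fintype.card_fin, nsmul_eq_mul]
  rw [Finset.sum_congr rfl fun σ _ => h3 σ, Finset.sum_const, Finset.card_univ,
    Fintype.card_perm, Fintype.card_fin, nsmul_eq_mul, ← mul_assoc, ← mul_assoc,
    mul_assoc _ (k ! : RatFun (k + l)), inv_mul_cancel₀, one_mul]
  have : CharZero (RatFun (k + l)) := algebraRat.charZero _
  exact mul_ne_zero (Nat.cast_ne_zero.2 (Nat.factorial_ne_zero _))
    (Nat.cast_ne_zero.2 (Nat.factorial_ne_zero _))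

theorem shuffle_add_left (F F' : RatFun k) (G : RatFun l) :
    shuffle (F + F') G = shuffle F G + shuffle F' G := by
  simp only [shuffle, map_add, add_mul, Finset.sum_add_distrib, mul_add]

theorem shuffle_add_right (F : RatFun k) (G G' : RatFun l) :
    shuffle F (G + G') = shuffle F G + shuffle F G' := by
  simp only [shuffle, map_add, add_mul, Finset.sum_add_distrib, mul_add]

theorem smul_eq (c : Cq) (F : RatFun k) : c • F = algebraMap Cq (RatFun k) c * F :=
  Algebra.smul_def c F

theorem shuffle_smul_left (c : Cq) (F : RatFun k) (G : RatFun l) :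
    shuffle (c • F) G = c • shuffle F G := by
  simp only [shuffle, smul_eq, map_mul, AlgHom.commutes, mul_assoc, ← Finset.mul_sum]
  exact mul_left_comm _ _ _

theorem shuffle_smul_right (c : Cq) (F : RatFun k) (G : RatFun l) :
    shuffle F (c • G) = c • shuffle F G := by
  simp only [shuffle, smul_eq, map_mul, AlgHom.commutes, mul_assoc,
    mul_left_comm _ (algebraMap Cq (RatFun (k + l)) c), ← Finset.mul_sum]

/-- The shuffle product as a bilinear map. -/
def shuffleLin (k l : ℕ) : RatFun k →ₗ[Cq] RatFun l →ₗ[Cq] RatFun (k + l) :=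
  LinearMap.mk₂ Cq shuffle shuffle_add_left shuffle_smul_left shuffle_add_right shuffle_smul_right

theorem sym_eLaurent (k : ℕ) (n : ℤ) :
    sym k (eLaurent (q ^ 2)⁻¹ k n) = (∏ i : Fin k, x i ^ n) *
      ∏ i : Fin k, ∏ j ∈ Finset.univ.erase i, (x i - (q ^ 2)⁻¹ • x j) := by
  have h0 := antisymm_ePoly (q ^ 2)⁻¹ fun i => (x i : RatFun k)
  rw [sym_eq_anti_div, div_eq_iff vdm_x_ne_zero, mul_assoc]
  refine Eq.trans ?_ (congrArg _ h0)
  rw [Finset.mul_sum, anti]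
  refine Finset.sum_congr rfl fun σ _ => ?_
  rw [ev_eLaurent]
  have h := Equiv.prod_comp σ fun i => (x i : RatFun k) ^ n
  simp only [Function.comp_def, val_ux, Units.val_zpow_eq_zpow_val] at h ⊢
  rw [h]
  ring

end RatFun

open Classical in
/-- The bilinear extension of the shuffle product. -/
def Graded.starLin : Graded →ₗ[Cq] Graded →ₗ[Cq] Graded :=
  DFinsupp.lsum Cq fun k => LinearMap.flip <| DFinsupp.lsum Cq fun l =>
    LinearMap.flip <| (RatFun.shuffleLin k l).compr₂ (DFinsupp.lsingle (k + l))

theorem Graded.starLin_apply (F G : Graded) : Graded.starLin F G = F.star G := by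
  classical
  rw [starLin, DFinsupp.lsum_apply_apply, DFinsupp.sumAddHom_apply, star, DFinsupp.sum,
    DFinsupp.sum, LinearMap.sum_apply]
  refine Finset.sum_congr (by congr!) fun k _ => ?_
  rw [LinearMap.toAddMonoidHom_coe, LinearMap.flip_apply, DFinsupp.lsum_apply_apply,
    DFinsupp.sumAddHom_apply, DFinsupp.sum, DFinsupp.sum, LinearMap.sum_apply]
  refine Finset.sum_congr (by congr!) fun l _ => ?_
  simp [RatFun.shuffleLin]

theorem Graded.starLin_single (k l : ℕ) (F : RatFun k) (G : RatFun l) :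
    Graded.starLin (DFinsupp.single k F) (DFinsupp.single l G) =
      DFinsupp.single (k + l) (RatFun.shuffle F G) := by
  simp [starLin, RatFun.shuffleLin]

/-! ### The shuffle realization of the positive half -/

/-- A word in the letters `e_p`. -/
def word (l : List ℤ) : FreeAlgebra Cq ℤ := (l.map (FreeAlgebra.ι Cq)).prod

theorem word_append (l l' : List ℤ) : word (l ++ l') = word l * word l' := by
  simp [word]

theorem basisFreeMonoid_apply (l : FreeMonoid ℤ) :
    FreeAlgebra.basisFreeMonoid Cq ℤ l = word l.toList := by
  have h : FreeAlgebra.equivMonoidAlgebraFreeMonoid (word l.toList) =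
      MonoidAlgebra.of Cq (FreeMonoid ℤ) l := by
    induction l using FreeMonoid.inductionOn' with
    | one => rw [MonoidHom.map_one]; simp [word]
    | of_mul p l ih =>
      rw [MonoidHom.map_mul, ← ih]
      change FreeAlgebra.equivMonoidAlgebraFreeMonoid (word (p :: l.toList)) = _
      rw [word, List.map_cons, List.prod_cons, map_mul]
      simp [FreeAlgebra.equivMonoidAlgebraFreeMonoid, word]
  apply FreeAlgebra.equivMonoidAlgebraFreeMonoid.injective
  rw [h]
  simp [FreeAlgebra.basisFreeMonoid, MonoidAlgebra.of]

theorem word_induction {p : FreeAlgebra Cq ℤ → Prop} (h0 : p 0) (hw : ∀ l, p (word l))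
    (ha : ∀ x y, p x → p y → p (x + y)) (hs : ∀ (c : Cq) x, p x → p (c • x)) (x) : p x := by
  have hx := (FreeAlgebra.basisFreeMonoid Cq ℤ).mem_span x
  induction hx using Submodule.span_induction with
  | mem x hx =>
    obtain ⟨l, rfl⟩ := hx
    rw [basisFreeMonoid_apply]; exact hw _
  | zero => exact h0
  | add x y _ _ hx hy => exact ha x y hx hy
  | smul c x _ hx => exact hs c x hx

/-- The exponent of a word. -/
def expo (l : List ℤ) : Π₀ k : ℕ, ((Fin k → ℤ) →₀ Cq) :=
  DFinsupp.single l.length (Finsupp.single l.get 1)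

/-- The expansion of an element of the free algebra in words, sorted by length. -/
def expand : FreeAlgebra Cq ℤ →ₗ[Cq] Π₀ k : ℕ, ((Fin k → ℤ) →₀ Cq) :=
  (FreeAlgebra.basisFreeMonoid Cq ℤ).constr Cq fun l => expo l.toList

theorem expand_word (l : List ℤ) : expand (word l) = expo l := by
  have h := (FreeAlgebra.basisFreeMonoid Cq ℤ).constr_basis Cq (fun l => expo l.toList)
    (FreeMonoid.ofList l)
  rw [basisFreeMonoid_apply] at h
  exact h

/-- An algebra map out of the free algebra is computed one word length at a time; this permits
arguing in each degree of the shuffle algebra separately. -/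
theorem lift_eq_lsum_expand {R : Type*} [Ring R] [Algebra Cq R] (F : FreeAlgebra Cq ℤ →ₐ[Cq] R)
    (x : FreeAlgebra Cq ℤ) :
    F x = DFinsupp.lsum Cq (fun k => wordLin (k := k) fun p => F (FreeAlgebra.ι Cq p))
      (expand x) := by
  induction x using word_induction with
  | h0 => simp
  | hw l =>
    rw [expand_word, expo, DFinsupp.lsum_apply_apply, DFinsupp.sumAddHom_single]
    simp only [LinearMap.toAddMonoidHom_coe, wordLin_apply, wordSum_single, one_smul]
    rw [word, map_list_prod, List.map_map]
    congr 1
    refine List.ext_get (by simp) fun n h1 h2 => ?_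
    simp
  | ha x y hx hy => rw [map_add, map_add, map_add, hx, hy]
  | hs c x hx => rw [map_smul, map_smul, map_smul, hx]

/-- The shuffle realization on the free algebra. -/
def freeShuffle : FreeAlgebra Cq ℤ →ₗ[Cq] Graded :=
  DFinsupp.mapRange.linearMap RatFun.sym ∘ₗ expand

theorem freeShuffle_word (l : List ℤ) : freeShuffle (word l) =
    DFinsupp.single l.length (RatFun.sym l.length (Finsupp.single l.get 1)) := by
  simp [freeShuffle, expand_word, expo]

theorem freeShuffle_apply (x : FreeAlgebra Cq ℤ) (k : ℕ) :
    freeShuffle x k = RatFun.sym k (expand x k) := rfl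

theorem single_sym_congr {k k' : ℕ} (h : k = k') (p : Fin k → ℤ) (p' : Fin k' → ℤ)
    (hp : ∀ i, p i = p' (Fin.cast h i)) :
    (DFinsupp.single k (RatFun.sym k (Finsupp.single p 1)) : Graded) =
      DFinsupp.single k' (RatFun.sym k' (Finsupp.single p' 1)) := by
  subst h
  rw [show p = p' from funext hp]

theorem freeShuffle_mul (x y : FreeAlgebra Cq ℤ) :
    freeShuffle (x * y) = Graded.starLin (freeShuffle x) (freeShuffle y) := by
  induction x using word_induction with
  | h0 => simp
  | ha x x' hx hx' => rw [add_mul, map_add, map_add, hx, hx', map_add, LinearMap.add_apply]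
  | hs c x hx => rw [smul_mul_assoc, map_smul, map_smul, hx, map_smul, LinearMap.smul_apply]
  | hw l =>
    induction y using word_induction with
    | h0 => simp
    | ha x x' hx hx' => rw [mul_add, map_add, map_add, hx, hx', map_add]
    | hs c x hx => rw [mul_smul_comm, map_smul, map_smul, hx, map_smul]
    | hw l' =>
      rw [← word_append, freeShuffle_word, freeShuffle_word, freeShuffle_word,
        Graded.starLin_single, RatFun.shuffle_sym]
      refine single_sym_congr List.length_append _ _ fun i => ?_
      obtain ⟨i, hi⟩ := i
      simp only [List.get_eq_getElem, Fin.cast_mk, Fin.append, Fin.addCases, List.getElem_append]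
      split_ifs with h <;> simp

theorem freeShuffle_ι (p : ℤ) :
    freeShuffle (FreeAlgebra.ι Cq p) = DFinsupp.single 1 (RatFun.x 0 ^ p) := by
  have h : FreeAlgebra.ι Cq p = word [p] := by simp [word]
  rw [h, freeShuffle_word]
  have h1 : ∀ p' : Fin 1 → ℤ, RatFun.sym 1 (Finsupp.single p' 1) = RatFun.x 0 ^ p' 0 := fun p' => by
    rw [RatFun.sym_apply, Fintype.sum_unique]
    have : (Finset.Iio (0 : Fin 1)) = ∅ := rfl
    simp [zetaTerm, zProd, vdm, ev_single, this]
  exact congrArg _ (h1 _)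

theorem freeShuffle_one : freeShuffle 1 = DFinsupp.single 0 1 := by
  have h : (1 : FreeAlgebra Cq ℤ) = word [] := by simp [word]
  rw [h, freeShuffle_word]
  have h1 : ∀ p' : Fin 0 → ℤ, RatFun.sym 0 (Finsupp.single p' 1) = 1 := fun p' => by
    rw [RatFun.sym_apply, Fintype.sum_unique]
    simp [zetaTerm, zProd, vdm, ev_single]
  exact congrArg _ (h1 _)

theorem expand_wordSum {k : ℕ} (f : (Fin k → ℤ) →₀ Cq) :
    expand (wordSum (FreeAlgebra.ι Cq) f) = DFinsupp.single k f := by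
  rw [← wordLin_apply]
  induction f using Finsupp.induction_linear with
  | zero => simp
  | add f g hf hg => rw [map_add, map_add, hf, hg, DFinsupp.single_add]
  | single p c =>
    have h1 : (List.ofFn fun l => FreeAlgebra.ι Cq (p l)).prod = word (List.ofFn p) := by
      rw [word, List.map_ofFn]; rfl
    rw [wordLin_apply, wordSum_single, map_smul, h1, expand_word, expo]
    have h2 : ∀ (k' : ℕ) (h : k' = k) (p' : Fin k' → ℤ) (_ : ∀ i, p' i = p (Fin.cast h i)),
        (DFinsupp.single k' (Finsupp.single p' (1 : Cq)) : Π₀ k : ℕ, ((Fin k → ℤ) →₀ Cq)) =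
          DFinsupp.single k (Finsupp.single p 1) := by
      rintro _ rfl p' hp
      rw [show p' = p from funext hp]
    rw [h2 _ List.length_ofFn _ fun i => by simp [Fin.cast], ← DFinsupp.single_smul,
      Finsupp.smul_single, smul_eq_mul, mul_one]

theorem freeShuffle_wordSum {k : ℕ} (f : (Fin k → ℤ) →₀ Cq) :
    freeShuffle (wordSum (FreeAlgebra.ι Cq) f) = DFinsupp.single k (RatFun.sym k f) := by
  rw [freeShuffle, LinearMap.comp_apply, expand_wordSum]
  simp

/-- The kernel congruence of `freeShuffle`. -/
def shuffleCon : RingCon (FreeAlgebra Cq ℤ) where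
  r x y := freeShuffle x = freeShuffle y
  iseqv := ⟨fun _ => rfl, fun h => h.symm, fun h h' => h.trans h'⟩
  add' h h' := by rw [map_add, map_add, h, h']
  mul' h h' := by rw [freeShuffle_mul, freeShuffle_mul, h, h']

theorem freeShuffle_rel (m n : ℤ) :
    freeShuffle (FreeAlgebra.ι Cq (m + 1) * FreeAlgebra.ι Cq n
          - q ^ 2 • (FreeAlgebra.ι Cq m * FreeAlgebra.ι Cq (n + 1))) =
      freeShuffle (q ^ 2 • (FreeAlgebra.ι Cq n * FreeAlgebra.ι Cq (m + 1))
          - FreeAlgebra.ι Cq (n + 1) * FreeAlgebra.ι Cq m) := by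
  rw [← sub_eq_zero, ← map_sub]
  have h := wordSum_relLaurent (FreeAlgebra.ι Cq (X := ℤ)) ((q ^ 2)⁻¹ : Cq) m n
  have h1 : RatFun.sym 2 (relLaurent (q ^ 2)⁻¹ m n) = 0 := by
    have hq : ((q ^ 2)⁻¹ : Cq) ≠ 0 := inv_ne_zero (pow_ne_zero _ A.q_ne_zero)
    have h2 := antisymm_relLaurent hq m n (RatFun.ux (k := 2))
    rw [RatFun.sym_eq_anti_div, anti, h2, zero_div]
  have h3 := freeShuffle_wordSum (relLaurent (q ^ 2)⁻¹ m n)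
  rw [h1, DFinsupp.single_zero, h, inv_inv] at h3
  rw [← h3]
  congr 1
  abel

/-- The universal property of `UPos` needs an algebra as target, and `Graded` carries only the
bilinear product. The quotient by the kernel congruence is an algebra, and it serves as the target.
-/
theorem freeShuffle_eq_of_mkAlgHom_eq {x y : FreeAlgebra Cq ℤ}
    (h : RingQuot.mkAlgHom Cq UPosRel x = RingQuot.mkAlgHom Cq UPosRel y) :
    freeShuffle x = freeShuffle y := by
  let mk : FreeAlgebra Cq ℤ →ₐ[Cq] shuffleCon.Quotient := shuffleCon.mkₐ Cq
  have hmk : ∀ {x y : FreeAlgebra Cq ℤ}, mk x = mk y ↔ freeShuffle x = freeShuffle y :=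
    RingCon.eq shuffleCon
  have hrel : ∀ ⦃x y⦄, UPosRel x y → mk x = mk y := by
    rintro _ _ ⟨m, n⟩
    exact hmk.2 (freeShuffle_rel m n)
  have h1 := congrArg (RingQuot.liftAlgHom Cq ⟨mk, hrel⟩) h
  rw [RingQuot.liftAlgHom_mkAlgHom_apply, RingQuot.liftAlgHom_mkAlgHom_apply] at h1
  exact hmk.1 h1

/-- The shuffle realization `Υ`. -/
def shuffleReal : UPos →ₗ[Cq] Graded :=
  (LinearMap.ker (RingQuot.mkAlgHom Cq UPosRel).toLinearMap).liftQ freeShuffle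
      (fun x hx => by
        have := freeShuffle_eq_of_mkAlgHom_eq (x := x) (y := 0) (by simpa using hx)
        simpa using this) ∘ₗ
    ((RingQuot.mkAlgHom Cq UPosRel).toLinearMap.quotKerEquivOfSurjective
      (RingQuot.mkAlgHom_surjective Cq UPosRel)).symm.toLinearMap

theorem shuffleReal_mk (x : FreeAlgebra Cq ℤ) :
    shuffleReal (RingQuot.mkAlgHom Cq UPosRel x) = freeShuffle x := by
  rw [shuffleReal, LinearMap.comp_apply]
  have h : ((RingQuot.mkAlgHom Cq UPosRel).toLinearMap.quotKerEquivOfSurjective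
      (RingQuot.mkAlgHom_surjective Cq UPosRel)).symm (RingQuot.mkAlgHom Cq UPosRel x) =
      Submodule.Quotient.mk x := by
    rw [LinearEquiv.symm_apply_eq]; rfl
  erw [h]
  rfl

theorem UPos.exists_mk (u : UPos) : ∃ x, RingQuot.mkAlgHom Cq UPosRel x = u :=
  RingQuot.mkAlgHom_surjective Cq UPosRel u

theorem isShuffleRealization_shuffleReal : IsShuffleRealization shuffleReal where
  mem u k := by
    obtain ⟨x, rfl⟩ := u.exists_mk
    rw [shuffleReal_mk, freeShuffle_apply]
    exact RatFun.isSymmLaurent_sym _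
  map_one := by
    rw [← map_one (RingQuot.mkAlgHom Cq UPosRel), shuffleReal_mk, freeShuffle_one]
  map_mul u v := by
    obtain ⟨x, rfl⟩ := u.exists_mk
    obtain ⟨y, rfl⟩ := v.exists_mk
    rw [← map_mul, shuffleReal_mk, shuffleReal_mk, shuffleReal_mk, freeShuffle_mul,
      Graded.starLin_apply]
  map_e p := by rw [UPos.e, shuffleReal_mk, freeShuffle_ι]

theorem IsShuffleRealization.eq_shuffleReal {Υ : UPos →ₗ[Cq] Graded}
    (h : IsShuffleRealization Υ) : Υ = shuffleReal := by
  have h' := isShuffleRealization_shuffleReal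
  ext1 u
  obtain ⟨x, rfl⟩ := u.exists_mk
  induction x using word_induction with
  | h0 => simp
  | ha x y hx hy => rw [map_add, map_add, map_add, hx, hy]
  | hs c x hx => rw [map_smul, map_smul, map_smul, hx]
  | hw l =>
    induction l with
    | nil =>
      simp only [word, List.map_nil, List.prod_nil, _root_.map_one]
      rw [h.map_one, h'.map_one]
    | cons p l ih =>
      have : word (p :: l) = FreeAlgebra.ι Cq p * word l := by simp [word]
      rw [this, _root_.map_mul, h.map_mul, h'.map_mul, ih]
      congr 1
      exact (h.map_e p).trans (h'.map_e p).symm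

theorem shuffleReal_wordSum {k : ℕ} (f : (Fin k → ℤ) →₀ Cq) :
    shuffleReal (wordSum UPos.e f) = DFinsupp.single k (RatFun.sym k f) := by
  rw [← freeShuffle_wordSum, ← shuffleReal_mk]
  congr 1
  simp only [wordSum, Finsupp.sum, map_sum, map_smul, map_list_prod, List.map_ofFn]
  rfl

theorem shuffleReal_eLaurent (k : ℕ) (n : ℤ) :
    shuffleReal (wordSum UPos.e (eLaurent (q ^ 2)⁻¹ k n)) = shuffleE k n := by
  rw [shuffleReal_wordSum, RatFun.sym_eLaurent, shuffleE]

/-- After clearing denominators, vanishing of the rational function means that the polynomial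
`antiPoly` is zero, and this persists at every invertible point of every commutative algebra. -/
theorem anti_eq_zero_of_sym_eq_zero {k : ℕ} {f : (Fin k → ℤ) →₀ Cq} (h : RatFun.sym k f = 0)
    {C : Type} [CommRing C] [Algebra Cq C] (x : Fin k → Cˣ) : anti (q ^ 2)⁻¹ x f = 0 := by
  obtain ⟨N, hN⟩ := exists_polynomial f
  obtain ⟨f₀, hf₀⟩ := hN N le_rfl
  have h1 : MvPolynomial.aeval (fun l => ((RatFun.ux l : (RatFun k)ˣ) : RatFun k)) =
      IsScalarTower.toAlgHom Cq (MvPolynomial (Fin k) Cq) (RatFun k) := by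
    refine MvPolynomial.algHom_ext fun i => ?_
    simp [RatFun.x]
  rw [RatFun.sym_eq_anti_div, div_eq_zero_iff, or_iff_left RatFun.vdm_x_ne_zero,
    anti_eq_aeval _ _ _ N f₀ fun x => hf₀ _ x, h1, mul_eq_zero, IsScalarTower.coe_toAlgHom',
    or_iff_right, map_eq_zero_iff _ (IsFractionRing.injective _ _)] at h
  · rw [anti_eq_aeval _ _ _ N f₀ fun x => hf₀ _ x, h, map_zero, mul_zero]
  · rw [← Units.coe_prod]
    exact Units.ne_zero _

/-! ### Words in the scaled operators -/

theorem wordSum_mem {K R : Type*} [Field K] [Ring R] [Algebra K R] {k : ℕ} {y : ℤ → R}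
    {f : (Fin k → ℤ) →₀ K} {S : Subalgebra K R} (h : ∀ p ∈ f.support, ∀ l, y (p l) ∈ S) :
    wordSum y f ∈ S := by
  refine Subalgebra.sum_mem _ fun p hp => Subalgebra.smul_mem _ ?_ _
  refine Subalgebra.list_prod_mem _ fun x hx => ?_
  obtain ⟨l, rfl⟩ := (List.mem_ofFn' _ _).1 hx
  exact h p hp l

theorem map_wordSum {K R R' : Type*} [Field K] [Ring R] [Algebra K R] [Ring R'] [Algebra K R']
    (F : R →ₐ[K] R') {k : ℕ} (y : ℤ → R) (f : (Fin k → ℤ) →₀ K) :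
    F (wordSum y f) = wordSum (fun p => F (y p)) f := by
  simp only [wordSum, Finsupp.sum, map_sum, map_smul, map_list_prod, List.map_ofFn]
  rfl

namespace DiffOps

variable {K : Type*} [Field K] {a : ℕ} {C R : Type*} [CommRing C] [Algebra K C]
  [Ring R] [Algebra K R] (S : DiffOps K a C R)

theorem y_mul_P_pow (p : ℤ) (k : ℕ) :
    S.y p * S.ι S.P ^ k = S.t ^ k • (S.ι S.P ^ k * S.y p) := by
  induction k with
  | zero => simp
  | succ k ih =>
    rw [pow_succ, ← mul_assoc, ih, smul_mul_assoc, mul_assoc, y_mul_P, mul_smul_comm, smul_smul,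
      ← pow_succ, ← mul_assoc]

/-- The scalar `c^k t^{k(k-1)/2}`. -/
def wordScalar (c : K) (k : ℕ) : K := ∏ i ∈ Finset.range k, (c * S.t ^ i)

theorem wordScalar_ne_zero {c : K} (hc : c ≠ 0) (k : ℕ) : S.wordScalar c k ≠ 0 :=
  Finset.prod_ne_zero_iff.2 fun i _ => mul_ne_zero hc (pow_ne_zero i S.t_ne)

/-- Collecting the factors `P` on the left costs only powers of `t`. -/
theorem prod_opE (c : K) {k : ℕ} (p : Fin k → ℤ) :
    (List.ofFn fun l => S.opE c (p l)).prod =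
      S.wordScalar c k • (S.ι S.P ^ k * (List.ofFn fun l => S.y (p l)).prod) := by
  induction k with
  | zero => simp [wordScalar]
  | succ k ih =>
    rw [List.ofFn_succ, List.prod_cons, ih, List.ofFn_succ, List.prod_cons, opE, smul_mul_smul_comm,
      mul_assoc, ← mul_assoc (S.y _), y_mul_P_pow, smul_mul_assoc, mul_smul_comm, smul_smul,
      wordScalar, wordScalar, Finset.prod_range_succ, pow_succ']
    congr 1
    · ring
    · simp only [mul_assoc]

theorem wordSum_opE (c : K) {k : ℕ} (f : (Fin k → ℤ) →₀ K) :
    wordSum (S.opE c) f = S.wordScalar c k • (S.ι S.P ^ k * wordSum S.y f) := by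
  simp only [wordSum, Finsupp.sum, prod_opE, Finset.mul_sum, Finset.smul_sum]
  refine Finset.sum_congr rfl fun p _ => ?_
  rw [mul_smul_comm, smul_comm]

theorem wordSum_opE_eq_zero (c : K) {k : ℕ} (f : (Fin k → ℤ) →₀ K)
    (hf : ∀ x : Fin k → Cˣ, anti S.t x f = 0) : wordSum (S.opE c) f = 0 := by
  rw [wordSum_opE, S.wordSum_eq_zero f hf, mul_zero, smul_zero]

theorem prod_zpow (n : ℤ) : ∏ l, ((S.w l ^ n : Cˣ) : C) = ((S.P ^ n : Cˣ) : C) := by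
  rw [P, ← Finset.prod_zpow, Units.coe_prod]

/-- The product of all `T_i`, as a unit. -/
def TT : Rˣ := (List.ofFn S.T).prod

theorem coe_TT : (S.TT : R) = S.Tw id := by
  rw [TT, Tw, ← Units.coeHom_apply, map_list_prod, List.map_ofFn]
  rfl

/-- The element `P` as a unit of the operator algebra. -/
def PR : Rˣ := Units.map (S.ι : C →* R) S.P

theorem coe_PR : (S.PR : R) = S.ι S.P := rfl

theorem coe_PR_zpow (n : ℤ) : ((S.PR ^ n : Rˣ) : R) = S.ι ((S.P ^ n : Cˣ) : C) := by
  rw [PR, ← map_zpow]; rfl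

theorem wordSum_eLaurent_top' (n : ℤ) :
    wordSum S.y (eLaurent S.t a n) = ((S.PR ^ (n + (a - 1 : ℕ)) * S.TT : Rˣ) : R) := by
  rw [wordSum_eLaurent_top, prod_zpow, Units.val_mul, coe_PR_zpow, coe_TT]

theorem wordSum_opE_eLaurent_top (c : K) (n : ℤ) :
    wordSum (S.opE c) (eLaurent S.t a n) =
      S.wordScalar c a • ((S.PR ^ (n + (a - 1 : ℕ) + a) * S.TT : Rˣ) : R) := by
  rw [wordSum_opE, wordSum_eLaurent_top', ← coe_PR, ← Units.val_pow_eq_pow_val, ← Units.val_mul,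
    ← mul_assoc, ← zpow_natCast, ← zpow_add, add_comm (a : ℤ)]

theorem Tw_cons (j : Fin a) {k : ℕ} (i : Fin k → Fin a) :
    S.Tw (Fin.cons j i : Fin (k + 1) → Fin a) = S.T j * S.Tw i := by
  simp [Tw, List.ofFn_succ]

end DiffOps

section Inverse

variable {K : Type*} [Field K] {k : ℕ} {C R : Type*} [CommRing C] [Algebra K C]
  [Ring R] [Algebra K R]

namespace DiffOps

theorem Tw_succAbove (S : DiffOps K (k + 1) C R) (j : Fin (k + 1)) :
    S.Tw j.succAbove = ((S.T j)⁻¹ : Rˣ) * S.Tw id := by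
  have h : Function.Injective (Fin.cons j j.succAbove : Fin (k + 1) → Fin (k + 1)) :=
    Fin.cons_injective_iff.2 ⟨by simp, Fin.succAbove_right_injective⟩
  have := S.Tw_comp id (Equiv.ofBijective _ (Finite.injective_iff_bijective.1 h))
  rw [← this]
  change _ = _ * S.Tw (Fin.cons j j.succAbove : Fin (k + 1) → Fin (k + 1))
  rw [Tw_cons, Units.inv_mul_cancel_left]

/-- Complete the product over `i ≠ j` to `P^n`, and reverse the `k` differences, which gives the
sign, to recognize `1/W_j(w_j)`. -/
theorem prod_succAbove (S : DiffOps K (k + 1) C R) (j : Fin (k + 1)) (n : ℤ) :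
    ∏ l, (((S.w (j.succAbove l) ^ n : Cˣ) : C) *
        Ring.inverse ((S.w (j.succAbove l) : C) - S.w j)) =
      (-1) ^ k * (((S.P ^ n : Cˣ) : C) * (((S.w j ^ (-(n + k)) : Cˣ) : C) * S.WI j)) := by
  have h1 : ((S.P ^ n : Cˣ) : C) = ((S.w j ^ n : Cˣ) : C) *
      ∏ l, ((S.w (j.succAbove l) ^ n : Cˣ) : C) := by
    rw [← prod_zpow, Fin.prod_univ_succAbove _ j]
  have h2 : S.WI j = (S.w j : C) ^ k *
      ((-1) ^ k * ∏ l, Ring.inverse ((S.w (j.succAbove l) : C) - S.w j)) := by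
    have h3 : Finset.univ.erase j = Finset.univ.image j.succAbove := by
      rw [Fin.image_succAbove_univ, Finset.compl_eq_univ_sdiff, Finset.sdiff_singleton_eq_erase]
    rw [WI, h3, Finset.prod_image fun _ _ _ _ h => Fin.succAbove_right_injective h,
      Finset.prod_mul_distrib, Finset.prod_const, Finset.card_univ, Fintype.card_fin]
    congr 1
    have h4 : (-1 : C) ^ k = ∏ _l : Fin k, (-1 : C) := by simp
    rw [h4, ← Finset.prod_mul_distrib]
    refine Finset.prod_congr rfl fun l _ => ?_
    rw [neg_one_mul]
    have := S.inverse_neg_comm j (j.succAbove l) 1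
    rwa [one_smul] at this
  have h5 : ((S.w j ^ n : Cˣ) : C) * ((S.w j ^ (-(n + k)) : Cˣ) : C) * (S.w j : C) ^ k = 1 := by
    rw [← Units.val_pow_eq_pow_val, ← Units.val_mul, ← Units.val_mul, ← zpow_natCast, ← zpow_add,
      ← zpow_add]
    simp
  have h6 : (-1 : C) ^ k * (-1) ^ k = 1 := by rw [← mul_pow]; simp
  rw [h1, h2, Finset.prod_mul_distrib]
  linear_combination -(∏ l, ((S.w (j.succAbove l) ^ n : Cˣ) : C)) *
    (∏ l, Ring.inverse ((S.w (j.succAbove l) : C) - S.w j)) * (h5 * ((-1 : C) ^ k * (-1) ^ k) + h6)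

/-- Omitting colour `j` from the product of all `T_i⁻¹` leaves `T_j` times the full product. The sum
over the omitted colour is thus one mode of the opposite current, between two units. -/
theorem IsInverse.wordSum_eLaurent {S S' : DiffOps K (k + 1) C R} (h : S.IsInverse S') (n : ℤ) :
    wordSum S'.y (eLaurent S'.t k n) =
      (-1) ^ k * (((S'.PR ^ (n + k) : Rˣ) : R) * (S.y (-(n + 2 * k)) * S'.TT)) := by
  rw [wordSum_eLaurent_sub_top, y, Finset.sum_mul, Finset.mul_sum, Finset.mul_sum]
  refine Finset.sum_congr rfl fun j _ => ?_
  have e : n + k + k = n + 2 * k := by ring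
  rw [prod_succAbove, Tw_succAbove, map_mul, map_mul, map_pow, map_neg, map_one, coe_PR_zpow,
    coe_TT, h.WI_eq, e, h.w_eq, h.T_eq, inv_inv, h.ι_eq]
  simp only [mul_assoc]

end DiffOps

end Inverse

/-! ### Generation by currents -/

section Generation

variable {K R : Type*} [Field K] [Ring R] [Algebra K R] {S : Subalgebra K R} {v : K}
  {ψ x : ℤ → R}

theorem mem_of_smul_mem {c : K} (hc : c ≠ 0) {z : R} (h : c • z ∈ S) : z ∈ S := by
  have := S.smul_mem h c⁻¹
  rwa [smul_smul, inv_mul_cancel₀ hc, one_smul] at this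

theorem mem_of_mul_mem {u u' z : R} (hu : u' * u = 1) (hu' : u' ∈ S) (h : u * z ∈ S) : z ∈ S := by
  have := S.mul_mem hu' h
  rwa [← mul_assoc, hu, one_mul] at this

/-- Since `ψ_{-1} = 0`, the relation at `m = -1` shows that `ψ_0` and `x_{n+1}` commute up to `v`.
Inserted at `m = 0`, it solves for `x_{n+1}` in terms of `ψ_1`, `x_n` and `ψ_0⁻¹`. -/
theorem current_succ_mem (hv2 : v ^ 2 ≠ 1)
    (h : ∀ m n, ψ (m + 1) * x n - v • (ψ m * x (n + 1)) =
      v • (x n * ψ (m + 1)) - x (n + 1) * ψ m)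
    (h0 : ψ (-1) = 0) {u : R} (hu : u * ψ 0 = 1) (huS : u ∈ S) (h1 : ψ 1 ∈ S) {n : ℤ}
    (hn : x n ∈ S) : x (n + 1) ∈ S := by
  have e1 := h (-1) (n + 1)
  have e2 := h 0 n
  rw [h0, neg_add_cancel, zero_mul, smul_zero, sub_zero, mul_zero, sub_zero] at e1
  rw [zero_add] at e2
  have e3 : (v ^ 2 - 1) • (ψ 0 * x (n + 1)) = v • (ψ 1 * x n) - v ^ 2 • (x n * ψ 1) := by
    have e4 := congrArg (fun z => v • z) e2
    simp only [smul_sub, smul_smul, ← pow_two] at e4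
    rw [sub_smul, one_smul, e1, eq_comm, sub_eq_iff_eq_add] at *
    rw [e4]; abel
  have e5 : (v ^ 2 - 1) • (ψ 0 * x (n + 1)) ∈ S := by
    rw [e3]
    exact S.sub_mem (S.smul_mem (S.mul_mem h1 hn) _) (S.smul_mem (S.mul_mem hn h1) _)
  exact mem_of_mul_mem hu huS (mem_of_smul_mem (sub_ne_zero.2 hv2) e5)

/-- Mirror argument at the top mode `b` of a series vanishing at `b + 1`: it lowers the mode of `x`.
-/
theorem current_pred_mem (hv2 : v ^ 2 ≠ 1)
    (h : ∀ m n, ψ (m + 1) * x n - v • (ψ m * x (n + 1)) =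
      v • (x n * ψ (m + 1)) - x (n + 1) * ψ m) {b : ℤ}
    (h0 : ψ (b + 1) = 0) {u : R} (hu : u * ψ b = 1) (huS : u ∈ S) (h1 : ψ (b - 1) ∈ S) {n : ℤ}
    (hn : x (n + 1) ∈ S) : x n ∈ S := by
  have e1 := h b (n - 1)
  have e2 := h (b - 1) n
  rw [sub_add_cancel, h0, zero_mul, mul_zero, smul_zero, zero_sub, zero_sub, neg_inj] at e1
  rw [sub_add_cancel] at e2
  have e3 : (1 - v ^ 2) • (ψ b * x n) = v • (ψ (b - 1) * x (n + 1)) - x (n + 1) * ψ (b - 1) := by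
    rw [← e1, smul_smul, ← pow_two] at e2
    rw [sub_smul, one_smul, sub_eq_sub_iff_add_eq_add]
    rw [sub_eq_sub_iff_add_eq_add] at e2
    rw [e2]; abel
  have e5 : (1 - v ^ 2) • (ψ b * x n) ∈ S := by
    rw [e3]
    exact S.sub_mem (S.smul_mem (S.mul_mem h1 hn) _) (S.mul_mem hn h1)
  exact mem_of_mul_mem hu huS (mem_of_smul_mem (sub_ne_zero.2 hv2.symm) e5)

theorem current_mem (hv2 : v ^ 2 ≠ 1) {ψ' : ℤ → R}
    (h : ∀ m n, ψ (m + 1) * x n - v • (ψ m * x (n + 1)) =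
      v • (x n * ψ (m + 1)) - x (n + 1) * ψ m)
    (h' : ∀ m n, ψ' (m + 1) * x n - v • (ψ' m * x (n + 1)) =
      v • (x n * ψ' (m + 1)) - x (n + 1) * ψ' m)
    (h0 : ψ (-1) = 0) {u : R} (hu : u * ψ 0 = 1) (huS : u ∈ S) (h1 : ψ 1 ∈ S) {b : ℤ}
    (h0' : ψ' (b + 1) = 0) {u' : R} (hu' : u' * ψ' b = 1) (huS' : u' ∈ S) (h1' : ψ' (b - 1) ∈ S)
    {n₀ : ℤ} (hn : x n₀ ∈ S) (n : ℤ) : x n ∈ S := by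
  induction n using Int.inductionOn' (b := n₀) with
  | zero => exact hn
  | succ k _ hk => exact current_succ_mem hv2 h h0 hu huS h1 hk
  | pred k _ hk =>
    exact current_pred_mem hv2 h' h0' hu' huS' h1' (by rwa [sub_add_cancel])

end Generation

/-! ### Units of a subalgebra -/

section Units

variable {K R : Type*} [Field K] [Ring R] [Algebra K R] {S : Subalgebra K R}

/-- The invertible elements of a subalgebra. -/
def unitsIn (S : Subalgebra K R) : Subgroup Rˣ := S.toSubmonoid.units

theorem mem_unitsIn {u : Rˣ} : u ∈ unitsIn S ↔ (u : R) ∈ S ∧ ((u⁻¹ : Rˣ) : R) ∈ S :=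
  Submonoid.mem_units_iff _ _

theorem inverse_smul_unit {c : K} (hc : c ≠ 0) (u : Rˣ) :
    Ring.inverse (c • (u : R)) = c⁻¹ • ((u⁻¹ : Rˣ) : R) := by
  have h1 : c • (u : R) * c⁻¹ • ((u⁻¹ : Rˣ) : R) = 1 := by
    rw [smul_mul_smul_comm, mul_inv_cancel₀ hc, one_smul, Units.mul_inv]
  have h2 : c⁻¹ • ((u⁻¹ : Rˣ) : R) * c • (u : R) = 1 := by
    rw [smul_mul_smul_comm, inv_mul_cancel₀ hc, one_smul, Units.inv_mul]
  exact Ring.inverse_unit (⟨_, _, h1, h2⟩ : Rˣ)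

theorem isUnit_smul_unit {c : K} (hc : c ≠ 0) (u : Rˣ) : IsUnit (c • (u : R)) := by
  rw [Algebra.smul_def]
  exact ((IsUnit.mk0 c hc).map _).mul u.isUnit

theorem mem_units_of_inverse_mem {c : K} (hc : c ≠ 0) {u : Rˣ} (h : c • (u : R) ∈ S)
    (h' : Ring.inverse (c • (u : R)) ∈ S) : u ∈ unitsIn S := by
  rw [inverse_smul_unit hc] at h'
  exact mem_unitsIn.2
    ⟨mem_of_smul_mem hc h, mem_of_smul_mem (inv_ne_zero hc) h'⟩

/-- The quotient of the two elements is `u`. This is why two consecutive elements `E_{r+1,n}`,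
`E_{r+1,n+1}` are inverted. -/
theorem mem_units_of_mem_units {H : Subgroup Rˣ} {u v : Rˣ} {N : ℤ} (h : u ^ N * v ∈ H)
    (h' : u ^ (N + 1) * v ∈ H) : u ∈ H ∧ v ∈ H := by
  have hu : u ∈ H := by
    have := H.mul_mem h' (H.inv_mem h)
    rwa [mul_inv_rev, mul_assoc, mul_inv_cancel_left, ← zpow_neg, ← zpow_add,
      show N + 1 + -N = 1 by ring, zpow_one] at this
  refine ⟨hu, ?_⟩
  have := H.mul_mem (H.inv_mem (H.zpow_mem hu N)) h
  rwa [inv_mul_cancel_left] at this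

theorem coe_mem_of_mem_units {u : Rˣ} (h : u ∈ unitsIn S) : (u : R) ∈ S :=
  (mem_unitsIn.1 h).1

theorem coe_inv_mem_of_mem_units {u : Rˣ} (h : u ∈ unitsIn S) :
    ((u⁻¹ : Rˣ) : R) ∈ S :=
  (mem_unitsIn.1 h).2

theorem mem_of_unit_mul_mul_unit_mem {u v : Rˣ} (hu : u ∈ unitsIn S)
    (hv : v ∈ unitsIn S) {z : R} {k : ℕ} (h : (-1) ^ k * ((u : R) * (z * v)) ∈ S) :
    z ∈ S := by
  have h0 : (-1 : R) ^ k ∈ S := S.pow_mem (S.neg_mem S.one_mem) k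
  have h1 := S.mul_mem h0 h
  rw [← mul_assoc, ← pow_add, Even.neg_one_pow ⟨k, rfl⟩, one_mul] at h1
  have h2 := S.mul_mem (S.mul_mem (coe_inv_mem_of_mem_units hu) h1) (coe_inv_mem_of_mem_units hv)
  rwa [Units.inv_mul_cancel_left, Units.mul_inv_cancel_right] at h2

theorem rel_inv_smul {c : K} (hc : c ≠ 0) {x y z t : R} (h : c • x - y = z - c • t) :
    x - c⁻¹ • y = c⁻¹ • z - t := by
  have := congrArg (fun w => c⁻¹ • w) h
  simpa only [smul_sub, smul_smul, inv_mul_cancel₀ hc, one_smul] using this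

theorem sub_mem_of_eq_smul {c : K} (hc : c ≠ 0) {x y z w : R} (hx : x ∈ S) (hy : y ∈ S)
    (h : x * y - y * x = c • (z - w)) : z - w ∈ S :=
  mem_of_smul_mem hc (h ▸ S.sub_mem (S.mul_mem hx hy) (S.mul_mem hy hx))

end Units

/-! ### Recovering the opposite current and the total shift operator -/

namespace DiffOps

variable {K : Type*} [Field K] {a k : ℕ} {C R : Type*} [CommRing C] [Algebra K C] [Ring R]
  [Algebra K R] {S S' : DiffOps K a C R} {B : Subalgebra K R}

theorem IsInverse.TT_eq (h : S.IsInverse S') : S'.TT = S.TT⁻¹ := by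
  have h1 : ∀ i j, Commute (S'.T i) (S'.T j) := fun i j => Units.ext (S'.T_comm i j)
  rw [TT, TT, List.prod_inv_reverse, List.map_ofFn,
    show S'.T = Inv.inv ∘ S.T from funext h.T_eq]
  refine List.Perm.prod_eq' (List.reverse_perm _).symm ?_
  rw [List.pairwise_ofFn]
  intro i j _
  have := h1 i j
  rwa [h.T_eq, h.T_eq] at this

theorem IsInverse.PR_eq (h : S.IsInverse S') : S'.PR = S.PR := by
  rw [PR, PR, P, P, h.ι_eq, h.w_eq]

theorem opF_mem_of_opE_word_mem {S S' : DiffOps K (k + 1) C R} (h : S.IsInverse S') {c c' : K}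
    (hc : c ≠ 0) {n : ℤ} (hP : S'.PR ∈ unitsIn B) (hT : S'.TT ∈ unitsIn B)
    (hw : wordSum (S'.opE c) (eLaurent S'.t k n) ∈ B) : S.opF c' (-(n + 2 * k)) ∈ B := by
  refine B.smul_mem ?_ _
  rw [wordSum_opE, h.wordSum_eLaurent, ← coe_PR, ← Units.val_pow_eq_pow_val] at hw
  exact mem_of_unit_mul_mul_unit_mem (Subgroup.zpow_mem _ hP _) hT
    (mem_of_mul_mem (Units.inv_mul _) (coe_inv_mem_of_mem_units (Subgroup.pow_mem _ hP k))
      (mem_of_smul_mem (S'.wordScalar_ne_zero hc k) hw))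

/-- The top element built from the `e`'s gives the full product of the inverse shifts, the one built
from the `f`'s gives its inverse, each up to a power of `P`. -/
theorem IsInverse.TT_mem_units (h : S.IsInverse S') {c c' : K} (hc : c ≠ 0) (hc' : c' ≠ 0)
    (hP : S.PR ∈ unitsIn B) (he : ∀ p, S'.opE c p ∈ B) (hf : ∀ p, S.opF c' p ∈ B) :
    S'.TT ∈ unitsIn B := by
  refine mem_unitsIn.2 ⟨?_, ?_⟩
  · have h1 : wordSum (S'.opE c) (eLaurent S'.t a 0) ∈ B := wordSum_mem fun p _ l => he _
    rw [wordSum_opE_eLaurent_top, h.PR_eq] at h1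
    have h2 := mem_of_smul_mem (S'.wordScalar_ne_zero hc a) h1
    rw [Units.val_mul] at h2
    exact mem_of_mul_mem (Units.inv_mul _)
      (coe_inv_mem_of_mem_units (Subgroup.zpow_mem _ hP _)) h2
  · have h1 : wordSum S.y (eLaurent S.t a 0) ∈ B := wordSum_mem fun p _ l =>
      mem_of_smul_mem (mul_ne_zero hc' (zpow_ne_zero _ S.t_ne)) (hf (p l))
    rw [wordSum_eLaurent_top', Units.val_mul] at h1
    rw [h.TT_eq, inv_inv]
    exact mem_of_mul_mem (Units.inv_mul _)
      (coe_inv_mem_of_mem_units (Subgroup.zpow_mem _ hP _)) h1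

end DiffOps

/-! ### Generation of the image by finitely many modes -/

namespace A

variable {r : ℕ}

theorem q_sq_ne_zero : q ^ 2 ≠ 0 := pow_ne_zero _ q_ne_zero

theorem eScalar_ne_zero : -q / (1 - q ^ 2) ≠ 0 :=
  div_ne_zero (neg_ne_zero.2 q_ne_zero) one_sub_q_sq_ne

theorem efScalar_ne_zero : (q - q⁻¹)⁻¹ ≠ 0 := by
  refine inv_ne_zero fun h => q_sq_ne_one ?_
  have h1 : q = q⁻¹ := sub_eq_zero.1 h
  exact (pow_two q).trans ((congrArg (q * ·) h1).trans (mul_inv_cancel₀ q_ne_zero))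

/-- The image of `E_{k,n}`. -/
def eWord (a k : ℕ) (n : ℤ) : A a := wordSum (eOp a) (eLaurent (q ^ 2)⁻¹ k n)

theorem eWord_eq (a k : ℕ) (n : ℤ) : eWord a k n =
    wordSum ((opDInv a).opE (-q / (1 - q ^ 2))) (eLaurent (opDInv a).t k n) := by
  rw [eWord]
  congr 1
  funext p; exact eOp_eq_opE p

/-- The normalization of the image of `E_{a,n}`. -/
def topScalar (a : ℕ) : Cq := (opDInv a).wordScalar (-q / (1 - q ^ 2)) a

theorem topScalar_ne_zero (a : ℕ) : topScalar a ≠ 0 :=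
  (opDInv a).wordScalar_ne_zero eScalar_ne_zero a

/-- The product of all `D_i⁻¹`. -/
def TA (a : ℕ) : (A a)ˣ := (opDInv a).TT

theorem eWord_top (a : ℕ) (n : ℤ) : eWord a a n =
    topScalar a • ((PA a ^ (n + (a - 1 : ℕ) + a) * TA a : (A a)ˣ) : A a) := by
  rw [eWord_eq, DiffOps.wordSum_opE_eLaurent_top]; rfl

theorem eWord_mem {a k : ℕ} {n : ℤ} {S : Subalgebra Cq (A a)}
    (h : ∀ p, n ≤ p → p ≤ n + 2 * (k - 1 : ℕ) → eOp a p ∈ S) :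
    eWord a k n ∈ S :=
  wordSum_mem fun _ hp l => h _ (mem_support_eLaurent _ _ _ hp l).1 (mem_support_eLaurent _ _ _ hp l).2

/-- The invertible elements of a subalgebra. -/
def opUnits {a : ℕ} (S : Subalgebra Cq (A a)) : Subgroup (A a)ˣ := unitsIn S

theorem fOp_mem {S : Subalgebra Cq (A (r + 1))} {n : ℤ}
    (hP : PA (r + 1) ∈ opUnits S) (hT : TA (r + 1) ∈ opUnits S)
    (h : eWord (r + 1) r n ∈ S) : fOp (r + 1) (-(n + 2 * r)) ∈ S := by
  rw [fOp_eq_opF]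
  rw [eWord_eq] at h
  exact DiffOps.opF_mem_of_opE_word_mem (isInverse_opD (a := r + 1)) eScalar_ne_zero hP hT h

theorem psiOp_true_eq_zero {a : ℕ} {s : ℤ} (hs : s < 0) : psiOp a true s = 0 := by
  rw [psiOp, psiFn_true_eq_zero hs]; rfl

theorem psiOp_false_eq_zero {a : ℕ} {s : ℤ} (hs : -(2 * a : ℤ) < s) : psiOp a false s = 0 := by
  rw [psiOp, psiFn_false_eq_zero hs]; rfl

theorem q_sq_sq_ne_one : (q ^ 2) ^ 2 ≠ 1 := by
  rw [← pow_mul]; exact q_four_ne_one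

/-- The two commutators yield the modes next to the extreme ones `P` and `q^{-2(r+1)} P⁻¹`. These
move `e` and `f` through all modes, after which every `ψ` is a commutator. -/
theorem ops_mem {S : Subalgebra Cq (A (r + 1))} (hP : PA (r + 1) ∈ opUnits S)
    {m n m' n' : ℤ} (h1 : m + n = 1) (h2 : m' + n' = -(2 * (r + 1 : ℕ)) - 1)
    (hm : eOp (r + 1) m ∈ S) (hn : fOp (r + 1) n ∈ S) (hm' : eOp (r + 1) m' ∈ S)
    (hn' : fOp (r + 1) n' ∈ S) (g : UGen) : genOp (r + 1) g ∈ S := by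
  -- At mode `1` the series `ψ⁻` has no coefficient, so the commutator is `ψ⁺_1` alone;
  -- symmetrically, `ψ⁺` is absent at the negative mode below.
  have hψ : psiOp (r + 1) true 1 ∈ S := by
    have := sub_mem_of_eq_smul efScalar_ne_zero hm hn (eOp_fOp m n)
    rwa [h1, psiOp_false_eq_zero (by omega), sub_zero] at this
  have hψ' : psiOp (r + 1) false (-(2 * (r + 1 : ℕ)) - 1) ∈ S := by
    have := sub_mem_of_eq_smul efScalar_ne_zero hm' hn' (eOp_fOp m' n')
    rw [h2, psiOp_true_eq_zero (by omega), zero_sub] at this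
    exact neg_mem_iff.1 this
  have hu : (((PA (r + 1))⁻¹ : (A (r + 1))ˣ) : A (r + 1)) * psiOp (r + 1) true 0 = 1 := by
    rw [psiOp_true_zero, Units.inv_mul]
  have hu' : ((q ^ 2) ^ (r + 1) • (PA (r + 1) : A (r + 1))) *
      psiOp (r + 1) false (-(2 * (r + 1 : ℕ))) = 1 := by
    rw [psiOp_false_bot, smul_mul_smul_comm, Units.mul_inv, inv_pow,
      mul_inv_cancel₀ (pow_ne_zero _ q_sq_ne_zero), one_smul]
  have huS := coe_inv_mem_of_mem_units hP
  have huS' := S.smul_mem (coe_mem_of_mem_units hP) ((q ^ 2) ^ (r + 1))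
  have he : ∀ p, eOp (r + 1) p ∈ S := current_mem (v := q ^ 2) q_sq_sq_ne_one (psiOp_eOp true)
    (psiOp_eOp false) (psiOp_true_eq_zero (by omega)) hu huS hψ (psiOp_false_eq_zero (by omega))
    hu' huS' hψ' hm
  have hf : ∀ p, fOp (r + 1) p ∈ S := current_mem (v := (q ^ 2)⁻¹)
    (by rw [inv_pow]; exact fun h => q_sq_sq_ne_one (inv_eq_one.1 h))
    (fun m n => rel_inv_smul q_sq_ne_zero (psiOp_fOp true m n))
    (fun m n => rel_inv_smul q_sq_ne_zero (psiOp_fOp false m n))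
    (psiOp_true_eq_zero (by omega)) hu huS hψ (psiOp_false_eq_zero (by omega)) hu' huS' hψ' hn
  have hsub : ∀ s : ℤ, psiOp (r + 1) true s - psiOp (r + 1) false s ∈ S := fun s => by
    have := sub_mem_of_eq_smul efScalar_ne_zero (he 0) (hf s) (eOp_fOp 0 s)
    rwa [zero_add] at this
  cases g with
  | e p => exact he p
  | f p => exact hf p
  | psiP s =>
    have := hsub s
    rwa [psiOp_false_eq_zero (by omega), sub_zero] at this
  | psiM s =>
    have := hsub (-(2 * (r + 1 : ℕ)) - s)
    rw [psiOp_true_eq_zero (by omega), zero_sub] at this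
    exact neg_mem_iff.1 this
  | psiPInv => exact huS
  | psiMInv => exact huS'

/-- The inverted elements supply `P` and `∏ D_i⁻¹` as units; then `E_{r,n}` and `E_{r,n+3}`, which
together use only modes from `n` to `n + 2r + 1`, supply two modes of `f`. -/
theorem genOp_mem {S : Subalgebra Cq (A (r + 1))} {n : ℤ}
    (he : ∀ p, n ≤ p → p ≤ n + 2 * r + 1 → eOp (r + 1) p ∈ S)
    (h₀ : Ring.inverse (eWord (r + 1) (r + 1) n) ∈ S)
    (h₁ : Ring.inverse (eWord (r + 1) (r + 1) (n + 1)) ∈ S) (g : UGen) :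
    genOp (r + 1) g ∈ S := by
  have m₀ : eWord (r + 1) (r + 1) n ∈ S := eWord_mem (fun p h1 h2 => he p h1 (by omega))
  have m₁ : eWord (r + 1) (r + 1) (n + 1) ∈ S :=
    eWord_mem (fun p h1 h2 => he p (by omega) (by omega))
  rw [eWord_top] at h₀ m₀ h₁ m₁
  have u₀ := mem_units_of_inverse_mem (topScalar_ne_zero _) m₀ h₀
  have u₁ := mem_units_of_inverse_mem (topScalar_ne_zero _) m₁ h₁
  rw [show n + 1 + ((r + 1 - 1 : ℕ) : ℤ) + ((r + 1 : ℕ) : ℤ) =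
    n + ((r + 1 - 1 : ℕ) : ℤ) + ((r + 1 : ℕ) : ℤ) + 1 by ring] at u₁
  obtain ⟨hP, hT⟩ := mem_units_of_mem_units u₀ u₁
  -- The mode sums are `1` and `-(2r+2) - 1`. The extreme modes `n + 2r + 1` and `n` of the window
  -- are paired with the `f`'s coming from `E_{r,n}` and `E_{r,n+3}`.
  refine ops_mem hP (m := n + 2 * r + 1) (n := -(n + 2 * r)) (m' := n) (n' := -(n + 3 + 2 * r))
    (by ring) (by push_cast; ring) (he _ (by omega) le_rfl) (fOp_mem hP hT ?_)
    (he _ le_rfl (by omega)) (fOp_mem hP hT ?_) g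
  · exact wordSum_mem fun p hp l => by
      have := mem_support_eLaurent _ _ _ hp l
      -- A letter exists only if `r > 0`, so the natural subtraction in `r - 1` is not truncated;
      -- for `r = 0` the word is empty.
      have := l.pos
      exact he _ (by omega) (by omega)
  · exact wordSum_mem fun p hp l => by
      have := mem_support_eLaurent _ _ _ hp l
      have := l.pos
      exact he _ (by omega) (by omega)

/-- For the inclusion into the image: `P⁻¹` is the image of `(ψ⁺_0)⁻¹`, and `∏ D_i` is obtained from
the `f`'s. -/
theorem inverse_eWord_mem_range (n : ℤ) :
    Ring.inverse (eWord (r + 1) (r + 1) n) ∈ (gklo r).range := by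
  have hg : ∀ g, genOp (r + 1) g ∈ (gklo r).range := fun g => ⟨_, gklo_gen r g⟩
  have hP : PA (r + 1) ∈ opUnits (gklo r).range :=
    mem_unitsIn.2 ⟨psiOp_true_zero (a := r + 1) ▸ hg (.psiP 0), hg .psiPInv⟩
  have hT : TA (r + 1) ∈ opUnits (gklo r).range :=
    isInverse_opD.TT_mem_units eScalar_ne_zero (one_div_ne_zero one_sub_q_sq_ne) hP
      (fun p => eOp_eq_opE (a := r + 1) p ▸ hg (.e p))
      (fun p => fOp_eq_opF (a := r + 1) p ▸ hg (.f p))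
  rw [eWord_top, inverse_smul_unit (topScalar_ne_zero _)]
  exact Subalgebra.smul_mem _ (coe_inv_mem_of_mem_units
    (Subgroup.mul_mem _ (Subgroup.zpow_mem _ hP _) hT)) _

end A

/-! ### Independence of the chosen preimages and the final theorem -/

theorem UPos.toU_e (b p : ℤ) : UPos.toU b (UPos.e p) = U.gen b (.e p) := by
  rw [toU, UPos.e, RingQuot.liftAlgHom_mkAlgHom_apply, FreeAlgebra.lift_ι_apply]

/-- In each degree the symmetrization of the word combination vanishes, hence so do its
antisymmetrization at every point and its operator. This replaces injectivity of `Υ`. -/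
theorem gklo_toU_eq_zero (r : ℕ) {u : UPos} (h : shuffleReal u = 0) :
    gklo r (UPos.toU _ u) = 0 := by
  obtain ⟨x, rfl⟩ := u.exists_mk
  rw [shuffleReal_mk] at h
  have h1 := lift_eq_lsum_expand
    (((gklo r).comp (UPos.toU _)).comp (RingQuot.mkAlgHom Cq UPosRel)) x
  refine h1.trans ?_
  classical
  rw [DFinsupp.lsum_apply_apply, DFinsupp.sumAddHom_apply, DFinsupp.sum]
  refine Finset.sum_eq_zero fun k _ => ?_
  have h2 : (fun p => (((gklo r).comp (UPos.toU _)).comp (RingQuot.mkAlgHom Cq UPosRel))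
      (FreeAlgebra.ι Cq p)) = (A.opDInv (r + 1)).opE (-q / (1 - q ^ 2)) := by
    funext p
    rw [← A.eOp_eq_opE]
    change gklo r (UPos.toU _ (UPos.e p)) = _
    rw [UPos.toU_e, gklo_gen, A.genOp]
  rw [LinearMap.toAddMonoidHom_coe, wordLin_apply, h2]
  refine DiffOps.wordSum_opE_eq_zero _ _ _ fun x' => ?_
  refine anti_eq_zero_of_sym_eq_zero ?_ x'
  rw [← freeShuffle_apply, h]; rfl

/-- An arbitrary preimage differs from the explicit one by an element of the kernel of `Υ`. -/
theorem gklo_toU_eq (r : ℕ) {u : UPos} {k : ℕ} {n : ℤ} (h : shuffleReal u = shuffleE k n) :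
    gklo r (UPos.toU _ u) = A.eWord (r + 1) k n := by
  have h1 := gklo_toU_eq_zero r (u := u - wordSum UPos.e (eLaurent (q ^ 2)⁻¹ k n))
    (by rw [map_sub, h, shuffleReal_eLaurent, sub_self])
  rw [map_sub, map_sub, sub_eq_zero] at h1
  rw [h1, map_wordSum, map_wordSum, A.eWord]
  congr 1
  funext p
  rw [UPos.toU_e, gklo_gen, A.genOp]

theorem range_gklo_le {r : ℕ} {S : Subalgebra Cq (A (r + 1))}
    (h : ∀ g, A.genOp (r + 1) g ∈ S) : (gklo r).range ≤ S := by
  rintro _ ⟨u, rfl⟩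
  obtain ⟨x, rfl⟩ := RingQuot.mkAlgHom_surjective Cq _ u
  induction x using FreeAlgebra.induction with
  | grade0 c =>
    change gklo r (RingQuot.mkAlgHom Cq _ _) ∈ S
    rw [AlgHom.commutes, AlgHom.commutes]; exact S.algebraMap_mem c
  | grade1 g =>
    change gklo r (U.gen _ g) ∈ S
    rw [gklo_gen]; exact h g
  | mul x y hx hy =>
    change gklo r (RingQuot.mkAlgHom Cq _ _) ∈ S
    rw [map_mul, map_mul]; exact S.mul_mem hx hy
  | add x y hx hy =>
    change gklo r (RingQuot.mkAlgHom Cq _ _) ∈ S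
    rw [map_add, map_add]; exact S.add_mem hx hy

end ShiftedSl2

end

open ShiftedSl2 in
theorem lemma6p10 (r : ℕ) :
    (∃! Φ : U (-(2 * r + 2)) →ₐ[Cq] A (r + 1), IsGKLO r Φ) ∧
    (∃! Υ : UPos →ₗ[Cq] Graded, IsShuffleRealization Υ) ∧
    ∀ (Φ : U (-(2 * r + 2)) →ₐ[Cq] A (r + 1)) (Υ : UPos →ₗ[Cq] Graded),
      IsGKLO r Φ → IsShuffleRealization Υ →
      (∀ n : ℤ, ∃ u : UPos, Υ u = shuffleE (r + 1) n) ∧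
      ∀ (n : ℤ) (u₀ u₁ : UPos),
        Υ u₀ = shuffleE (r + 1) n → Υ u₁ = shuffleE (r + 1) (n + 1) →
        Φ (UPos.toU _ u₀) ∈ Algebra.adjoin Cq
          ((fun p : ℤ => Φ (U.gen _ (.e p))) '' Set.Icc n (n + 2 * r + 1)) ∧
        Φ (UPos.toU _ u₁) ∈ Algebra.adjoin Cq
          ((fun p : ℤ => Φ (U.gen _ (.e p))) '' Set.Icc n (n + 2 * r + 1)) ∧
        IsUnit (Φ (UPos.toU _ u₀)) ∧ IsUnit (Φ (UPos.toU _ u₁)) ∧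
        Algebra.adjoin Cq
          ((fun p : ℤ => Φ (U.gen _ (.e p))) '' Set.Icc n (n + 2 * r + 1) ∪
            {Ring.inverse (Φ (UPos.toU _ u₀)), Ring.inverse (Φ (UPos.toU _ u₁))}) =
          Φ.range := by
  refine ⟨⟨gklo r, isGKLO_gklo r, fun Φ h => h.unique (isGKLO_gklo r)⟩,
    ⟨shuffleReal, isShuffleRealization_shuffleReal, fun Υ h => h.eq_shuffleReal⟩,
    fun Φ Υ hΦ hΥ => ?_⟩
  -- By uniqueness it suffices to treat the two constructed maps.
  obtain rfl := hΦ.unique (isGKLO_gklo r)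
  obtain rfl := hΥ.eq_shuffleReal
  refine ⟨fun n => ⟨_, shuffleReal_eLaurent (r + 1) n⟩, fun n u₀ u₁ h₀ h₁ => ?_⟩
  rw [gklo_toU_eq r h₀, gklo_toU_eq r h₁]
  have he : ∀ (s : Set (A (r + 1))) (p : ℤ), n ≤ p → p ≤ n + 2 * r + 1 →
      A.eOp (r + 1) p ∈ Algebra.adjoin Cq
        ((fun p : ℤ => gklo r (U.gen _ (.e p))) '' Set.Icc n (n + 2 * r + 1) ∪ s) :=
    fun s p h1 h2 => Algebra.subset_adjoin (Or.inl ⟨p, ⟨h1, h2⟩, gklo_gen r (.e p)⟩)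
  have he' : ∀ p : ℤ, n ≤ p → p ≤ n + 2 * r + 1 → A.eOp (r + 1) p ∈ Algebra.adjoin Cq
        ((fun p : ℤ => gklo r (U.gen _ (.e p))) '' Set.Icc n (n + 2 * r + 1)) := fun p h1 h2 => by
    simpa only [Set.union_empty] using he ∅ p h1 h2
  refine ⟨A.eWord_mem fun p h1 h2 => he' p h1 (by omega),
    A.eWord_mem fun p h1 h2 => he' p (by omega) (by omega), ?_, ?_, le_antisymm ?_ ?_⟩
  · rw [A.eWord_top]; exact isUnit_smul_unit (A.topScalar_ne_zero _) _
  · rw [A.eWord_top]; exact isUnit_smul_unit (A.topScalar_ne_zero _) _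
  · refine Algebra.adjoin_le ?_
    rintro x (⟨p, -, rfl⟩ | rfl | rfl)
    · exact ⟨_, rfl⟩
    · exact A.inverse_eWord_mem_range n
    · exact A.inverse_eWord_mem_range (n + 1)
  · exact range_gklo_le fun g => A.genOp_mem (he _)
      (Algebra.subset_adjoin (Or.inr (Or.inl rfl))) (Algebra.subset_adjoin (Or.inr (Or.inr rfl))) g
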